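/- **Bialgebra Reconstruction Theorem (1-categorical).** Let $k$ be an algebraically closed field and let $\mathrm{Vec}$ be the symmetric monoidal category of finite-dimensional $k$-vector spaces. All categories and functors are $k$-linear. A *finite semisimple category* is an abelian $k$-linear category with finite-dimensional Hom spaces and finitely many simple objects up to isomorphism, in which every object is a finite direct sum of simple objects. Let $\mathrm{Slice}$ be the following category. Its objects are pairs $(C,F)$ of a finite semisimple category $C$ and a faithful linear functor $F\colon C\to\mathrm{Vec}$. A morphism $(C,F)\to(C',F')$ is represented by a pair $(T,\tau)$ of a linear functor $T\colon C\to C'$ and a natural isomorphism $\tau\colon F\Rightarrow F'T$; two pairs $(T,\tau)$, $(S,\sigma)$ represent the same morphism if there is a natural isomorphism $\kappa\colon T\Rightarrow S$ with $\sigma=F'\kappa\circ\tau$ (such a $\kappa$ is unique when it exists, because $F'$ is faithful). The Deligne tensor product $\boxtimes$ of finite semisimple categories makes $\mathrm{Slice}$ a symmetric monoidal category: $(C,F)\otimes(C',F')=(C\boxtimes C',\ \otimes\circ(F\boxtimes F'))$, the unit is $(\mathrm{Vec},\mathrm{id})$, the tensor product of morphisms is $(T,\tau)\otimes(T',\tau')=(T\boxtimes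 T',\ \otimes\circ(\tau\boxtimes\tau'))$, and the associator, the unitors and the braiding are the canonical ones, with 2-cells given by the associator, the unitors and the braiding of $\mathrm{Vec}$. Let $\mathrm{Mon}(\mathrm{Slice})$ be the monoidal category of monoids in $\mathrm{Slice}$, and let $\mathrm{Bialg}^{ss}$ be the monoidal category (under $\otimes_k$) of finite-dimensional semisimple bialgebras over $k$ and bialgebra homomorphisms. Then: 1. Every pair $(C,F)\in\mathrm{Slice}$ with $C$ a linear monoidal category and $F$ a (strong) monoidal functor is canonically a monoid in $\mathrm{Slice}$: there is exactly one monoid structure on $(C,F)$ whose multiplication is the morphism $C\boxtimes C\to C$ induced by $c\boxtimes d\mapsto c\otimes d$, with 2-cell the tensorator of $F$, and whose unit is the morphism $\mathrm{Vec}\to C$ with $k\mapsto\mathbf 1_C$, with 2-cell the unit comparison of $F$. With respect to these structures, every morphism represented by a pair $(T,\tau)$ with $T$ a (strong) monoidal functor and $\tau$ a monoidal natural isomorphism is a monoid homomorphism. Every monoid in $\mathrm{Slice}$ is isomorphic, as a monoid, to one of this form. 2. The assignments $A\mapsto(\mathrm{Mod}(A),\mathrm{Forget}_A)$ and $(C,F)\mapsto\mathrm{End}(F)$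 define mutually inverse contravariant monoidal equivalences $(\mathrm{Bialg}^{ss})^{\mathrm{op}}\simeq\mathrm{Mon}(\mathrm{Slice})$. Here $\mathrm{Mod}(A)$ is the category of finite-dimensional $A$-modules, with the standard monoidal structure induced by the comultiplication and the counit of $A$, so that the forgetful functor $\mathrm{Forget}_A\colon\mathrm{Mod}(A)\to\mathrm{Vec}$ is monoidal and $(\mathrm{Mod}(A),\mathrm{Forget}_A)$ is a monoid as in 1; a homomorphism $f\colon A\to B$ goes to restriction along $f$; and the monoidal comparison $\mathrm{Mod}(A)\boxtimes\mathrm{Mod}(B)\to\mathrm{Mod}(A\otimes B)$ sends $V\boxtimes W$ to $V\otimes W$. In the other direction, $\mathrm{End}(F)$ is the algebra of natural endomorphisms of $F$; a morphism represented by $(T,\tau)\colon(C,F)\to(C',F')$ induces $\mathrm{End}(F')\to\mathrm{End}(F)$, $\eta\mapsto\tau^{-1}\circ\eta T\circ\tau$; and the comultiplication and the counit of $\mathrm{End}(F)$, as well as the monoidal structure of $(C,F)\mapsto\mathrm{End}(F)$, are the ones induced by the multiplication and the unit of the monoid $(C,F)$ by means of the canonical isomorphisms $\mathrm{End}(F)\otimes\mathrm{End}(F')\cong\mathrm{End}(\otimes\circ(F\boxtimes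 F'))$ and $k\cong\mathrm{End}(\mathrm{id}_{\mathrm{Vec}})$. -/

import Mathlib

open CategoryTheory MonoidalCategory Limits Opposite
open scoped TensorProduct

universe w u

noncomputable section

namespace BialgebraReconstruction

/-- `Vec`: the symmetric monoidal category of finite-dimensional `k`-vector spaces. -/
abbrev Vec (k : Type u) [Field k] := FGModuleCat.{u} k

/-- A `k`-linear abelian category is *finite semisimple* if its morphism spaces are
finite-dimensional, it has finitely many simple objects up to isomorphism, and every object is a
biproduct of finitely many simple objects. -/
class IsFiniteSemisimple (k : Type u) [Field k] (C : Type*) [Category C] [Abelian C]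
    [Linear k C] : Prop where
  finite_hom : ∀ X Y : C, Module.Finite k (X ⟶ Y)
  finite_simples : ∃ (n : ℕ) (S : Fin n → C), ∀ X : C, Simple X → ∃ i, Nonempty (X ≅ S i)
  semisimple : ∀ X : C, ∃ (n : ℕ) (S : Fin n → C), (∀ i, Simple (S i)) ∧
    ∃ b : Bicone S, Nonempty b.IsBilimit ∧ Nonempty (X ≅ b.pt)

namespace Vec
variable {k : Type u} [Field k]

/-- A vector, as a map from `k`. -/
def span (V : Vec k) (x : V) : FGModuleCat.of k k ⟶ V :=
  FGModuleCat.ofHom (LinearMap.toSpanSingleton k V x)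

theorem span_comp {V W : Vec k} (x : V) (f : V ⟶ W) : span V x ≫ f = span W (f.hom.hom x) := by
  ext
  exact congrArg f.hom.hom (one_smul k x) |>.trans (one_smul k _).symm

theorem span_injective (V : Vec k) : Function.Injective (span V) := fun x y h => by
  have := congrArg (fun f : FGModuleCat.of k k ⟶ V => f.hom.hom (1 : k)) h
  exact (one_smul k x).symm.trans (this.trans (one_smul k y))

theorem span_zero (V : Vec k) : span V 0 = 0 := by
  ext
  exact smul_zero (1 : k)

theorem mono_span {V : Vec k} {x : V} (hx : x ≠ 0) : Mono (span V x) where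
  right_cancellation f g h := by
    ext y
    have := congrArg (fun l : _ ⟶ V => l.hom.hom y) h
    exact smul_left_injective k hx this

theorem exists_ne {V : Vec k} (h : ¬ IsZero V) : ∃ x : V, x ≠ 0 := by
  by_contra! hx
  refine h ((IsZero.iff_id_eq_zero V).2 ?_)
  ext x
  exact hx x

theorem simple_k : Simple (FGModuleCat.of k k) where
  mono_isIso_iff_nonzero {Y} f _ := by
    constructor
    · rintro h rfl
      have e : 𝟙 (FGModuleCat.of k k) = 0 := by
        rw [← IsIso.inv_hom_id (0 : Y ⟶ FGModuleCat.of k k), comp_zero]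
      exact one_ne_zero (congrArg (fun l : FGModuleCat.of k k ⟶ _ => l.hom.hom (1 : k)) e)
    · intro h
      obtain ⟨y, hy⟩ : ∃ y : Y, f.hom.hom y ≠ (0 : k) := by
        by_contra! hy
        exact h (by ext y; exact hy y)
      let g : FGModuleCat.of k k ⟶ Y := span Y ((f.hom.hom y : k)⁻¹ • y)
      have hg : g ≫ f = 𝟙 _ := by
        rw [span_comp]
        ext
        change (1 : k) • f.hom.hom ((f.hom.hom y : k)⁻¹ • y) = (1 : k)
        rw [one_smul, map_smul]
        exact inv_mul_cancel₀ hy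
      refine ⟨g, ?_, hg⟩
      rw [← cancel_mono f, Category.assoc, hg, Category.comp_id, Category.id_comp]

instance : IsFiniteSemisimple k (Vec k) where
  finite_hom X Y := inferInstance
  finite_simples := by
    refine ⟨1, fun _ => FGModuleCat.of k k, fun X hX => ⟨0, ?_⟩⟩
    obtain ⟨x, hx⟩ := exists_ne (Simple.not_isZero X)
    have := mono_span hx
    have := isIso_of_mono_of_nonzero (f := span X x) fun h => hx (span_injective X
      (h.trans (span_zero X).symm))
    exact ⟨(asIso (span X x)).symm⟩
  semisimple X := by
    let B := Module.finBasis k X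
    refine ⟨Module.finrank k X, fun _ => FGModuleCat.of k k, fun _ => simple_k, ?_⟩
    let b : Bicone fun _ : Fin (Module.finrank k X) => FGModuleCat.of k k :=
      { pt := X
        π := fun i => FGModuleCat.ofHom (B.coord i)
        ι := fun i => span X (B i)
        ι_π := by
          intro i j
          rw [span_comp]
          ext
          by_cases h : i = j
          · subst h
            rw [dif_pos rfl]
            change (1 : k) • B.coord i (B i) = (1 : k)
            simp
          · rw [dif_neg h]
            change (1 : k) • B.coord j (B i) = (0 : k)
            simp [h] }
    refine ⟨b, ⟨isBilimitOfTotal b ?_⟩, ⟨Iso.refl X⟩⟩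
    ext x
    have h₁ : ∀ (s : Finset (Fin (Module.finrank k X))) (f : Fin (Module.finrank k X) → (X ⟶ X)),
        (∑ j ∈ s, f j).hom.hom x = ∑ j ∈ s, (f j).hom.hom x := by
      intro s f
      induction s using Finset.induction_on with
      | empty => rfl
      | insert a s ha ih =>
        rw [Finset.sum_insert ha, Finset.sum_insert ha, ← ih]
        rfl
    exact (h₁ _ _).trans (B.sum_repr x)

end Vec

/-- The objects of `Slice`: a finite semisimple `k`-linear category `C` with a faithful linear
functor `F : C ⥤ Vec`. -/
structure Slice (k : Type u) [Field k] where
  C : Type (u + 1)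
  [category : Category.{u} C]
  [abelian : Abelian C]
  [linear : Linear k C]
  [finiteSemisimple : IsFiniteSemisimple k C]
  F : C ⥤ Vec k
  [additive_F : F.Additive]
  [linear_F : F.Linear k]
  [faithful_F : F.Faithful]

attribute [instance] Slice.category Slice.abelian Slice.linear Slice.finiteSemisimple
  Slice.additive_F Slice.linear_F Slice.faithful_F

namespace Slice
variable {k : Type u} [Field k]

/-- A pair `(T, τ)`: a linear functor `T` and a natural isomorphism `τ : F₁ ≅ F₂ ∘ T`. -/
structure PreHom (X Y : Slice k) where
  T : X.C ⥤ Y.C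
  [additive : T.Additive]
  [linear : T.Linear k]
  τ : X.F ≅ T ⋙ Y.F

attribute [instance] PreHom.additive PreHom.linear

/-- A 2-morphism `(T, τ) ⇒ (T', τ')`: a natural transformation `σ : T ⟶ T'` satisfying the
ice cream cone condition. -/
structure Hom₂ {X Y : Slice k} (f g : PreHom X Y) where
  σ : f.T ⟶ g.T
  cone : ∀ c : X.C, f.τ.hom.app c ≫ Y.F.map (σ.app c) = g.τ.hom.app c

/-- There is at most one 2-morphism between two morphisms. -/
theorem Hom₂.eq {X Y : Slice k} {f g : PreHom X Y} (s t : Hom₂ f g) : s = t := by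
  obtain ⟨s, hs⟩ := s
  obtain ⟨t, ht⟩ := t
  have : s = t := by
    ext c
    apply Y.F.map_injective
    rw [← cancel_epi (f.τ.hom.app c), hs, ht]
  subst this
  rfl

/-- Every 2-morphism is invertible. -/
theorem Hom₂.isIso_app {X Y : Slice k} {f g : PreHom X Y} (s : Hom₂ f g) (c : X.C) :
    IsIso (s.σ.app c) := by
  have h : Y.F.map (s.σ.app c) = f.τ.inv.app c ≫ g.τ.hom.app c := by
    rw [← s.cone]; simp
  have : IsIso (Y.F.map (s.σ.app c)) := by rw [h]; infer_instance
  have : Mono (s.σ.app c) := Y.F.mono_of_mono_map inferInstance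
  have : Epi (s.σ.app c) := Y.F.epi_of_epi_map inferInstance
  exact isIso_of_mono_of_epi _

/-- Two morphisms are identified when there is a (necessarily unique and invertible) 2-morphism
between them. -/
instance setoid (X Y : Slice k) : Setoid (PreHom X Y) where
  r f g := Nonempty (Hom₂ f g)
  iseqv :=
    { refl := fun f => ⟨⟨𝟙 _, fun c => by simp⟩⟩
      symm := by
        rintro f g ⟨s⟩
        have := s.isIso_app
        have : IsIso s.σ := NatIso.isIso_of_isIso_app _
        refine ⟨⟨inv s.σ, fun c => ?_⟩⟩
        rw [← s.cone c, Category.assoc, ← Functor.map_comp, NatIso.isIso_inv_app,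
          IsIso.hom_inv_id]
        exact (congrArg _ (Y.F.map_id _)).trans (Category.comp_id _)
      trans := by
        rintro f g h ⟨s⟩ ⟨t⟩
        exact ⟨⟨s.σ ≫ t.σ, fun c => by
          rw [NatTrans.comp_app, Functor.map_comp, ← Category.assoc, s.cone, t.cone]⟩⟩ }

/-- The identity morphism. -/
def PreHom.id (X : Slice k) : PreHom X X where
  T := 𝟭 X.C
  τ := X.F.leftUnitor.symm

/-- Composition of morphisms, by pasting. -/
def PreHom.comp {X Y Z : Slice k} (f : PreHom X Y) (g : PreHom Y Z) : PreHom X Z where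
  T := f.T ⋙ g.T
  τ := f.τ ≪≫ Functor.isoWhiskerLeft f.T g.τ ≪≫ (Functor.associator _ _ _).symm

theorem PreHom.id_app {X : Slice k} (c : X.C) :
    (PreHom.id X).τ.hom.app c = 𝟙 (X.F.obj c) := rfl

theorem PreHom.comp_app {X Y Z : Slice k} (f : PreHom X Y) (g : PreHom Y Z) (c : X.C) :
    (f.comp g).τ.hom.app c = f.τ.hom.app c ≫ g.τ.hom.app (f.T.obj c) := by
  change f.τ.hom.app c ≫ g.τ.hom.app (f.T.obj c) ≫ 𝟙 _ = _
  rw [Category.comp_id]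

theorem comp_aux {V : Type*} [Category V] {a b b' c c' d : V} (x : a ⟶ b) (m : b ⟶ b')
    (y : b ⟶ c) (y' : b' ⟶ c') (n : c ⟶ c') (w : c' ⟶ d) (h : m ≫ y' = y ≫ n) :
    (x ≫ y) ≫ n ≫ w = (x ≫ m) ≫ y' ≫ w := by
  rw [Category.assoc, Category.assoc, ← Category.assoc m, h, Category.assoc]

/-- `Slice` as a 1-category: since there is at most one 2-morphism between two morphisms and it is
invertible, the 2-category of pairs `(C, F)` is equivalent to the category whose morphisms are the
2-isomorphism classes of pairs `(T, τ)`. -/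
instance : Category (Slice k) where
  Hom X Y := Quotient (setoid X Y)
  id X := Quotient.mk _ (PreHom.id X)
  comp {_ _ Z} := Quotient.map₂ PreHom.comp (by
    rintro f f' ⟨s⟩ g g' ⟨t⟩
    refine ⟨⟨s.σ ◫ t.σ, fun c => ?_⟩⟩
    have e : (s.σ ◫ t.σ).app c = g.T.map (s.σ.app c) ≫ t.σ.app (f'.T.obj c) := by
      rw [NatTrans.hcomp_app, t.σ.naturality]
    have n := g.τ.hom.naturality (s.σ.app c)
    rw [PreHom.comp_app, PreHom.comp_app, ← t.cone, ← s.cone c, e]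
    refine (congrArg _ (Z.F.map_comp _ _)).trans ?_
    exact comp_aux _ _ _ _ _ _ n)
  id_comp := by
    rintro X Y ⟨f⟩
    refine Quotient.sound ⟨⟨f.T.leftUnitor.hom, fun c => ?_⟩⟩
    rw [PreHom.comp_app, PreHom.id_app]
    exact (Category.assoc _ _ _).trans ((Category.id_comp _).trans
      ((congrArg _ (Y.F.map_id _)).trans (Category.comp_id _)))
  comp_id := by
    rintro X Y ⟨f⟩
    refine Quotient.sound ⟨⟨f.T.rightUnitor.hom, fun c => ?_⟩⟩
    rw [PreHom.comp_app, PreHom.id_app]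
    exact (congrArg _ (Y.F.map_id _)).trans ((Category.comp_id _).trans (Category.comp_id _))
  assoc := by
    rintro X Y Z W ⟨f⟩ ⟨g⟩ ⟨h⟩
    refine Quotient.sound ⟨⟨(Functor.associator _ _ _).hom, fun c => ?_⟩⟩
    rw [PreHom.comp_app, PreHom.comp_app, PreHom.comp_app, PreHom.comp_app]
    exact (congrArg _ (W.F.map_id _)).trans ((Category.comp_id _).trans (Category.assoc _ _ _))

/-- The morphism of `Slice` represented by `(T, τ)`. -/
def PreHom.toHom {X Y : Slice k} (f : PreHom X Y) : X ⟶ Y := Quotient.mk _ f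

/-- Conjugation by `τ`: the algebra homomorphism `η ↦ τ⁻¹ ∘ (η ∘ T) ∘ τ`. -/
def PreHom.conj {X Y : Slice k} (f : PreHom X Y) : End Y.F →ₐ[k] End X.F where
  toFun η := f.τ.hom ≫ Functor.whiskerLeft f.T η ≫ f.τ.inv
  map_one' := by
    refine NatTrans.ext (funext fun c => ?_)
    change f.τ.hom.app c ≫ 𝟙 _ ≫ f.τ.inv.app c = 𝟙 _
    simp
  map_mul' := fun a b => by
    refine NatTrans.ext (funext fun c => ?_)
    change f.τ.hom.app c ≫ (b.app _ ≫ a.app _) ≫ f.τ.inv.app c =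
      (f.τ.hom.app c ≫ b.app _ ≫ f.τ.inv.app c) ≫ f.τ.hom.app c ≫ a.app _ ≫ f.τ.inv.app c
    simp
  map_zero' := by
    refine NatTrans.ext (funext fun c => ?_)
    change f.τ.hom.app c ≫ 0 ≫ f.τ.inv.app c = 0
    simp
  map_add' := fun a b => by
    refine NatTrans.ext (funext fun c => ?_)
    change f.τ.hom.app c ≫ (a.app _ + b.app _) ≫ f.τ.inv.app c =
      f.τ.hom.app c ≫ a.app _ ≫ f.τ.inv.app c + f.τ.hom.app c ≫ b.app _ ≫ f.τ.inv.app c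
    simp
  commutes' := fun r => by
    refine NatTrans.ext (funext fun c => ?_)
    change f.τ.hom.app c ≫ (r • 𝟙 _) ≫ f.τ.inv.app c = r • 𝟙 _
    simp

theorem PreHom.conj_app {X Y : Slice k} (f : PreHom X Y) (η : End Y.F) (c : X.C) :
    NatTrans.app (f.conj η) c =
      f.τ.hom.app c ≫ NatTrans.app η (f.T.obj c) ≫ f.τ.inv.app c := rfl

/-- The algebra homomorphism `End F₂ → End F₁` induced by a morphism `(C₁, F₁) ⟶ (C₂, F₂)`. -/
def endMap {X Y : Slice k} (f : X ⟶ Y) : End Y.F →ₐ[k] End X.F :=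
  Quotient.lift PreHom.conj (by
    rintro f g ⟨s⟩
    ext η
    refine NatTrans.ext (funext fun c => ?_)
    have e : f.τ.inv.app c = Y.F.map (s.σ.app c) ≫ g.τ.inv.app c := by
      rw [← cancel_epi (f.τ.hom.app c), ← Category.assoc, s.cone]
      simp
    have n : Y.F.map (s.σ.app c) ≫ NatTrans.app η (g.T.obj c) =
        NatTrans.app η (f.T.obj c) ≫ Y.F.map (s.σ.app c) :=
      NatTrans.naturality η (s.σ.app c)
    rw [PreHom.conj_app, PreHom.conj_app, e, ← s.cone c, Category.assoc]
    congr 1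
    exact ((Category.assoc _ _ _).symm.trans (congrArg (· ≫ g.τ.inv.app c) n.symm)).trans
      (Category.assoc _ _ _)) f

end Slice

/-- `a ⊗ b ↦ (a ⊗ b : V ⊗ W ⟶ V ⊗ W)`. -/
def endTensor {k : Type u} [Field k] (V W : Vec k) : End V ⊗[k] End W →ₐ[k] End (V ⊗ W) :=
  Algebra.TensorProduct.lift
    { toFun := fun a : V ⟶ V => (a ▷ W : V ⊗ W ⟶ V ⊗ W)
      map_one' := id_whiskerRight V W
      map_mul' := fun a b => comp_whiskerRight (b : V ⟶ V) (a : V ⟶ V) W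
      map_zero' := MonoidalPreadditive.zero_whiskerRight
      map_add' := fun a b => MonoidalPreadditive.add_whiskerRight (a : V ⟶ V) (b : V ⟶ V)
      commutes' := fun r => by
        change (r • 𝟙 V) ▷ W = r • 𝟙 (V ⊗ W)
        rw [MonoidalLinear.smul_whiskerRight, id_whiskerRight] }
    { toFun := fun b : W ⟶ W => (V ◁ b : V ⊗ W ⟶ V ⊗ W)
      map_one' := whiskerLeft_id V W
      map_mul' := fun a b => whiskerLeft_comp V (b : W ⟶ W) (a : W ⟶ W)
      map_zero' := MonoidalPreadditive.whiskerLeft_zero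
      map_add' := fun a b => MonoidalPreadditive.whiskerLeft_add (a : W ⟶ W) (b : W ⟶ W)
      commutes' := fun r => by
        change V ◁ (r • 𝟙 W) = r • 𝟙 (V ⊗ W)
        rw [MonoidalLinear.whiskerLeft_smul, whiskerLeft_id] }
    (fun a b => whisker_exchange (a : V ⟶ V) (b : W ⟶ W))

theorem endTensor_tmul {k : Type u} [Field k] (V W : Vec k) (a : End V) (b : End W) :
    endTensor V W (a ⊗ₜ b) = ((a : V ⟶ V) ⊗ₘ (b : W ⟶ W)) := by
  refine (Algebra.TensorProduct.lift_tmul _ _ _ _ _).trans ?_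
  exact (tensorHom_def' (a : V ⟶ V) (b : W ⟶ W)).symm

/-- The action `a ⊗ b ↦ r a ⊗ s b` of `A ⊗ B` on `V ⊗ W`. -/
def tensorRep {k : Type u} [Field k] {A B : Type w} [Ring A] [Algebra k A] [Ring B] [Algebra k B]
    {V W : Vec k} (r : A →ₐ[k] End V) (s : B →ₐ[k] End W) : A ⊗[k] B →ₐ[k] End (V ⊗ W) :=
  (endTensor V W).comp (Algebra.TensorProduct.map r s)

section tensorRep

variable {k : Type u} [Field k] {A B C : Type w} [Ring A] [Algebra k A] [Ring B] [Algebra k B]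
  [Ring C] [Algebra k C] {V W U V' W' : Vec k} (r : A →ₐ[k] End V) (s : B →ₐ[k] End W)
  (q : C →ₐ[k] End U)

theorem tensorRep_tmul (a : A) (b : B) : (tensorRep r s (a ⊗ₜ b) : V ⊗ W ⟶ V ⊗ W) =
    ((r a : V ⟶ V) ⊗ₘ (s b : W ⟶ W)) :=
  endTensor_tmul V W (r a) (s b)

theorem tensorRep_add (x y : A ⊗[k] B) : (tensorRep r s (x + y) : V ⊗ W ⟶ V ⊗ W) =
    (tensorRep r s x : V ⊗ W ⟶ V ⊗ W) + (tensorRep r s y : V ⊗ W ⟶ V ⊗ W) :=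
  map_add (tensorRep r s) x y

theorem tensorRep_zero : (tensorRep r s 0 : V ⊗ W ⟶ V ⊗ W) = 0 := map_zero (tensorRep r s)

theorem tensorRep_naturality (r' : A →ₐ[k] End V') (s' : B →ₐ[k] End W') (f : V ⟶ V') (g : W ⟶ W')
    (hf : ∀ a, (r a : V ⟶ V) ≫ f = f ≫ (r' a : V' ⟶ V'))
    (hg : ∀ b, (s b : W ⟶ W) ≫ g = g ≫ (s' b : W' ⟶ W')) (t : A ⊗[k] B) :
    (tensorRep r s t : V ⊗ W ⟶ V ⊗ W) ≫ (f ⊗ₘ g) =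
      (f ⊗ₘ g) ≫ (tensorRep r' s' t : V' ⊗ W' ⟶ V' ⊗ W') := by
  induction t with
  | zero => rw [tensorRep_zero, tensorRep_zero, zero_comp, comp_zero]
  | tmul a b =>
    rw [tensorRep_tmul, tensorRep_tmul, tensorHom_comp_tensorHom, tensorHom_comp_tensorHom,
      hf a, hg b]
  | add x y hx hy =>
    rw [tensorRep_add, tensorRep_add, Preadditive.add_comp, Preadditive.comp_add, hx, hy]

theorem tensorRep_assoc (t : (A ⊗[k] B) ⊗[k] C) :
    (tensorRep (tensorRep r s) q t : (V ⊗ W) ⊗ U ⟶ (V ⊗ W) ⊗ U) ≫ (α_ V W U).hom =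
      (α_ V W U).hom ≫ (tensorRep r (tensorRep s q) (TensorProduct.assoc k A B C t) :
        V ⊗ W ⊗ U ⟶ V ⊗ W ⊗ U) := by
  induction t with
  | zero => rw [LinearEquiv.map_zero, tensorRep_zero, tensorRep_zero, zero_comp, comp_zero]
  | add x y hx hy =>
    rw [LinearEquiv.map_add, tensorRep_add, tensorRep_add, Preadditive.add_comp, Preadditive.comp_add, hx, hy]
  | tmul t c =>
    induction t with
    | zero =>
      rw [TensorProduct.zero_tmul, LinearEquiv.map_zero, tensorRep_zero, tensorRep_zero, zero_comp, comp_zero]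
    | add x y hx hy =>
      rw [TensorProduct.add_tmul, LinearEquiv.map_add, tensorRep_add, tensorRep_add, Preadditive.add_comp,
        Preadditive.comp_add, hx, hy]
    | tmul a b =>
      rw [TensorProduct.assoc_tmul, tensorRep_tmul, tensorRep_tmul, tensorRep_tmul,
        tensorRep_tmul]
      exact associator_naturality _ _ _

theorem tensorRep_comp_left (f : C →ₐ[k] A) (t : C ⊗[k] B) :
    tensorRep (r.comp f) s t = tensorRep r s (f.toLinearMap.rTensor B t) := by
  induction t with
  | zero => rw [map_zero, map_zero, map_zero]
  | add x y hx hy => rw [map_add, map_add, map_add, hx, hy]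
  | tmul a b => rfl

theorem tensorRep_comp_right (f : C →ₐ[k] B) (t : A ⊗[k] C) :
    tensorRep r (s.comp f) t = tensorRep r s (f.toLinearMap.lTensor A t) := by
  induction t with
  | zero => rw [map_zero, map_zero, map_zero]
  | add x y hx hy => rw [map_add, map_add, map_add, hx, hy]
  | tmul a b => rfl

theorem tensorRep_lid (e : C →ₐ[k] k) (t : C ⊗[k] A) :
    (tensorRep ((Algebra.ofId k (End (𝟙_ (Vec k)))).comp e) r t :
        𝟙_ (Vec k) ⊗ V ⟶ 𝟙_ (Vec k) ⊗ V) ≫ (λ_ V).hom =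
      (λ_ V).hom ≫ (r (TensorProduct.lid k A (e.toLinearMap.rTensor A t)) : V ⟶ V) := by
  induction t with
  | zero =>
    rw [LinearMap.map_zero, LinearEquiv.map_zero, map_zero r, tensorRep_zero]
    exact zero_comp.trans comp_zero.symm
  | add x y hx hy =>
    rw [LinearMap.map_add, LinearEquiv.map_add, map_add r, tensorRep_add, Preadditive.add_comp, hx, hy]
    exact (Preadditive.comp_add _ _ _ _ _ _).symm
  | tmul c a =>
    rw [tensorRep_tmul, LinearMap.rTensor_tmul, TensorProduct.lid_tmul, map_smul]
    change ((e c • 𝟙 (𝟙_ (Vec k))) ⊗ₘ (r a : V ⟶ V)) ≫ _ = _ ≫ (e c • (r a : V ⟶ V))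
    rw [MonoidalCategory.tensorHom_def, MonoidalLinear.smul_whiskerRight, id_whiskerRight,
      Linear.smul_comp, Linear.smul_comp, Category.id_comp, leftUnitor_naturality,
      Linear.comp_smul]

theorem tensorRep_rid (e : C →ₐ[k] k) (t : A ⊗[k] C) :
    (tensorRep r ((Algebra.ofId k (End (𝟙_ (Vec k)))).comp e) t :
        V ⊗ 𝟙_ (Vec k) ⟶ V ⊗ 𝟙_ (Vec k)) ≫ (ρ_ V).hom =
      (ρ_ V).hom ≫ (r (TensorProduct.rid k A (e.toLinearMap.lTensor A t)) : V ⟶ V) := by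
  induction t with
  | zero =>
    rw [LinearMap.map_zero, LinearEquiv.map_zero, map_zero r, tensorRep_zero]
    exact zero_comp.trans comp_zero.symm
  | add x y hx hy =>
    rw [LinearMap.map_add, LinearEquiv.map_add, map_add r, tensorRep_add, Preadditive.add_comp, hx, hy]
    exact (Preadditive.comp_add _ _ _ _ _ _).symm
  | tmul a c =>
    rw [tensorRep_tmul, LinearMap.lTensor_tmul, TensorProduct.rid_tmul, map_smul]
    change ((r a : V ⟶ V) ⊗ₘ (e c • 𝟙 (𝟙_ (Vec k)))) ≫ _ = _ ≫ (e c • (r a : V ⟶ V))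
    rw [MonoidalCategory.tensorHom_def, MonoidalLinear.whiskerLeft_smul, whiskerLeft_id,
      Linear.comp_smul, Linear.smul_comp, Category.comp_id, rightUnitor_naturality,
      Linear.comp_smul]

end tensorRep

/-- An object of `Mod(A)`: a finite-dimensional vector space with an action of `A`. -/
structure FDMod (k : Type u) [Field k] (A : Type w) [Ring A] [Algebra k A] where
  V : Vec k
  ρ : A →ₐ[k] End V

namespace FDMod
variable {k : Type u} [Field k] {A : Type w} [Ring A] [Algebra k A]
  {B : Type w} [Ring B] [Algebra k B]

/-- The space of `k`-linear maps commuting with the actions of `A`. -/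
def intertwiners (X Y : FDMod k A) : Submodule k (X.V ⟶ Y.V) where
  carrier := {f | ∀ a : A, (X.ρ a : X.V ⟶ X.V) ≫ f = f ≫ (Y.ρ a : Y.V ⟶ Y.V)}
  zero_mem' := fun a => by rw [comp_zero, zero_comp]
  add_mem' := fun {f g} hf hg a => by rw [Preadditive.comp_add, Preadditive.add_comp, hf a, hg a]
  smul_mem' := fun r f hf a => by rw [Linear.comp_smul, Linear.smul_comp, hf a]

instance : Category.{u} (FDMod k A) where
  Hom X Y := intertwiners X Y
  id X := ⟨𝟙 X.V, fun a => by rw [Category.id_comp, Category.comp_id]⟩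
  comp f g := ⟨f.1 ≫ g.1, fun a => by
    rw [← Category.assoc, f.2 a, Category.assoc, g.2 a, Category.assoc]⟩
  id_comp f := Subtype.ext (Category.id_comp f.1)
  comp_id f := Subtype.ext (Category.comp_id f.1)
  assoc f g h := Subtype.ext (Category.assoc f.1 g.1 h.1)

instance : Preadditive (FDMod k A) where
  homGroup X Y := inferInstanceAs (AddCommGroup (intertwiners X Y))
  add_comp _ _ _ f f' g := Subtype.ext (Preadditive.add_comp _ _ _ f.1 f'.1 g.1)
  comp_add _ _ _ f g g' := Subtype.ext (Preadditive.comp_add _ _ _ f.1 g.1 g'.1)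

instance : Linear k (FDMod k A) where
  homModule X Y := inferInstanceAs (Module k (intertwiners X Y))
  smul_comp _ _ _ r f g := Subtype.ext (Linear.smul_comp _ _ _ r f.1 g.1)
  comp_smul _ _ _ f r g := Subtype.ext (Linear.comp_smul _ _ _ f.1 r g.1)

variable (k A) in
/-- The forgetful functor. -/
def forget : FDMod k A ⥤ Vec k where
  obj X := X.V
  map f := f.1

instance : (forget k A).Additive where
  map_add := rfl

instance : (forget k A).Linear k where
  map_smul _ _ := rfl

instance : (forget k A).Faithful where
  map_injective h := Subtype.ext h

/-- Restriction along an algebra homomorphism. -/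
def restrict (f : A →ₐ[k] B) : FDMod k B ⥤ FDMod k A where
  obj X := ⟨X.V, X.ρ.comp f⟩
  map g := ⟨g.1, fun a => g.2 (f a)⟩

instance (f : A →ₐ[k] B) : (restrict f).Additive where
  map_add := rfl

instance (f : A →ₐ[k] B) : (restrict f).Linear k where
  map_smul _ _ := rfl

/-- The `A ⊗ B`-module `V ⊗ W` of an `A`-module `V` and a `B`-module `W`. -/
def extTensor (X : FDMod k A) (Y : FDMod k B) : FDMod k (A ⊗[k] B) where
  V := X.V ⊗ Y.V
  ρ := tensorRep X.ρ Y.ρ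

/-- A linear isomorphism commuting with the actions gives an isomorphism. -/
def mkIso {X Y : FDMod k A} (e : X.V ≅ Y.V)
    (h : ∀ a : A, (X.ρ a : X.V ⟶ X.V) ≫ e.hom = e.hom ≫ (Y.ρ a : Y.V ⟶ Y.V)) : X ≅ Y where
  hom := ⟨e.hom, h⟩
  inv := ⟨e.inv, fun a => by
    rw [Iso.eq_inv_comp, ← Category.assoc, ← h a, Category.assoc, e.hom_inv_id, Category.comp_id]⟩
  hom_inv_id := Subtype.ext e.hom_inv_id
  inv_hom_id := Subtype.ext e.inv_hom_id

section bialgebra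
variable {H : Type w} [Ring H] [Bialgebra k H]

variable (k H) in
/-- The base field, on which `H` acts through the counit. -/
def trivial : FDMod k H where
  V := 𝟙_ (Vec k)
  ρ := (Algebra.ofId k (End (𝟙_ (Vec k)))).comp (Bialgebra.counitAlgHom k H)

/-- `H` acts on `V ⊗ W` through the comultiplication and on the unit through the counit. -/
instance : MonoidalCategoryStruct (FDMod k H) where
  tensorObj X Y := (restrict (Bialgebra.comulAlgHom k H)).obj (extTensor X Y)
  tensorUnit := trivial k H
  tensorHom {X₁ Y₁ X₂ Y₂} f g := ⟨f.1 ⊗ₘ g.1, fun h =>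
    tensorRep_naturality X₁.ρ X₂.ρ Y₁.ρ Y₂.ρ f.1 g.1 f.2 g.2 (Coalgebra.comul h)⟩
  whiskerLeft X Y Y' g := ⟨X.V ◁ g.1, fun h => by
    rw [← id_tensorHom]
    exact tensorRep_naturality X.ρ Y.ρ X.ρ Y'.ρ (𝟙 X.V) g.1 (𝟙 X :).2 g.2 (Coalgebra.comul h)⟩
  whiskerRight {X X'} f Y := ⟨f.1 ▷ Y.V, fun h => by
    rw [← tensorHom_id]
    exact tensorRep_naturality X.ρ Y.ρ X'.ρ Y.ρ f.1 (𝟙 Y.V) f.2 (𝟙 Y :).2 (Coalgebra.comul h)⟩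
  associator X Y Z := mkIso (α_ X.V Y.V Z.V) fun h => by
    have e := tensorRep_assoc X.ρ Y.ρ Z.ρ
      ((Coalgebra.comul (R := k) (A := H)).rTensor H (Coalgebra.comul h))
    rw [Coalgebra.coassoc_apply] at e
    have e₁ := tensorRep_comp_left (tensorRep X.ρ Y.ρ) Z.ρ (Bialgebra.comulAlgHom k H)
      (Coalgebra.comul h)
    have e₂ := tensorRep_comp_right X.ρ (tensorRep Y.ρ Z.ρ) (Bialgebra.comulAlgHom k H)
      (Coalgebra.comul h)
    exact ((congrArg (· ≫ (α_ X.V Y.V Z.V).hom) e₁).trans e).trans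
      (congrArg ((α_ X.V Y.V Z.V).hom ≫ ·) e₂.symm)
  leftUnitor X := mkIso (λ_ X.V) fun h => by
    have e := tensorRep_lid X.ρ (Bialgebra.counitAlgHom k H) (Coalgebra.comul (R := k) h)
    have e₁ : (Bialgebra.counitAlgHom k H).toLinearMap.rTensor H (Coalgebra.comul (R := k) h) =
      1 ⊗ₜ h := Coalgebra.rTensor_counit_comul h
    rw [e₁, TensorProduct.lid_tmul, one_smul] at e
    exact e
  rightUnitor X := mkIso (ρ_ X.V) fun h => by
    have e := tensorRep_rid X.ρ (Bialgebra.counitAlgHom k H) (Coalgebra.comul (R := k) h)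
    have e₁ : (Bialgebra.counitAlgHom k H).toLinearMap.lTensor H (Coalgebra.comul (R := k) h) =
      h ⊗ₜ 1 := Coalgebra.lTensor_counit_comul h
    rw [e₁, TensorProduct.rid_tmul, one_smul] at e
    exact e

/-- The forgetful functor strictly preserves the tensor product. -/
def forgetData : Monoidal.InducingFunctorData (forget k H) where
  μIso X Y := Iso.refl (X.V ⊗ Y.V)
  εIso := Iso.refl (𝟙_ (Vec k))
  whiskerLeft_eq X _ _ g := by
    change X.V ◁ g.1 = 𝟙 _ ≫ X.V ◁ g.1 ≫ 𝟙 _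
    rw [Category.id_comp, Category.comp_id]
  whiskerRight_eq f Y := by
    change f.1 ▷ Y.V = 𝟙 _ ≫ f.1 ▷ Y.V ≫ 𝟙 _
    rw [Category.id_comp, Category.comp_id]
  tensorHom_eq f g := by
    change f.1 ⊗ₘ g.1 = 𝟙 _ ≫ (f.1 ⊗ₘ g.1) ≫ 𝟙 _
    rw [Category.id_comp, Category.comp_id]
  associator_eq X Y Z := by
    change (α_ X.V Y.V Z.V).hom = (𝟙 ((X.V ⊗ Y.V : Vec k) ⊗ Z.V : Vec k) ≫
      (𝟙 (X.V ⊗ Y.V : Vec k) ⊗ₘ 𝟙 Z.V)) ≫ (α_ X.V Y.V Z.V).hom ≫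
        (𝟙 X.V ⊗ₘ 𝟙 (Y.V ⊗ Z.V : Vec k)) ≫ 𝟙 (X.V ⊗ Y.V ⊗ Z.V : Vec k)
    rw [id_tensorHom_id, id_tensorHom_id, Category.id_comp, Category.id_comp, Category.id_comp,
      Category.comp_id]
  leftUnitor_eq X := by
    change (λ_ X.V).hom = (𝟙 (𝟙_ (Vec k) ⊗ X.V : Vec k) ≫ (𝟙 (𝟙_ (Vec k)) ⊗ₘ 𝟙 X.V)) ≫
      (λ_ X.V).hom
    rw [id_tensorHom_id, Category.id_comp, Category.id_comp]
  rightUnitor_eq X := by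
    change (ρ_ X.V).hom = (𝟙 (X.V ⊗ 𝟙_ (Vec k) : Vec k) ≫ (𝟙 X.V ⊗ₘ 𝟙 (𝟙_ (Vec k)))) ≫
      (ρ_ X.V).hom
    rw [id_tensorHom_id, Category.id_comp, Category.id_comp]

instance : MonoidalCategory (FDMod k H) := Monoidal.induced (forget k H) forgetData

instance : (forget k H).Monoidal := (Monoidal.fromInducedCoreMonoidal _ forgetData).toMonoidal

instance : MonoidalPreadditive (FDMod k H) := monoidalPreadditive_of_faithful (forget k H)

instance : MonoidalLinear k (FDMod k H) := .ofFaithful k (forget k H)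

end bialgebra


section abelian
variable {A : Type u} [Ring A] [Algebra k A]

/-- The underlying `A`-module. -/
def Under (X : FDMod k A) : Type u := X.V

namespace Under
variable (X : FDMod k A)

instance : AddCommGroup X.Under := inferInstanceAs (AddCommGroup X.V)
instance : Module k X.Under := inferInstanceAs (Module k X.V)
instance : Module.Finite k X.Under := inferInstanceAs (Module.Finite k X.V)

/-- The action on the underlying module. -/
def action : A →ₐ[k] Module.End k X.Under where
  toFun a := (X.ρ a : X.V ⟶ X.V).hom.hom
  map_one' := by rw [map_one]; rfl
  map_mul' a b := by rw [map_mul]; rfl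
  map_zero' := by rw [map_zero]; rfl
  map_add' a b := by rw [map_add]; rfl
  commutes' r := by rw [AlgHom.commutes]; rfl

instance : Module A X.Under := Module.compHom X.Under (action X).toRingHom

theorem smul_def (a : A) (x : X.Under) : a • x = action X a x := rfl

instance : IsScalarTower k A X.Under where
  smul_assoc r a x := by rw [smul_def, smul_def, map_smul]; rfl

instance : Module.Finite A X.Under := Module.Finite.of_restrictScalars_finite k A X.Under

end Under

/-- Morphisms are the `A`-linear maps. -/
def homEquiv (X Y : FDMod k A) : (X ⟶ Y) ≃ (X.Under →ₗ[A] Y.Under) where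
  toFun f := { toFun := fun x => f.1.hom.hom x
               map_add' := fun x y => map_add f.1.hom.hom x y
               map_smul' := fun a x => congrArg (fun g : X.V ⟶ Y.V => g.hom.hom x) (f.2 a) }
  invFun g := ⟨FGModuleCat.ofHom (g.restrictScalars k), fun a => by
    ext x
    exact g.map_smul a x⟩
  left_inv f := rfl
  right_inv g := rfl

/-- The object given by an `A`-module. -/
def ofModule (M : Type u) [AddCommGroup M] [Module k M] [Module A M] [IsScalarTower k A M]
    [Module.Finite k M] : FDMod k A where
  V := FGModuleCat.of k M
  ρ := { toFun := fun a => FGModuleCat.ofHom (Algebra.lsmul k k M a)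
         map_one' := by rw [map_one]; rfl
         map_mul' := fun a b => by rw [map_mul]; rfl
         map_zero' := by rw [map_zero]; rfl
         map_add' := fun a b => by rw [map_add]; rfl
         commutes' := fun r => by rw [AlgHom.commutes]; rfl }

/-- The underlying module of `ofModule M` is `M`. -/
def ofModuleEquiv (M : Type u) [AddCommGroup M] [Module k M] [Module A M] [IsScalarTower k A M]
    [Module.Finite k M] : (ofModule (k := k) (A := A) M).Under ≃ₗ[A] M where
  toFun x := x
  invFun x := x
  left_inv _ := rfl
  right_inv _ := rfl
  map_add' _ _ := rfl
  map_smul' _ _ := rfl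

variable (k A) in
/-- The equivalence with finitely generated `A`-modules. -/
def toFG : FDMod k A ⥤ FGModuleCat.{u} A where
  obj X := FGModuleCat.of A X.Under
  map {X Y} f := FGModuleCat.ofHom (homEquiv X Y f)

instance : (toFG k A).Faithful where
  map_injective {X Y} _ _ h := (homEquiv X Y).injective
    (congrArg (fun l : (toFG k A).obj X ⟶ (toFG k A).obj Y => l.hom.hom) h)

instance : (toFG k A).Full where
  map_surjective {X Y} g := ⟨(homEquiv X Y).symm g.hom.hom, rfl⟩

instance [Module.Finite k A] : (toFG k A).EssSurj where
  mem_essImage M := by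
    let _ : Module k M := Module.compHom M (algebraMap k A)
    have _ : IsScalarTower k A M := ⟨fun r a x => by
      rw [Algebra.smul_def, mul_smul]; rfl⟩
    have _ : Module.Finite k M := Module.Finite.trans A M
    exact ⟨ofModule M, ⟨(ofModuleEquiv M).toFGModuleCatIso⟩⟩

instance [Module.Finite k A] : (toFG k A).IsEquivalence where

instance [Module.Finite k A] : HasFiniteProducts (FDMod k A) :=
  haveI : IsNoetherianRing A := isNoetherian_of_tower k (inferInstanceAs (IsNoetherian k A))
  ⟨fun _ => Adjunction.hasLimitsOfShape_of_equivalence (toFG k A)⟩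

instance [Module.Finite k A] : Abelian (FDMod k A) :=
  haveI : IsNoetherianRing A := isNoetherian_of_tower k (inferInstanceAs (IsNoetherian k A))
  abelianOfEquivalence (toFG k A)

/-- An `A`-linear equivalence gives an isomorphism. -/
def isoOfEquiv {X Y : FDMod k A} (e : X.Under ≃ₗ[A] Y.Under) : X ≅ Y where
  hom := (homEquiv X Y).symm e.toLinearMap
  inv := (homEquiv Y X).symm e.symm.toLinearMap
  hom_inv_id := (homEquiv X X).injective (LinearMap.ext e.symm_apply_apply)
  inv_hom_id := (homEquiv Y Y).injective (LinearMap.ext e.apply_symm_apply)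

/-- The linear equivalence of an isomorphism. -/
def equivOfIso {X Y : FDMod k A} (e : X ≅ Y) : X.Under ≃ₗ[A] Y.Under :=
  LinearEquiv.ofLinearMap (homEquiv X Y e.hom) (homEquiv Y X e.inv)
    (congrArg (homEquiv Y Y) e.inv_hom_id) (congrArg (homEquiv X X) e.hom_inv_id)

instance (X : FDMod k A) (N : Submodule A X.Under) : Module.Finite k N :=
  inferInstanceAs (Module.Finite k (N.restrictScalars k))

/-- A submodule as an object. -/
def ofSubmodule {X : FDMod k A} (N : Submodule A X.Under) : FDMod k A := ofModule N

/-- The inclusion of a submodule. -/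
def subtype {X : FDMod k A} (N : Submodule A X.Under) : ofSubmodule N ⟶ X :=
  (homEquiv (ofSubmodule N) X).symm (N.subtype.comp (ofModuleEquiv (k := k) N).toLinearMap)

theorem injective_of_mono {X Y : FDMod k A} (f : X ⟶ Y) [Mono f] :
    Function.Injective (homEquiv X Y f) := by
  rw [← LinearMap.ker_eq_bot, eq_bot_iff]
  intro x hx
  have h : subtype (LinearMap.ker (homEquiv X Y f)) ≫ f = 0 ≫ f := by
    rw [zero_comp]
    exact (homEquiv _ Y).injective (LinearMap.ext fun y => y.2)
  rw [cancel_mono] at h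
  have := congrArg (fun g => homEquiv _ X g ((ofModuleEquiv (k := k)
    (LinearMap.ker (homEquiv X Y f))).symm ⟨x, hx⟩)) h
  exact this

theorem mono_of_injective {X Y : FDMod k A} (f : X ⟶ Y)
    (hf : Function.Injective (homEquiv X Y f)) : Mono f where
  right_cancellation {Z} _ _ e := (homEquiv Z X).injective (LinearMap.ext fun z =>
    hf (LinearMap.congr_fun (congrArg (homEquiv Z Y) e) z))

theorem simple_of_isSimpleModule (X : FDMod k A) [IsSimpleModule A X.Under] : Simple X where
  mono_isIso_iff_nonzero {Y} f _ := by
    constructor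
    · rintro h rfl
      have e : 𝟙 X = 0 := by rw [← IsIso.inv_hom_id (0 : Y ⟶ X), comp_zero]
      have := IsSimpleModule.nontrivial A X.Under
      obtain ⟨x, hx⟩ := exists_ne (0 : X.Under)
      exact hx (LinearMap.congr_fun (congrArg (homEquiv X X) e) x)
    · intro h
      have hs : Function.Surjective (homEquiv Y X f) := LinearMap.surjective_of_ne_zero fun h0 =>
        h ((homEquiv Y X).injective h0)
      exact (isoOfEquiv (LinearEquiv.ofBijective (homEquiv Y X f)
        ⟨injective_of_mono f, hs⟩)).isIso_hom

theorem isSimpleModule_of_simple [IsSemisimpleRing A] (X : FDMod k A) [Simple X] :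
    IsSimpleModule A X.Under := by
  have : Nontrivial X.Under := by
    by_contra h
    rw [not_nontrivial_iff_subsingleton] at h
    exact id_nonzero X ((homEquiv X X).injective (LinearMap.ext fun x => Subsingleton.elim _ _))
  obtain ⟨m, hm⟩ := IsSemisimpleModule.exists_simple_submodule A X.Under
  have : Mono (subtype (k := k) m) := mono_of_injective _ m.injective_subtype
  have hne : subtype (k := k) m ≠ 0 := by
    intro h
    have := IsSimpleModule.nontrivial A m
    obtain ⟨x, hx⟩ := exists_ne (0 : m)
    exact hx (Subtype.ext (LinearMap.congr_fun (congrArg (homEquiv _ X) h) x))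
  have hiso := isIso_of_mono_of_nonzero hne
  exact IsSimpleModule.congr (((ofModuleEquiv (k := k) m).symm.trans
    (equivOfIso (@asIso _ _ _ _ _ hiso))).symm)

instance [Module.Finite k A] [IsSemisimpleRing A] : IsFiniteSemisimple k (FDMod k A) where
  finite_hom X Y := inferInstanceAs (Module.Finite k (intertwiners X Y))
  finite_simples := by
    obtain ⟨n, S, e, hS⟩ := IsSemisimpleModule.exists_linearEquiv_fin_dfinsupp A A
    have hfin : ∀ i, Module.Finite k (S i) := fun i =>
      inferInstanceAs (Module.Finite k ((S i).restrictScalars k))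
    refine ⟨n, fun i => ofModule (S i), fun X hX => ?_⟩
    have hX' := isSimpleModule_of_simple X
    obtain ⟨x, hx⟩ := have := IsSimpleModule.nontrivial A X.Under; exists_ne (0 : X.Under)
    let g : (Π₀ i : Fin n, S i) →ₗ[A] X.Under :=
      (LinearMap.toSpanSingleton A X.Under x).comp e.symm.toLinearMap
    have hg : g ≠ 0 := fun h => hx <| by
      have := LinearMap.congr_fun h (e 1)
      simpa [g] using this
    obtain ⟨i, hi⟩ : ∃ i, g.comp (DFinsupp.lsingle i) ≠ 0 := by
      by_contra! h
      exact hg (DFinsupp.lhom_ext' h)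
    have := LinearMap.bijective_of_ne_zero hi
    exact ⟨i, ⟨isoOfEquiv (((ofModuleEquiv (k := k) (S i)).trans
      (LinearEquiv.ofBijective _ this)).symm)⟩⟩
  semisimple X := by
    obtain ⟨n, S, e, hS⟩ := IsSemisimpleModule.exists_linearEquiv_fin_dfinsupp A X.Under
    refine ⟨n, fun i => ofSubmodule (S i), fun i => ?_, ?_⟩
    · have : IsSimpleModule A (ofSubmodule (S i)).Under := hS i
      exact simple_of_isSimpleModule _
    · let b : Bicone fun i => ofSubmodule (S i) :=
        { pt := X
          π := fun i => (homEquiv X (ofSubmodule (S i))).symm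
            ((ofModuleEquiv (k := k) (S i)).symm.toLinearMap ∘ₗ DFinsupp.lapply i ∘ₗ e.toLinearMap)
          ι := fun i => (homEquiv (ofSubmodule (S i)) X).symm
            (e.symm.toLinearMap ∘ₗ DFinsupp.lsingle i ∘ₗ (ofModuleEquiv (k := k) (S i)).toLinearMap)
          ι_π := by
            intro i j
            refine (homEquiv _ _).injective (LinearMap.ext fun x => ?_)
            change (e (e.symm (DFinsupp.single i _))) j = _
            rw [e.apply_symm_apply]
            by_cases h : i = j
            · subst h
              rw [dif_pos rfl, DFinsupp.single_eq_same]
              rfl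
            · rw [dif_neg h, DFinsupp.single_eq_of_ne (Ne.symm h)]
              rfl }
      refine ⟨b, ⟨isBilimitOfTotal b ?_⟩, ⟨Iso.refl X⟩⟩
      refine (homEquiv X X).injective (LinearMap.ext fun x => ?_)
      have hs : homEquiv X X (∑ j, b.π j ≫ b.ι j) x =
          ∑ j, e.symm (DFinsupp.single j (e x j)) := by
        have h₁ : ∀ (s : Finset (Fin n)) (f : Fin n → (X ⟶ X)),
            homEquiv X X (∑ j ∈ s, f j) x = ∑ j ∈ s, homEquiv X X (f j) x := by
          intro s f
          induction s using Finset.induction_on with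
          | empty => rfl
          | insert a s ha ih =>
            rw [Finset.sum_insert ha, Finset.sum_insert ha, ← ih]
            rfl
        exact h₁ _ _
      refine hs.trans ?_
      rw [← map_sum, LinearEquiv.symm_apply_eq]
      ext j
      rw [DFinsupp.finsetSum_apply, Finset.sum_eq_single j]
      · rw [DFinsupp.single_eq_same]
        rfl
      · intro i _ hij
        rw [DFinsupp.single_eq_of_ne hij.symm]
      · intro h
        exact absurd (Finset.mem_univ j) h

end abelian

end FDMod

namespace Slice

variable (k : Type u) [Field k]

/-- The unit of `Slice`: the identity functor of `Vec`. -/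
def unit : Slice k where
  C := Vec k
  F := 𝟭 (Vec k)

variable {k}

/-- `f.Sends c d p` says that `f` maps the object `c` to `d` by means of the linear map
`p : F₁ c ⟶ F₂ d`: for a representative `(T, τ)` of `f` there is an isomorphism `φ : T c ≅ d` with
`p = F₂ φ ∘ τ_c`. As `F₂` is faithful, `φ` is unique and is natural wherever `p` is, so that this
expresses an (invertible) 2-morphism evaluated at `c`. -/
def Sends {X Y : Slice k} (f : X ⟶ Y) (c : X.C) (d : Y.C) (p : X.F.obj c ⟶ Y.F.obj d) : Prop :=
  ∃ g : PreHom X Y, g.toHom = f ∧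
    ∃ φ : g.T.obj c ≅ d, g.τ.hom.app c ≫ Y.F.map φ.hom = p

end Slice

/-- A bifunctor which is `k`-linear in each variable. -/
structure IsBilinear (k : Type u) [Field k] {C D E : Type*} [Category C] [Category D] [Category E]
    [Preadditive C] [Preadditive D] [Preadditive E] [Linear k C] [Linear k D] [Linear k E]
    (B : C ⥤ D ⥤ E) : Prop where
  additive_right : ∀ c, (B.obj c).Additive
  linear_right : ∀ c, (B.obj c).Linear k
  additive_left : ∀ d, (B.flip.obj d).Additive
  linear_left : ∀ d, (B.flip.obj d).Linear k

/-- The data exhibiting `(P, G)` as the tensor product `(C ⊠ C', ⊗ ∘ (F ⊠ F'))` of `(C, F)` and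
`(C', F')`: a bilinear bifunctor `C × C' → P` with the 2-universal property of the Deligne tensor
product, and a natural isomorphism `F c ⊗ F' c' ≅ G (c ⊠ c')`. -/
structure DeligneProduct {k : Type u} [Field k] (X Y P : Slice k) where
  box : X.C ⥤ Y.C ⥤ P.C
  bilinear : IsBilinear k box
  exists_desc : ∀ (E : Type (u + 1)) [Category.{u} E] [Abelian E] [Linear k E]
    [IsFiniteSemisimple k E] (B : X.C ⥤ Y.C ⥤ E), IsBilinear k B →
    ∃ L : P.C ⥤ E, L.Additive ∧ L.Linear k ∧
      Nonempty (box ⋙ (Functor.whiskeringRight Y.C P.C E).obj L ≅ B)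
  existsUnique_desc : ∀ (E : Type (u + 1)) [Category.{u} E] [Abelian E] [Linear k E]
    [IsFiniteSemisimple k E] (L L' : P.C ⥤ E) [L.Additive] [L.Linear k] [L'.Additive] [L'.Linear k]
    (t : box ⋙ (Functor.whiskeringRight Y.C P.C E).obj L ⟶
      box ⋙ (Functor.whiskeringRight Y.C P.C E).obj L'),
    ∃! s : L ⟶ L', Functor.whiskerLeft box ((Functor.whiskeringRight Y.C P.C E).map s) = t
  fib : ∀ (c : X.C) (d : Y.C), X.F.obj c ⊗ Y.F.obj d ≅ P.F.obj ((box.obj c).obj d)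
  fib_natural : ∀ {c c' : X.C} {d d' : Y.C} (f : c ⟶ c') (g : d ⟶ d'),
    (X.F.map f ⊗ₘ Y.F.map g) ≫ (fib c' d').hom =
      (fib c d).hom ≫ P.F.map ((box.map f).app d ≫ (box.obj c').map g)

open Slice

/-- The symmetric monoidal structure of `Slice` is the one given by the Deligne tensor product:
`(C, F) ⊗ (C', F')` is `(C ⊠ C', ⊗ ∘ (F ⊠ F'))`, the unit is `(Vec, id)`, the tensor product of
`(T, τ)` and `(T', τ')` is `(T ⊠ T', ⊗ ∘ (τ ⊠ τ'))`, and the associator, the unitors and the braiding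
are `(c ⊠ d) ⊠ e ↦ c ⊠ (d ⊠ e)`, `k ⊠ c ↦ c`, `c ⊠ k ↦ c` and `c ⊠ d ↦ d ⊠ c`, with the 2-cells
given by the associator, the unitors and the braiding of `Vec`. By the universal property these
conditions determine each of the morphisms. -/
structure DeligneStructure (k : Type u) [Field k] [MonoidalCategory (Slice k)]
    [SymmetricCategory (Slice k)] where
  prod : ∀ X Y : Slice k, DeligneProduct X Y (X ⊗ Y)
  unitIso : 𝟙_ (Slice k) ≅ Slice.unit k
  tensorHom : ∀ {X X' Y Y' : Slice k} (f : PreHom X X') (g : PreHom Y Y') (c : X.C) (d : Y.C),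
    Sends (f.toHom ⊗ₘ g.toHom) (((prod X Y).box.obj c).obj d)
      (((prod X' Y').box.obj (f.T.obj c)).obj (g.T.obj d))
      (((prod X Y).fib c d).inv ≫ (f.τ.hom.app c ⊗ₘ g.τ.hom.app d) ≫
        ((prod X' Y').fib (f.T.obj c) (g.T.obj d)).hom)
  associator : ∀ (X Y Z : Slice k) (c : X.C) (d : Y.C) (e : Z.C),
    Sends (α_ X Y Z).hom (((prod (X ⊗ Y) Z).box.obj (((prod X Y).box.obj c).obj d)).obj e)
      (((prod X (Y ⊗ Z)).box.obj c).obj (((prod Y Z).box.obj d).obj e))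
      (((prod (X ⊗ Y) Z).fib _ e).inv ≫ ((prod X Y).fib c d).inv ▷ Z.F.obj e ≫
        (α_ (X.F.obj c) (Y.F.obj d) (Z.F.obj e)).hom ≫
          X.F.obj c ◁ ((prod Y Z).fib d e).hom ≫ ((prod X (Y ⊗ Z)).fib c _).hom)
  leftUnitor : ∀ (X : Slice k) (c : X.C) (e : (𝟙_ (Slice k) :).C)
    (q : (𝟙_ (Slice k) :).F.obj e ⟶ 𝟙_ (Vec k)), Sends unitIso.hom e (𝟙_ (Vec k)) q →
    Sends (λ_ X).hom (((prod (𝟙_ (Slice k)) X).box.obj e).obj c) c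
      (((prod (𝟙_ (Slice k)) X).fib e c).inv ≫ q ▷ X.F.obj c ≫ (λ_ (X.F.obj c)).hom)
  rightUnitor : ∀ (X : Slice k) (c : X.C) (e : (𝟙_ (Slice k) :).C)
    (q : (𝟙_ (Slice k) :).F.obj e ⟶ 𝟙_ (Vec k)), Sends unitIso.hom e (𝟙_ (Vec k)) q →
    Sends (ρ_ X).hom (((prod X (𝟙_ (Slice k))).box.obj c).obj e) c
      (((prod X (𝟙_ (Slice k))).fib c e).inv ≫ X.F.obj c ◁ q ≫ (ρ_ (X.F.obj c)).hom)
  braiding : ∀ (X Y : Slice k) (c : X.C) (d : Y.C),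
    Sends (β_ X Y).hom (((prod X Y).box.obj c).obj d) (((prod Y X).box.obj d).obj c)
      (((prod X Y).fib c d).inv ≫ (β_ (X.F.obj c) (Y.F.obj d)).hom ≫ ((prod Y X).fib d c).hom)

/-- An object `(C, F)` of `Slice` where `C` is a linear monoidal category and `F` is a (strong)
monoidal functor. -/
structure FiberFunctor (k : Type u) [Field k] extends Slice k where
  [monoidal : MonoidalCategory C]
  [monoidalPreadditive : MonoidalPreadditive C]
  [monoidalLinear : MonoidalLinear k C]
  [monoidal_F : F.Monoidal]

attribute [instance] FiberFunctor.monoidal FiberFunctor.monoidalPreadditive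
  FiberFunctor.monoidalLinear FiberFunctor.monoidal_F

section

variable {k : Type u} [Field k] [MonoidalCategory (Slice k)] [SymmetricCategory (Slice k)]

/-- `m` is the monoid structure on `(C, F)` given by the monoidal structures of `C` and `F`: the
multiplication `C ⊠ C → C` is `c ⊠ d ↦ c ⊗ d` with the tensorator of `F` as its 2-cell, and the unit
`Vec → C` is `k ↦ 𝟙_ C` with the unit comparison of `F` as its 2-cell. -/
structure IsCanonicalMonoid (D : DeligneStructure k) (X : FiberFunctor k)
    (m : MonObj X.toSlice) : Prop where
  one : ∀ (e : (𝟙_ (Slice k) :).C) (q : (𝟙_ (Slice k) :).F.obj e ⟶ 𝟙_ (Vec k)),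
    Sends D.unitIso.hom e (𝟙_ (Vec k)) q →
    Sends m.one e (𝟙_ X.C) (q ≫ Functor.LaxMonoidal.ε X.F)
  mul : ∀ c d : X.C,
    Sends m.mul (((D.prod X.toSlice X.toSlice).box.obj c).obj d) (c ⊗ d)
      (((D.prod X.toSlice X.toSlice).fib c d).inv ≫ Functor.LaxMonoidal.μ X.F c d)

end

section mod

variable (k : Type u) [Field k] [IsAlgClosed k]

theorem isSemisimpleRing_tensorProduct (A B : Type u) [Ring A] [Algebra k A] [Module.Finite k A]
    [IsSemisimpleRing A] [Ring B] [Algebra k B] [Module.Finite k B] [IsSemisimpleRing B] :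
    IsSemisimpleRing (A ⊗[k] B) := by
  obtain ⟨m, d, _, ⟨e⟩⟩ := IsSemisimpleRing.exists_algEquiv_pi_matrix_of_isAlgClosed k A
  obtain ⟨n, d', _, ⟨e'⟩⟩ := IsSemisimpleRing.exists_algEquiv_pi_matrix_of_isAlgClosed k B
  have h : ∀ i, IsSemisimpleRing
      (Matrix (Fin (d i)) (Fin (d i)) k ⊗[k] Π j, Matrix (Fin (d' j)) (Fin (d' j)) k) := fun i =>
    have h' : ∀ j, IsSemisimpleRing
        (Matrix (Fin (d i)) (Fin (d i)) k ⊗[k] Matrix (Fin (d' j)) (Fin (d' j)) k) := fun j =>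
      (Matrix.kroneckerAlgEquiv (Fin (d i)) (Fin (d' j)) k).symm.toRingEquiv.isSemisimpleRing
    (Algebra.TensorProduct.piRight k k _
      fun j => Matrix (Fin (d' j)) (Fin (d' j)) k).symm.toRingEquiv.isSemisimpleRing
  have h₂ : ∀ i, IsSemisimpleRing
      ((Π j, Matrix (Fin (d' j)) (Fin (d' j)) k) ⊗[k] Matrix (Fin (d i)) (Fin (d i)) k) := fun i =>
    (Algebra.TensorProduct.comm k _ _).toRingEquiv.isSemisimpleRing
  have h₃ := (Algebra.TensorProduct.piRight k k (Π j, Matrix (Fin (d' j)) (Fin (d' j)) k)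
      fun i => Matrix (Fin (d i)) (Fin (d i)) k).symm.toRingEquiv.isSemisimpleRing
  exact ((Algebra.TensorProduct.comm k _ _).trans
    (Algebra.TensorProduct.congr e.symm e'.symm)).toRingEquiv.isSemisimpleRing

/-- Finite-dimensional semisimple bialgebras. -/
def isSemisimpleBialg : ObjectProperty (BialgCat.{u} k) :=
  fun A => Module.Finite k A ∧ IsSemisimpleRing A

instance : (isSemisimpleBialg k).IsMonoidal where
  prop_unit := ⟨inferInstanceAs (Module.Finite k k), inferInstanceAs (IsSemisimpleRing k)⟩
  prop_tensor A B hA hB := by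
    have := hA.1
    have := hA.2
    have := hB.1
    have := hB.2
    exact ⟨inferInstanceAs (Module.Finite k (A ⊗[k] B)),
      isSemisimpleRing_tensorProduct k A B⟩

/-- The monoidal category of finite-dimensional semisimple bialgebras and bialgebra homomorphisms,
under the tensor product. -/
abbrev SSBialg := (isSemisimpleBialg k).FullSubcategory

variable {k}

instance (A : SSBialg k) : Module.Finite k A.obj := A.property.1
instance (A : SSBialg k) : IsSemisimpleRing A.obj := A.property.2

/-- `(Mod(A), Forget)` with the monoidal structure given by the comultiplication of `A`. -/
def modFiber (A : SSBialg k) : FiberFunctor k where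
  C := FDMod k A.obj
  F := FDMod.forget k A.obj

/-- Restriction of modules along `f : A ⟶ B`, as a pair `(T, τ)` with `τ` the identity. -/
def modMap {A B : SSBialg k} (f : A ⟶ B) :
    PreHom (modFiber B).toSlice (modFiber A).toSlice where
  T := FDMod.restrict (f.hom.toBialgHom : A.obj →ₐ[k] B.obj)
  additive := inferInstanceAs (FDMod.restrict (f.hom.toBialgHom : A.obj →ₐ[k] B.obj)).Additive
  linear := inferInstanceAs ((FDMod.restrict (f.hom.toBialgHom : A.obj →ₐ[k] B.obj)).Linear k)
  τ := Iso.refl (FDMod.forget k B.obj)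

variable (k) in
/-- The contravariant functor `A ↦ (Mod(A), Forget)`. -/
def modFunctor : (SSBialg k)ᵒᵖ ⥤ Slice k where
  obj A := (modFiber A.unop).toSlice
  map f := (modMap f.unop).toHom
  map_id A := Quotient.sound ⟨⟨𝟙 (𝟭 (FDMod k A.unop.obj)), fun _ => rfl⟩⟩
  map_comp f g := Quotient.sound ⟨⟨𝟙 (modMap (f ≫ g).unop).T, fun _ => rfl⟩⟩

variable [MonoidalCategory (Slice k)] [SymmetricCategory (Slice k)]

/-- `Φ` is the monoidal functor `A ↦ (Mod(A), Forget)`, up to natural isomorphism: the monoid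
structure of `Φ A` is the one given by the standard monoidal structure on `Mod(A)`, and the
comparison `Φ A ⊗ Φ B ⟶ Φ (A ⊗ B)` sends `V ⊠ W` to the `A ⊗ B`-module `V ⊗ W`. -/
def IsModFunctor (D : DeligneStructure k) (Φ : (SSBialg k)ᵒᵖ ⥤ Mon (Slice k)) [Φ.Monoidal] :
    Prop :=
  ∃ ν : Φ ⋙ Mon.forget (Slice k) ≅ modFunctor k,
    (∀ A : SSBialg k, ∃ m : MonObj (modFiber A).toSlice, IsCanonicalMonoid D (modFiber A) m ∧
      IsMonHom (M := (Φ.obj (op A)).X) (N := (modFiber A).toSlice) (ν.hom.app (op A))) ∧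
    ∀ (A B : SSBialg k) (V : FDMod k A.obj) (W : FDMod k B.obj),
      Sends (X := (modFiber A).toSlice ⊗ (modFiber B).toSlice) (Y := (modFiber (A ⊗ B)).toSlice)
        ((ν.inv.app (op A) ⊗ₘ ν.inv.app (op B)) ≫
          (Functor.LaxMonoidal.μ Φ (op A) (op B)).hom ≫ ν.hom.app (op A ⊗ op B))
        (((D.prod (modFiber A).toSlice (modFiber B).toSlice).box.obj V).obj W)
        (FDMod.extTensor V W)
        ((D.prod (modFiber A).toSlice (modFiber B).toSlice).fib V W).inv

end mod

section endFunctor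

variable {k : Type u} [Field k] [IsAlgClosed k]

/-- The evaluation `End F → End (F c)` at an object `c`. -/
def leg (X : Slice k) (c : X.C) : End X.F →ₐ[k] End (X.F.obj c) where
  toFun η := NatTrans.app η c
  map_one' := rfl
  map_mul' _ _ := rfl
  map_zero' := rfl
  map_add' _ _ := rfl
  commutes' _ := rfl

variable [MonoidalCategory (Slice k)] [SymmetricCategory (Slice k)]

/-- `Ψ` is the monoidal functor `(C, F) ↦ End(F)`, up to natural isomorphism (of algebras). The
comultiplication and the counit of `End(F)` are induced by the multiplication and the unit of the
monoid `(C, F)` by means of the canonical maps `End(F) ⊗ End(F') → End(⊗ ∘ (F ⊠ F'))` and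
`k → End(id)`, and the monoidal structure of `Ψ` is given by the former. -/
def IsEndFunctor (D : DeligneStructure k) (Ψ : Mon (Slice k) ⥤ (SSBialg k)ᵒᵖ) [Ψ.Monoidal] :
    Prop :=
  ∃ e : ∀ M : Mon (Slice k), (Ψ.obj M).unop.obj ≃ₐ[k] End M.X.F,
    (∀ (M N : Mon (Slice k)) (f : M ⟶ N) (b : (Ψ.obj N).unop.obj),
      e M ((Ψ.map f).unop.hom.toBialgHom b) = endMap f.hom (e N b)) ∧
    (∀ (M : Mon (Slice k)) (b : (Ψ.obj M).unop.obj) (c d : M.X.C),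
      ((D.prod M.X M.X).fib c d).hom ≫
          NatTrans.app (endMap (MonObj.mul (X := M.X)) (e M b)) (((D.prod M.X M.X).box.obj c).obj d) =
        (tensorRep ((leg M.X c).comp (e M).toAlgHom) ((leg M.X d).comp (e M).toAlgHom)
          (Coalgebra.comul (R := k) b) : M.X.F.obj c ⊗ M.X.F.obj d ⟶ M.X.F.obj c ⊗ M.X.F.obj d) ≫
          ((D.prod M.X M.X).fib c d).hom) ∧
    (∀ (M : Mon (Slice k)) (b : (Ψ.obj M).unop.obj),
      endMap (MonObj.one (X := M.X)) (e M b) =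
        algebraMap k (End (𝟙_ (Slice k) :).F) (Coalgebra.counit (R := k) b)) ∧
    ∀ (M N : Mon (Slice k)) (b : (Ψ.obj (M ⊗ N)).unop.obj) (c : M.X.C) (d : N.X.C),
      ((D.prod M.X N.X).fib c d).hom ≫
          NatTrans.app (e (M ⊗ N) b) (((D.prod M.X N.X).box.obj c).obj d) =
        (tensorRep ((leg M.X c).comp (e M).toAlgHom) ((leg N.X d).comp (e N).toAlgHom)
          ((Functor.LaxMonoidal.μ Ψ M N).unop.hom.toBialgHom b) :
            M.X.F.obj c ⊗ N.X.F.obj d ⟶ M.X.F.obj c ⊗ N.X.F.obj d) ≫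
          ((D.prod M.X N.X).fib c d).hom

end endFunctor

end BialgebraReconstruction

end

open BialgebraReconstruction BialgebraReconstruction.Slice

/-!
The fibre functor `F` of an object `(C, F)` of `Slice` is represented by a generator `G` of `C`, the
sum of the simple objects with multiplicities the dimensions of their fibres. Hence `F(G)` is a free
module of rank one over `End F`, and `End F` is a finite-dimensional semisimple algebra
(`Slice.exists_universal_and_model`). From this follows Tannaka reconstruction: linear maps between
fibres which commute with `End F` come from morphisms of `C` (`Slice.exists_map_eq`), and every
finite-dimensional representation of `End F` is a fibre (`Slice.exists_fiber_iso`). So morphisms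
`X ⟶ Y` in `Slice` are the same as algebra homomorphisms `End Y.F → End X.F` (`endMap_injective`,
`endMap_surjective`), and the condition that a morphism sends `c` to `d` by means of a 2-cell `p`
says that `p` is an equivariant isomorphism (`sends_iff`).

If `A` and `B` are the endomorphism algebras of `F` and `F'`, the category of `A ⊗ B`-modules is a
Deligne tensor product (`deligneProductOfModels`), because additive functors and natural
transformations are determined, and can be prescribed, on a generator. For any Deligne tensor
product the endomorphism algebra is the tensor product of those of the factors
(`DeligneProduct.theta`). The symmetric monoidal structure of `Slice` is therefore obtained from
that of algebras (`sliceMonoidal`, `sliceSymmetric`, `sliceDeligneStructure`), and conversely the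
structure morphisms of any Deligne structure act on pure tensors as expected
(`DeligneStructure.endMap_tensorHom`, `DeligneStructure.endMap_associator`, …).

Consequently a monoid structure on `(C, F)` is the same as a bialgebra structure on `End F`
(`DeligneStructure.IsDual`, `DeligneStructure.dualBialgebra`), and monoid homomorphisms are dual to
bialgebra homomorphisms (`DeligneStructure.IsDual.isMonHom_iff`). A monoidal fibre functor gives a
monoid because a morphism of `Slice` is determined by where it sends one representing object
(`Slice.Sends.unique`), so that the monoid axioms reduce to the coherence axioms of the functor
(`FiberFunctor.exists_isCanonicalMonoid`). Since `A` is the endomorphism algebra of the forgetful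
functor of `Mod(A)`, and dual to its canonical monoid (`DeligneStructure.isDual_modMon`), the
functor `A ↦ (Mod(A), Forget)` is a monoidal equivalence; the description of its inverse as `(C, F) ↦ End F`
is read off from the counit (`DeligneStructure.isEndFunctor`).
-/

noncomputable section

namespace BialgebraReconstruction

/-! ### Generators of additive categories -/

section Generators

variable {C : Type*} [Category C] [Preadditive C] {E : Type*} [Category E] [Preadditive E]

/-- An object `G` *generates* if every object is a retract of a finite power of `G`; the retraction
is written out in components, so that no biproducts are needed. -/
def Generates (G : C) : Prop :=
  ∀ c : C, ∃ (n : ℕ) (a : Fin n → (c ⟶ G)) (b : Fin n → (G ⟶ c)), ∑ i, a i ≫ b i = 𝟙 c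

/-- A natural transformation of additive functors is determined by its component at a generator. -/
theorem Generates.natTrans_ext {G : C} (hG : Generates G) {L L' : C ⥤ E} [L.Additive]
    {s t : L ⟶ L'} (h : s.app G = t.app G) : s = t := by
  ext c
  obtain ⟨n, a, b, hab⟩ := hG c
  have key : ∀ s : L ⟶ L', s.app c = ∑ i, L.map (a i) ≫ s.app G ≫ L'.map (b i) := fun s => by
    conv_lhs => rw [← Category.id_comp (s.app c), ← L.map_id, ← hab, L.map_sum,
      Preadditive.sum_comp]
    refine Finset.sum_congr rfl fun i _ => ?_
    rw [L.map_comp, Category.assoc, s.naturality]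
  rw [key s, key t, h]

/-- A morphism `L G ⟶ L' G` commuting with the endomorphisms of a generator `G` extends to a natural
transformation. -/
theorem Generates.exists_natTrans {G : C} (hG : Generates G) (L L' : C ⥤ E) [L.Additive]
    [L'.Additive] (t : L.obj G ⟶ L'.obj G) (ht : ∀ f : G ⟶ G, L.map f ≫ t = t ≫ L'.map f) :
    ∃ s : L ⟶ L', s.app G = t := by
  choose n a b hab using hG
  have hnat : ∀ {c d : C} (f : c ⟶ d),
      L.map f ≫ (∑ j, L.map (a d j) ≫ t ≫ L'.map (b d j)) =
        (∑ i, L.map (a c i) ≫ t ≫ L'.map (b c i)) ≫ L'.map f := fun {c d} f => by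
    have h₁ : L.map f ≫ (∑ j, L.map (a d j) ≫ t ≫ L'.map (b d j)) =
        ∑ j, ∑ i, L.map (a c i) ≫ t ≫ L'.map (b c i ≫ f ≫ a d j ≫ b d j) := by
      rw [Preadditive.comp_sum]
      refine Finset.sum_congr rfl fun j _ => ?_
      conv_lhs => rw [← Category.id_comp f, ← hab c, Preadditive.sum_comp, L.map_sum,
        Preadditive.sum_comp]
      refine Finset.sum_congr rfl fun i _ => ?_
      have := ht (b c i ≫ f ≫ a d j)
      simp only [Functor.map_comp, Category.assoc] at this ⊢
      rw [reassoc_of% this]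
    have h₂ : (∑ i, L.map (a c i) ≫ t ≫ L'.map (b c i)) ≫ L'.map f =
        ∑ i, ∑ j, L.map (a c i) ≫ t ≫ L'.map (b c i ≫ f ≫ a d j ≫ b d j) := by
      rw [Preadditive.sum_comp]
      refine Finset.sum_congr rfl fun i _ => ?_
      rw [← Preadditive.comp_sum, ← Preadditive.comp_sum, ← L'.map_sum, ← Preadditive.comp_sum,
        ← Preadditive.comp_sum, hab d, Category.comp_id, L'.map_comp, Category.assoc,
        Category.assoc]
    rw [h₁, h₂, Finset.sum_comm]
  refine ⟨{ app := fun c => ∑ i, L.map (a c i) ≫ t ≫ L'.map (b c i)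
            naturality := fun _ _ f => hnat f }, ?_⟩
  change ∑ i, L.map (a G i) ≫ t ≫ L'.map (b G i) = t
  have : ∀ i, L.map (a G i) ≫ t ≫ L'.map (b G i) = L.map (a G i ≫ b G i) ≫ t := fun i => by
    rw [L.map_comp, Category.assoc, ht]
  simp_rw [this]
  rw [← Preadditive.sum_comp, ← L.map_sum, hab, L.map_id, Category.id_comp]

/-- An idempotent matrix of endomorphisms of `x` splits. -/
theorem exists_splitting [HasFiniteBiproducts E] [IsIdempotentComplete E] {n : ℕ} {x : E}
    (e : Fin n → Fin n → (x ⟶ x)) (he : ∀ i j, ∑ l, e i l ≫ e l j = e i j) :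
    ∃ (y : E) (a : Fin n → (y ⟶ x)) (b : Fin n → (x ⟶ y)),
      ∑ i, a i ≫ b i = 𝟙 y ∧ ∀ i j, b i ≫ a j = e i j := by
  let p : (⨁ fun _ : Fin n => x) ⟶ (⨁ fun _ : Fin n => x) := biproduct.matrix e
  have hp : p ≫ p = p := by
    ext i j
    have h : biproduct.ι (fun _ : Fin n => x) j ≫ p =
        ∑ l, e j l ≫ biproduct.ι (fun _ : Fin n => x) l := by
      ext l
      simp [p, Preadditive.sum_comp, biproduct.ι_π, comp_ite]
    simp only [Category.assoc]
    rw [reassoc_of% h, Preadditive.sum_comp]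
    simp [p, he]
  obtain ⟨y, i, r, hir, hri⟩ := IsIdempotentComplete.idempotents_split _ p hp
  refine ⟨y, fun j => i ≫ biproduct.π _ j, fun j => biproduct.ι (fun _ : Fin n => x) j ≫ r, ?_,
    fun j l => ?_⟩
  · have : ∀ j, (i ≫ biproduct.π _ j) ≫ biproduct.ι (fun _ : Fin n => x) j ≫ r =
        i ≫ (biproduct.π _ j ≫ biproduct.ι (fun _ : Fin n => x) j) ≫ r := fun j => by
      simp only [Category.assoc]
    simp_rw [this]
    rw [← Preadditive.comp_sum, ← Preadditive.sum_comp, biproduct.total, Category.id_comp, hir]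
  · rw [Category.assoc, reassoc_of% hri]
    simp [p]

/-- A linear functor may be prescribed on the endomorphisms of a generator. -/
theorem Generates.exists_functor {k : Type*} [Field k] [Linear k C] [Linear k E]
    [HasFiniteBiproducts E] [IsIdempotentComplete E] {G : C} (hG : Generates G) {x : E}
    (r : (G ⟶ G) →ₗ[k] (x ⟶ x)) (r_id : r (𝟙 G) = 𝟙 x)
    (r_comp : ∀ f g : G ⟶ G, r (f ≫ g) = r f ≫ r g) :
    ∃ L : C ⥤ E, L.Additive ∧ L.Linear k ∧ ∃ φ : L.obj G ≅ x,
      ∀ f : G ⟶ G, L.map f ≫ φ.hom = φ.hom ≫ r f := by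
  choose n a b hab using hG
  have key : ∀ c, ∃ (y : E) (α : Fin (n c) → (y ⟶ x)) (β : Fin (n c) → (x ⟶ y)),
      ∑ i, α i ≫ β i = 𝟙 y ∧ ∀ i j, β i ≫ α j = r (b c i ≫ a c j) := fun c => by
    refine exists_splitting (fun i j => r (b c i ≫ a c j)) fun i j => ?_
    have : ∀ l, r (b c i ≫ a c l) ≫ r (b c l ≫ a c j) =
        r (b c i ≫ (a c l ≫ b c l) ≫ a c j) := fun l => by
      rw [← r_comp, Category.assoc, Category.assoc]
    simp_rw [this]
    rw [← map_sum, ← Preadditive.comp_sum, ← Preadditive.sum_comp, hab, Category.id_comp]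
  choose y α β hαβ hβα using key
  let L : C ⥤ E :=
    { obj := y
      map := fun {c d} f => ∑ i, ∑ j, α c i ≫ r (b c i ≫ f ≫ a d j) ≫ β d j
      map_id := fun c => by
        have : ∀ i j, α c i ≫ r (b c i ≫ 𝟙 c ≫ a c j) ≫ β c j =
            (α c i ≫ β c i) ≫ (α c j ≫ β c j) := fun i j => by
          rw [Category.id_comp, ← hβα]; simp only [Category.assoc]
        simp_rw [this, ← Preadditive.comp_sum, ← Preadditive.sum_comp, hαβ, Category.id_comp]
      map_comp := fun {c d e} f g => by
        simp only [Preadditive.sum_comp, Preadditive.comp_sum, Category.assoc]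
        have h₁ : ∀ l m i j, α c i ≫ r (b c i ≫ f ≫ a d j) ≫ β d j ≫ α d l ≫
            r (b d l ≫ g ≫ a e m) ≫ β e m =
            α c i ≫ r (b c i ≫ f ≫ (a d j ≫ b d j) ≫ (a d l ≫ b d l) ≫ g ≫ a e m) ≫ β e m := by
          intro l m i j
          rw [reassoc_of% hβα d j l, ← reassoc_of% r_comp, ← reassoc_of% r_comp]
          simp only [Category.assoc]
        have h₂ : ∀ l m i, ∑ j, α c i ≫ r (b c i ≫ f ≫ (a d j ≫ b d j) ≫ (a d l ≫ b d l) ≫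
            g ≫ a e m) ≫ β e m = α c i ≫ r (b c i ≫ f ≫ (a d l ≫ b d l) ≫ g ≫ a e m) ≫ β e m := by
          intro l m i
          rw [← Preadditive.comp_sum, ← Preadditive.sum_comp, ← map_sum, ← Preadditive.comp_sum,
            ← Preadditive.comp_sum, ← Preadditive.sum_comp, hab, Category.id_comp]
        simp_rw [h₁, h₂]
        symm
        rw [Finset.sum_congr rfl fun l _ => Finset.sum_comm, Finset.sum_comm]
        refine Finset.sum_congr rfl fun i _ => ?_
        rw [Finset.sum_comm]
        refine Finset.sum_congr rfl fun m _ => ?_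
        rw [← Preadditive.comp_sum, ← Preadditive.sum_comp, ← map_sum, ← Preadditive.comp_sum,
          ← Preadditive.comp_sum, ← Preadditive.sum_comp, hab, Category.id_comp] }
  refine ⟨L, ⟨fun {c d f g} => ?_⟩, ⟨fun {c d} f s => ?_⟩, ?_⟩
  · simp [L, Finset.sum_add_distrib]
  · simp [L, Finset.smul_sum]
  · refine ⟨⟨∑ i, α G i ≫ r (b G i), ∑ i, r (a G i) ≫ β G i, ?_, ?_⟩, fun f => ?_⟩
    · rw [Preadditive.sum_comp]
      have : ∀ i, (α G i ≫ r (b G i)) ≫ ∑ j, r (a G j) ≫ β G j =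
          ∑ j, (α G i ≫ β G i) ≫ (α G j ≫ β G j) := fun i => by
        rw [Preadditive.comp_sum]
        refine Finset.sum_congr rfl fun j _ => ?_
        simp only [Category.assoc]
        rw [reassoc_of% hβα, ← reassoc_of% r_comp]
      simp_rw [this, ← Preadditive.comp_sum, ← Preadditive.sum_comp, hαβ, Category.id_comp]
      rfl
    · rw [Preadditive.sum_comp]
      have : ∀ i, (r (a G i) ≫ β G i) ≫ ∑ j, α G j ≫ r (b G j) =
          ∑ j, r (a G i ≫ b G i) ≫ r (a G j ≫ b G j) := fun i => by
        rw [Preadditive.comp_sum]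
        refine Finset.sum_congr rfl fun j _ => ?_
        simp only [Category.assoc]
        rw [reassoc_of% hβα, ← r_comp, ← r_comp, ← r_comp]
        simp only [Category.assoc]
      simp_rw [this, ← Preadditive.comp_sum, ← Preadditive.sum_comp, ← map_sum, hab, r_id,
        Category.id_comp]
    · change (∑ i, ∑ j, α G i ≫ r (b G i ≫ f ≫ a G j) ≫ β G j) ≫ (∑ l, α G l ≫ r (b G l)) = _
      have : ∀ i j, (α G i ≫ r (b G i ≫ f ≫ a G j) ≫ β G j) ≫ (∑ l, α G l ≫ r (b G l)) =
          α G i ≫ r (b G i ≫ f ≫ a G j ≫ b G j) := fun i j => by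
        rw [Preadditive.comp_sum]
        have : ∀ l, (α G i ≫ r (b G i ≫ f ≫ a G j) ≫ β G j) ≫ α G l ≫ r (b G l) =
            α G i ≫ r (b G i ≫ f ≫ a G j ≫ b G j ≫ a G l ≫ b G l) := fun l => by
          simp only [Category.assoc]
          rw [reassoc_of% hβα, ← r_comp, ← r_comp]
          simp only [Category.assoc]
        simp_rw [this, ← Preadditive.comp_sum, ← map_sum, ← Preadditive.comp_sum, hab,
          Category.comp_id]
      simp_rw [Preadditive.sum_comp, this, ← Preadditive.comp_sum, ← map_sum,
        ← Preadditive.comp_sum, hab, Category.comp_id, r_comp, Category.assoc]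

end Generators

end BialgebraReconstruction

end
noncomputable section

namespace BialgebraReconstruction

/-! ### Universal elements of fibre functors -/

namespace Vec

variable {k : Type u} [Field k] {V W : Vec k}

theorem hom_ext_apply {f g : V ⟶ W} (h : ∀ x : V, f.hom.hom x = g.hom.hom x) : f = g := by
  ext x
  exact h x

theorem sum_apply {ι : Type*} (s : Finset ι) (f : ι → (V ⟶ W)) (x : V) :
    (∑ j ∈ s, f j).hom.hom x = ∑ j ∈ s, (f j).hom.hom x := by
  classical
  induction s using Finset.induction_on with
  | empty => rfl
  | insert a s ha ih =>
    rw [Finset.sum_insert ha, Finset.sum_insert ha, ← ih]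
    rfl

end Vec

section Simples

variable {k : Type u} [Field k] {C : Type*} [Category C] [Abelian C] [Linear k C]

variable (k C) in
theorem exists_simple_representatives [IsFiniteSemisimple k C] :
    ∃ (ι : Type) (_ : Fintype ι) (S : ι → C), (∀ i, Simple (S i)) ∧
      (∀ i j, Nonempty (S i ≅ S j) → i = j) ∧ ∀ X : C, Simple X → ∃ i, Nonempty (X ≅ S i) := by
  classical
  obtain ⟨n, S, hS⟩ := IsFiniteSemisimple.finite_simples (k := k) (C := C)
  -- in each isomorphism class of simple objects the one of least index is kept
  refine ⟨{i : Fin n // Simple (S i) ∧ ∀ j < i, ¬ Nonempty (S j ≅ S i)}, inferInstance,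
    fun i => S i.1, fun i => i.2.1, ?_, fun X hX => ?_⟩
  · rintro ⟨i, _, hi⟩ ⟨j, _, hj⟩ ⟨e⟩
    rcases lt_trichotomy i j with h | h | h
    · exact (hj i h ⟨e⟩).elim
    · exact Subtype.ext h
    · exact (hi j h ⟨e.symm⟩).elim
  · have hne : (Finset.univ.filter fun i => Nonempty (X ≅ S i)).Nonempty := by
      obtain ⟨i, hi⟩ := hS X hX
      exact ⟨i, by simpa using hi⟩
    let i := (Finset.univ.filter fun i => Nonempty (X ≅ S i)).min' hne
    have hi : Nonempty (X ≅ S i) := (Finset.mem_filter.1 (Finset.min'_mem _ hne)).2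
    refine ⟨⟨i, Simple.of_iso hi.some.symm, fun j hj hji => ?_⟩, hi⟩
    refine absurd (Finset.min'_le (Finset.univ.filter fun i => Nonempty (X ≅ S i)) j ?_)
      (not_le.2 hj)
    simpa using ⟨hi.some ≪≫ hji.some.symm⟩

/-- The identity of any object factors through finitely many of the chosen simple objects. -/
theorem exists_simple_decomposition [IsFiniteSemisimple k C] {ι : Type} {S : ι → C}
    (hS : ∀ X : C, Simple X → ∃ i, Nonempty (X ≅ S i)) (c : C) :
    ∃ (n : ℕ) (j : Fin n → ι) (a : ∀ l, c ⟶ S (j l)) (b : ∀ l, S (j l) ⟶ c),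
      ∑ l, a l ≫ b l = 𝟙 c := by
  obtain ⟨n, T, hT, B, ⟨hB⟩, ⟨e⟩⟩ := IsFiniteSemisimple.semisimple (k := k) c
  choose j hj using fun l => hS (T l) (hT l)
  refine ⟨n, j, fun l => e.hom ≫ B.π l ≫ (hj l).some.hom,
    fun l => (hj l).some.inv ≫ B.ι l ≫ e.inv, ?_⟩
  have : ∀ l, (e.hom ≫ B.π l ≫ (hj l).some.hom) ≫ (hj l).some.inv ≫ B.ι l ≫ e.inv =
      e.hom ≫ (B.π l ≫ B.ι l) ≫ e.inv := fun l => by simp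
  simp_rw [this]
  rw [← Preadditive.comp_sum, ← Preadditive.sum_comp, IsBilimit.total hB, Category.id_comp,
    e.hom_inv_id]

end Simples

section Universal

variable {k : Type u} [Field k]

/-- `g ∈ F(G)` is universal if it represents `F`: every element of `F(c)` is `F(f)(g)` for a unique
`f : G ⟶ c`. -/
def IsUniversal (X : Slice k) (G : X.C) (g : X.F.obj G) : Prop :=
  ∀ c : X.C, Function.Bijective fun f : G ⟶ c => (X.F.map f).hom.hom g

theorem Slice.map_sum_apply (X : Slice k) {ι : Type*} (s : Finset ι) {c d : X.C} (f : ι → (c ⟶ d))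
    (x : X.F.obj c) : (X.F.map (∑ j ∈ s, f j)).hom.hom x = ∑ j ∈ s, (X.F.map (f j)).hom.hom x := by
  rw [Functor.map_sum, Vec.sum_apply]

theorem Slice.map_comp_apply (X : Slice k) {c d e : X.C} (f : c ⟶ d) (g : d ⟶ e) (x : X.F.obj c) :
    (X.F.map (f ≫ g)).hom.hom x = (X.F.map g).hom.hom ((X.F.map f).hom.hom x) := by
  rw [Functor.map_comp]
  rfl

theorem Slice.map_id_apply (X : Slice k) {c : X.C} (x : X.F.obj c) :
    (X.F.map (𝟙 c)).hom.hom x = x := by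
  rw [CategoryTheory.Functor.map_id]
  rfl

theorem Slice.map_zero_apply (X : Slice k) {c d : X.C} (x : X.F.obj c) :
    (X.F.map (0 : c ⟶ d)).hom.hom x = 0 := by
  rw [Functor.map_zero]
  rfl

theorem Slice.map_smul_apply (X : Slice k) {c d : X.C} (r : k) (f : c ⟶ d) (x : X.F.obj c) :
    (X.F.map (r • f)).hom.hom x = r • (X.F.map f).hom.hom x := by
  rw [Functor.map_smul]
  rfl

/-- Evaluation of morphisms at a universal element. -/
def IsUniversal.homEquiv {X : Slice k} {G : X.C} {g : X.F.obj G} (hg : IsUniversal X G g)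
    (c : X.C) : (G ⟶ c) ≃ₗ[k] X.F.obj c :=
  LinearEquiv.ofBijective
    { toFun := fun f => (X.F.map f).hom.hom g
      map_add' := fun f f' => by rw [Functor.map_add]; rfl
      map_smul' := fun r f => X.map_smul_apply r f g } (hg c)

theorem IsUniversal.homEquiv_apply {X : Slice k} {G : X.C} {g : X.F.obj G}
    (hg : IsUniversal X G g) {c : X.C} (f : G ⟶ c) :
    hg.homEquiv c f = (X.F.map f).hom.hom g := rfl

/-- Evaluation at a universal element identifies `End F` with `F(G)`. -/
def IsUniversal.endEquiv {X : Slice k} {G : X.C} {g : X.F.obj G} (hg : IsUniversal X G g) :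
    End X.F ≃ₗ[k] X.F.obj G where
  toFun η := (NatTrans.app η G).hom.hom g
  map_add' _ _ := rfl
  map_smul' _ _ := rfl
  invFun z :=
    { app := fun c => FGModuleCat.ofHom
        { toFun := fun x => (X.F.map ((hg.homEquiv c).symm x)).hom.hom z
          map_add' := fun x y => by rw [map_add, Functor.map_add]; rfl
          map_smul' := fun r x => by
            rw [map_smul, X.map_smul_apply]; rfl }
      naturality := fun c d f => Vec.hom_ext_apply fun x => by
        obtain ⟨u, rfl⟩ := (hg.homEquiv c).surjective x
        change (X.F.map ((hg.homEquiv d).symm ((X.F.map f).hom.hom (hg.homEquiv c u)))).hom.hom z =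
          (X.F.map f).hom.hom ((X.F.map ((hg.homEquiv c).symm (hg.homEquiv c u))).hom.hom z)
        rw [LinearEquiv.symm_apply_apply, hg.homEquiv_apply, ← X.map_comp_apply,
          ← hg.homEquiv_apply, LinearEquiv.symm_apply_apply, X.map_comp_apply] }
  left_inv η := by
    refine NatTrans.ext (funext fun c => Vec.hom_ext_apply fun x => ?_)
    obtain ⟨u, rfl⟩ := (hg.homEquiv c).surjective x
    change (X.F.map ((hg.homEquiv c).symm (hg.homEquiv c u))).hom.hom
      ((NatTrans.app η G).hom.hom g) = _
    rw [LinearEquiv.symm_apply_apply]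
    exact congrArg (fun l : X.F.obj G ⟶ X.F.obj c => l.hom.hom g) (NatTrans.naturality η u).symm
  right_inv z := by
    change (X.F.map ((hg.homEquiv G).symm g)).hom.hom z = z
    have : (hg.homEquiv G).symm g = 𝟙 G := by
      rw [LinearEquiv.symm_apply_eq, hg.homEquiv_apply, X.map_id_apply]
    rw [this, X.map_id_apply]

theorem IsUniversal.endEquiv_apply {X : Slice k} {G : X.C} {g : X.F.obj G}
    (hg : IsUniversal X G g) (η : End X.F) :
    hg.endEquiv η = (NatTrans.app η G).hom.hom g := rfl

theorem Slice.naturality_apply {X : Slice k} (η : End X.F) {c d : X.C} (f : c ⟶ d)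
    (x : X.F.obj c) : (NatTrans.app η d).hom.hom ((X.F.map f).hom.hom x) =
      (X.F.map f).hom.hom ((NatTrans.app η c).hom.hom x) :=
  congrArg (fun l : X.F.obj c ⟶ X.F.obj d => l.hom.hom x) (NatTrans.naturality η f)

variable [IsAlgClosed k]

/-- The fibre functor of an object of `Slice` is represented by a generator `G`, namely by the sum
of the simple objects `S`, each repeated `dim F(S)` times, and `End F` is the product of the matrix
algebras `End (F(S))`. -/
theorem Slice.exists_universal_and_model (X : Slice k) :
    (∃ (G : X.C) (g : X.F.obj G), Generates G ∧ IsUniversal X G g) ∧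
    ∃ (A : Type u) (_ : Ring A) (_ : Algebra k A), Module.Finite k A ∧ IsSemisimpleRing A ∧
      Nonempty (A ≃ₐ[k] End X.F) := by
  classical
  obtain ⟨ι, _, S, hS, hiso, hex⟩ := exists_simple_representatives k X.C
  have := Abelian.hasFiniteBiproducts (C := X.C)
  have hdec := exists_simple_decomposition (k := k) hex
  have hfin : ∀ c d : X.C, Module.Finite k (c ⟶ d) := IsFiniteSemisimple.finite_hom
  let B := fun i => Module.finBasis k (X.F.obj (S i))
  let J := Σ i, Fin (Module.finrank k (X.F.obj (S i)))
  let T : J → X.C := fun p => S p.1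
  let G : X.C := ⨁ T
  let g : X.F.obj G := ∑ p : J, (X.F.map (biproduct.ι T p)).hom.hom (B p.1 p.2)
  have hπ : ∀ p : J, (X.F.map (biproduct.π T p)).hom.hom g = B p.1 p.2 := fun p => by
    change (X.F.map (biproduct.π T p)).hom.hom
      (∑ p : J, (X.F.map (biproduct.ι T p)).hom.hom (B p.1 p.2)) = _
    rw [map_sum, Finset.sum_eq_single p]
    · rw [← X.map_comp_apply, biproduct.ι_π_self, X.map_id_apply]
    · intro q _ hq
      rw [← X.map_comp_apply, biproduct.ι_π_ne _ hq, X.map_zero_apply]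
    · intro h
      exact absurd (Finset.mem_univ _) h
  have hpos : ∀ i, 0 < Module.finrank k (X.F.obj (S i)) := fun i => by
    rw [Module.finrank_pos_iff]
    by_contra h
    rw [not_nontrivial_iff_subsingleton] at h
    have := hS i
    refine id_nonzero (S i) (X.F.map_injective (Vec.hom_ext_apply fun x => Subsingleton.elim _ _))
  have hgen : Generates G := fun c => by
    obtain ⟨n, j, a, b, hab⟩ := hdec c
    refine ⟨n, fun l => a l ≫ biproduct.ι T ⟨j l, ⟨0, hpos (j l)⟩⟩,
      fun l => biproduct.π T ⟨j l, ⟨0, hpos (j l)⟩⟩ ≫ b l, ?_⟩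
    rw [← hab]
    refine Finset.sum_congr rfl fun l _ => ?_
    rw [Category.assoc, biproduct.ι_π_self_assoc]
  have hinj : ∀ i (w : G ⟶ S i), (X.F.map w).hom.hom g = 0 → w = 0 := fun i w hw => by
    have := hS
    have hsc : ∀ q : Fin (Module.finrank k (X.F.obj (S i))), ∃ r : k,
        r • 𝟙 (S i) = biproduct.ι T ⟨i, q⟩ ≫ w := fun q =>
      endomorphism_simple_eq_smul_id k _
    choose r hr using hsc
    have hz : ∀ p : J, p.1 ≠ i → biproduct.ι T p ≫ w = 0 := fun p hp => by
      by_contra h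
      have := isIso_of_hom_simple h
      exact hp (hiso _ _ ⟨asIso (biproduct.ι T p ≫ w)⟩)
    have hsum : (X.F.map w).hom.hom g = ∑ q, r q • B i q := by
      change (X.F.map w).hom.hom (∑ p : J, (X.F.map (biproduct.ι T p)).hom.hom (B p.1 p.2)) = _
      rw [map_sum, Fintype.sum_sigma, Finset.sum_eq_single i]
      · refine Finset.sum_congr rfl fun q _ => ?_
        rw [← X.map_comp_apply, ← hr q, X.map_smul_apply, X.map_id_apply]
      · intro i' _ hi'
        refine Finset.sum_eq_zero fun q _ => ?_
        rw [← X.map_comp_apply, hz _ hi', X.map_zero_apply]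
      · intro h
        exact absurd (Finset.mem_univ _) h
    have hr0 := Fintype.linearIndependent_iff.1 (B i).linearIndependent r (hsum.symm.trans hw)
    refine biproduct.hom_ext' _ _ fun p => ?_
    rw [comp_zero]
    obtain ⟨i', q⟩ := p
    by_cases h : i' = i
    · subst h
      rw [← hr q, hr0 q, zero_smul]
    · exact hz _ h
  have huniv : IsUniversal X G g := fun c => by
    obtain ⟨n, j, a, b, hab⟩ := hdec c
    have hx : ∀ x : X.F.obj c,
        x = ∑ l, (X.F.map (b l)).hom.hom ((X.F.map (a l)).hom.hom x) := fun x => by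
      conv_lhs => rw [← X.map_id_apply x, ← hab, X.map_sum_apply]
      simp_rw [X.map_comp_apply]
    constructor
    · intro u v huv
      rw [← sub_eq_zero]
      have h : ∀ l, (u - v) ≫ a l = 0 := fun l => hinj _ _ (by
        rw [X.map_comp_apply, Functor.map_sub]
        have : (X.F.map u - X.F.map v).hom.hom g = 0 := sub_eq_zero.2 huv
        rw [this, map_zero])
      rw [← Category.comp_id (u - v), ← hab, Preadditive.comp_sum]
      refine Finset.sum_eq_zero fun l _ => ?_
      rw [← Category.assoc, h, zero_comp]
    · intro x
      refine ⟨∑ l, ∑ q, (B (j l)).repr ((X.F.map (a l)).hom.hom x) q •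
        (biproduct.π T ⟨j l, q⟩ ≫ b l), ?_⟩
      change (X.F.map _).hom.hom g = x
      conv_rhs => rw [hx x]
      rw [X.map_sum_apply]
      refine Finset.sum_congr rfl fun l _ => ?_
      rw [X.map_sum_apply]
      conv_rhs => rw [← (B (j l)).sum_repr ((X.F.map (a l)).hom.hom x), map_sum]
      refine Finset.sum_congr rfl fun q _ => ?_
      rw [X.map_smul_apply, X.map_comp_apply, hπ, map_smul]
  refine ⟨⟨G, g, hgen, huniv⟩, Π i, Module.End k (X.F.obj (S i)), inferInstance, inferInstance,
    inferInstance, ?_, ⟨AlgEquiv.symm (AlgEquiv.ofBijective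
      { toFun := fun η i => (NatTrans.app η (S i)).hom.hom
        map_one' := rfl
        map_mul' := fun _ _ => rfl
        map_zero' := rfl
        map_add' := fun _ _ => rfl
        commutes' := fun _ => rfl } ⟨fun η η' h => ?_, fun f => ?_⟩)⟩⟩
  · have : ∀ i, IsSemisimpleRing (Module.End k (X.F.obj (S i))) := fun i =>
      IsSemisimpleRing.moduleEnd k _
    infer_instance
  · refine huniv.endEquiv.injective ?_
    rw [huniv.endEquiv_apply, huniv.endEquiv_apply]
    change (NatTrans.app η G).hom.hom (∑ p : J, (X.F.map (biproduct.ι T p)).hom.hom (B p.1 p.2)) =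
      (NatTrans.app η' G).hom.hom (∑ p : J, (X.F.map (biproduct.ι T p)).hom.hom (B p.1 p.2))
    rw [map_sum, map_sum]
    refine Finset.sum_congr rfl fun p _ => ?_
    rw [naturality_apply, naturality_apply]
    exact congrArg _ (LinearMap.congr_fun (congrFun h p.1) _)
  · let z : X.F.obj G := ∑ p : J, (X.F.map (biproduct.ι T p)).hom.hom (f p.1 (B p.1 p.2))
    have hz : ∀ p : J, (X.F.map (biproduct.π T p)).hom.hom z = f p.1 (B p.1 p.2) := fun p => by
      change (X.F.map (biproduct.π T p)).hom.hom
        (∑ p : J, (X.F.map (biproduct.ι T p)).hom.hom (f p.1 (B p.1 p.2))) = _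
      rw [map_sum, Finset.sum_eq_single p]
      · rw [← X.map_comp_apply, biproduct.ι_π_self, X.map_id_apply]
      · intro q _ hq
        rw [← X.map_comp_apply, biproduct.ι_π_ne _ hq, X.map_zero_apply]
      · intro h
        exact absurd (Finset.mem_univ _) h
    refine ⟨huniv.endEquiv.symm z, funext fun i => (B i).ext fun q => ?_⟩
    change (NatTrans.app (huniv.endEquiv.symm z) (S i)).hom.hom (B i q) = _
    rw [← hπ ⟨i, q⟩, naturality_apply, ← huniv.endEquiv_apply, LinearEquiv.apply_symm_apply, hz, hπ]

end Universal

end BialgebraReconstruction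

end
noncomputable section

namespace BialgebraReconstruction

/-! ### Tannaka reconstruction for semisimple categories -/

section Tannaka

variable {k : Type u} [Field k]

/-- A module over a semisimple algebra is projective, hence a retract of a free module of finite
rank. -/
theorem FDMod.exists_retraction {A : Type u} [Ring A] [Algebra k A] [IsSemisimpleRing A]
    (M : FDMod k A) : ∃ (n : ℕ) (v : Fin n → M.V) (g : M.V →ₗ[k] (Fin n → A)),
      (∀ a x, g ((M.ρ a : M.V ⟶ M.V).hom.hom x) = a • g x) ∧
        ∀ x, ∑ i, (M.ρ (g x i) : M.V ⟶ M.V).hom.hom (v i) = x := by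
  have := Module.projective_of_isSemisimpleRing A M.Under
  obtain ⟨n, f, g, -, -, hfg⟩ := Module.Finite.exists_comp_eq_id_of_projective A M.Under
  refine ⟨n, fun i => f (Pi.single i 1), g.restrictScalars k, fun a x => g.map_smul a x,
    fun x => ?_⟩
  refine Eq.trans ?_ (LinearMap.congr_fun hfg x)
  change _ = f (g x)
  conv_rhs => rw [← Finset.univ_sum_single (g x), map_sum]
  refine Finset.sum_congr rfl fun i _ => ?_
  have : (Pi.single i (g x i) : Fin n → A) = g x i • Pi.single i 1 := by
    rw [← Pi.single_smul, smul_eq_mul, mul_one]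
  rw [this, map_smul]
  rfl

variable [IsAlgClosed k]

/-- Linear maps between fibres which commute with the natural endomorphisms of the fibre functor
come from morphisms. -/
theorem Slice.exists_map_eq {X : Slice k} {c d : X.C} (f : X.F.obj c ⟶ X.F.obj d)
    (hf : ∀ η : End X.F, NatTrans.app η c ≫ f = f ≫ NatTrans.app η d) :
    ∃ m : c ⟶ d, X.F.map m = f := by
  obtain ⟨⟨G, g, hgen, hg⟩, -⟩ := X.exists_universal_and_model
  -- on `F(G)`, a map is determined by its value at the universal element
  have key : ∀ f : X.F.obj G ⟶ X.F.obj d,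
      (∀ η : End X.F, NatTrans.app η G ≫ f = f ≫ NatTrans.app η d) →
        ∃ m : G ⟶ d, X.F.map m = f := fun f hf => by
    obtain ⟨m, hm⟩ := (hg d).surjective (f.hom.hom g)
    refine ⟨m, Vec.hom_ext_apply fun x => ?_⟩
    obtain ⟨η, rfl⟩ := hg.endEquiv.surjective x
    rw [hg.endEquiv_apply, ← naturality_apply]
    exact (congrArg (NatTrans.app η d).hom.hom hm).trans
      (congrArg (fun l : X.F.obj G ⟶ X.F.obj d => l.hom.hom g) (hf η)).symm
  obtain ⟨n, a, b, hab⟩ := hgen c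
  have hb : ∀ i, ∃ m : G ⟶ d, X.F.map m = X.F.map (b i) ≫ f := fun i => key _ fun η => by
    have := NatTrans.naturality η (b i)
    rw [Category.assoc, ← hf η, ← Category.assoc, ← Category.assoc, this]
  choose m hm using hb
  refine ⟨∑ i, a i ≫ m i, ?_⟩
  conv_rhs => rw [← Category.id_comp f, ← CategoryTheory.Functor.map_id, ← hab, Functor.map_sum,
    Preadditive.sum_comp]
  rw [Functor.map_sum]
  refine Finset.sum_congr rfl fun i _ => ?_
  rw [Functor.map_comp, Functor.map_comp, hm, Category.assoc]

/-- Every finite-dimensional representation of `End F` is the fibre of an object: it is a retract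
of a power of the regular representation, which is the fibre of a representing object. -/
theorem Slice.exists_fiber_iso {X : Slice k} (V : Vec k) (r : End X.F →ₐ[k] End V) :
    ∃ (d : X.C) (e : V ≅ X.F.obj d),
      ∀ η : End X.F, (r η : V ⟶ V) ≫ e.hom = e.hom ≫ NatTrans.app η d := by
  obtain ⟨⟨G, g, -, hg⟩, A, _, _, _, _, ⟨E⟩⟩ := X.exists_universal_and_model
  obtain ⟨n, v, w, hw, hvw⟩ := FDMod.exists_retraction (k := k) (A := A) ⟨V, r.comp E.toAlgHom⟩
  change Fin n → V at v
  change V →ₗ[k] (Fin n → A) at w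
  replace hw : ∀ (η : End X.F) (x : V), w ((r η : V ⟶ V).hom.hom x) = E.symm η • w x :=
    fun η x => by
      rw [← hw]
      change _ = w ((r (E (E.symm η)) : V ⟶ V).hom.hom x)
      rw [AlgEquiv.apply_symm_apply]
  replace hvw : ∀ x : V, ∑ i, (r (E (w x i)) : V ⟶ V).hom.hom (v i) = x := hvw
  let a : Fin n → (V ⟶ X.F.obj G) := fun i => FGModuleCat.ofHom
    (hg.endEquiv.toLinearMap ∘ₗ E.toLinearMap ∘ₗ LinearMap.proj i ∘ₗ w)
  let b : Fin n → (X.F.obj G ⟶ V) := fun i => FGModuleCat.ofHom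
    { toFun := fun x => (r (hg.endEquiv.symm x) : V ⟶ V).hom.hom (v i)
      map_add' := fun x y => by rw [map_add, map_add]; rfl
      map_smul' := fun s x => by rw [map_smul, map_smul]; rfl }
  have ha : ∀ i (η : End X.F), (r η : V ⟶ V) ≫ a i = a i ≫ NatTrans.app η G := fun i η =>
    Vec.hom_ext_apply fun x => by
      change hg.endEquiv (E (w ((r η : V ⟶ V).hom.hom x) i)) =
        (NatTrans.app η G).hom.hom (hg.endEquiv (E (w x i)))
      rw [hw, Pi.smul_apply, smul_eq_mul, map_mul, AlgEquiv.apply_symm_apply]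
      rfl
  have hb : ∀ i (η : End X.F), NatTrans.app η G ≫ b i = b i ≫ (r η : V ⟶ V) := fun i η =>
    Vec.hom_ext_apply fun x => by
      obtain ⟨θ, rfl⟩ := hg.endEquiv.surjective x
      change (r (hg.endEquiv.symm (hg.endEquiv (η * θ))) : V ⟶ V).hom.hom (v i) =
        (r η : V ⟶ V).hom.hom ((r (hg.endEquiv.symm (hg.endEquiv θ)) : V ⟶ V).hom.hom (v i))
      rw [LinearEquiv.symm_apply_apply, LinearEquiv.symm_apply_apply, map_mul]
      rfl
  have hab : ∑ i, a i ≫ b i = 𝟙 V := Vec.hom_ext_apply fun x => by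
    rw [Vec.sum_apply]
    refine (Finset.sum_congr rfl fun i _ => ?_).trans (hvw x)
    change (r (hg.endEquiv.symm (hg.endEquiv (E (w x i)))) : V ⟶ V).hom.hom (v i) = _
    rw [LinearEquiv.symm_apply_apply]
  have hm : ∀ i j, ∃ m : G ⟶ G, X.F.map m = b i ≫ a j := fun i j =>
    X.exists_map_eq _ fun η => by
      rw [← Category.assoc, hb, Category.assoc, ha, Category.assoc]
  choose m hm using hm
  have := Abelian.hasFiniteBiproducts (C := X.C)
  obtain ⟨y, α, β, hαβ, hβα⟩ := exists_splitting m fun i j => X.F.map_injective <| by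
    rw [Functor.map_sum]
    have : ∀ l, X.F.map (m i l ≫ m l j) = b i ≫ (a l ≫ b l) ≫ a j := fun l => by
      rw [Functor.map_comp, hm, hm, Category.assoc, Category.assoc]
    simp_rw [this]
    rw [← Preadditive.comp_sum, ← Preadditive.sum_comp, hab, Category.id_comp, hm]
  refine ⟨y, ⟨∑ i, a i ≫ X.F.map (β i), ∑ i, X.F.map (α i) ≫ b i, ?_, ?_⟩, fun η => ?_⟩
  · have : ∀ i j, (a i ≫ X.F.map (β i)) ≫ X.F.map (α j) ≫ b j =
        (a i ≫ b i) ≫ (a j ≫ b j) := fun i j => by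
      rw [Category.assoc, ← Functor.map_comp_assoc, hβα, hm]
      simp only [Category.assoc]
    simp_rw [Preadditive.sum_comp, Preadditive.comp_sum, this, ← Preadditive.comp_sum,
      ← Preadditive.sum_comp, hab, Category.id_comp]
  · have : ∀ i j, (X.F.map (α i) ≫ b i) ≫ a j ≫ X.F.map (β j) =
        X.F.map ((α i ≫ β i) ≫ (α j ≫ β j)) := fun i j => by
      have h := hm i j
      rw [← hβα] at h
      simp only [Category.assoc, Functor.map_comp] at h ⊢
      rw [reassoc_of% h]
    simp_rw [Preadditive.sum_comp, Preadditive.comp_sum, this, ← Functor.map_sum,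
      ← Preadditive.comp_sum, ← Preadditive.sum_comp, hαβ, Category.id_comp,
      CategoryTheory.Functor.map_id]
  · dsimp only
    rw [Preadditive.comp_sum, Preadditive.sum_comp]
    refine Finset.sum_congr rfl fun i _ => ?_
    have := NatTrans.naturality η (β i)
    rw [← Category.assoc, ha, Category.assoc, Category.assoc, this]

end Tannaka

/-! ### Morphisms of fibre functors as algebra homomorphisms -/

section EndMap

variable {k : Type u} [Field k]

theorem endMap_id (X : Slice k) (η : End X.F) : endMap (𝟙 X) η = η := by
  refine NatTrans.ext (funext fun c => ?_)
  change 𝟙 _ ≫ NatTrans.app η c ≫ 𝟙 _ = _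
  rw [Category.id_comp, Category.comp_id]

theorem endMap_comp {X Y Z : Slice k} (f : X ⟶ Y) (g : Y ⟶ Z) (η : End Z.F) :
    endMap (f ≫ g) η = endMap f (endMap g η) := by
  obtain ⟨f, rfl⟩ := Quotient.exists_rep f
  obtain ⟨g, rfl⟩ := Quotient.exists_rep g
  refine NatTrans.ext (funext fun c => ?_)
  change (f.comp g).τ.hom.app c ≫ NatTrans.app η _ ≫ (f.comp g).τ.inv.app c =
    f.τ.hom.app c ≫ (g.τ.hom.app _ ≫ NatTrans.app η _ ≫ g.τ.inv.app _) ≫ f.τ.inv.app c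
  have : (f.comp g).τ.inv.app c = g.τ.inv.app _ ≫ f.τ.inv.app c := by
    change (𝟙 _ ≫ g.τ.inv.app _) ≫ f.τ.inv.app c = _
    rw [Category.id_comp]
  rw [PreHom.comp_app, this]
  simp only [Category.assoc]
  rfl

theorem endMap_comp_eq {X Y Z : Slice k} {f : X ⟶ Y} {g : Y ⟶ Z} {ζ : End Z.F} {η : End Y.F}
    {ξ : End X.F} (hg : endMap g ζ = η) (hf : endMap f η = ξ) : endMap (f ≫ g) ζ = ξ := by
  rw [endMap_comp, hg, hf]

variable [IsAlgClosed k]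

/-- A morphism of fibre functors is determined by the homomorphism it induces on endomorphism
algebras: if `f` and `g` induce the same one, then `τ_g ∘ τ_f⁻¹` commutes with the natural
endomorphisms of `Y.F`, so its components come from a 2-morphism from `f` to `g`. -/
theorem endMap_injective {X Y : Slice k} {f g : X ⟶ Y} (h : ∀ η, endMap f η = endMap g η) :
    f = g := by
  obtain ⟨f, rfl⟩ := Quotient.exists_rep f
  obtain ⟨g, rfl⟩ := Quotient.exists_rep g
  have hm : ∀ c, ∃ m : f.T.obj c ⟶ g.T.obj c, Y.F.map m = f.τ.inv.app c ≫ g.τ.hom.app c :=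
    fun c => Y.exists_map_eq _ fun η => by
      have e : f.τ.hom.app c ≫ NatTrans.app η (f.T.obj c) ≫ f.τ.inv.app c =
          g.τ.hom.app c ≫ NatTrans.app η (g.T.obj c) ≫ g.τ.inv.app c :=
        congrArg (fun η : End X.F => NatTrans.app η c) (h η)
      have e' := congrArg (fun l => f.τ.inv.app c ≫ l ≫ g.τ.hom.app c) e
      simpa using e'
  choose m hm using hm
  refine Quotient.sound ⟨⟨⟨m, fun c d u => Y.F.map_injective ?_⟩, fun c => ?_⟩⟩
  · rw [Functor.map_comp, Functor.map_comp, hm, hm]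
    have h₁ := f.τ.inv.naturality u
    have h₂ := g.τ.hom.naturality u
    rw [← Category.assoc, ← Functor.comp_map, h₁, Category.assoc, h₂, Category.assoc]
    rfl
  · dsimp only
    rw [hm, Iso.hom_inv_id_app_assoc]

/-- Every algebra homomorphism `End F₂ → End F₁` is induced by a morphism: it makes the fibres of
`F₁` representations of `End F₂`, and these are fibres of objects of the target. -/
theorem endMap_surjective {X Y : Slice k} (φ : End Y.F →ₐ[k] End X.F) :
    ∃ f : X ⟶ Y, ∀ η, endMap f η = φ η := by
  have := fun c => Y.exists_fiber_iso (X.F.obj c) ((leg X c).comp φ)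
  choose T u hu using this
  replace hu : ∀ c (η : End Y.F), NatTrans.app (φ η) c ≫ (u c).hom =
    (u c).hom ≫ NatTrans.app η (T c) := hu
  have hm : ∀ (c d : X.C) (f : c ⟶ d), ∃ m : T c ⟶ T d,
      Y.F.map m = (u c).inv ≫ X.F.map f ≫ (u d).hom := fun c d f => Y.exists_map_eq _ fun η => by
    have h := NatTrans.naturality (φ η) f
    have hc : NatTrans.app η (T c) = (u c).inv ≫ NatTrans.app (φ η) c ≫ (u c).hom := by
      rw [hu, Iso.inv_hom_id_assoc]
    simp only [hc, Category.assoc, Iso.hom_inv_id_assoc]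
    rw [← hu, reassoc_of% h]
  choose m hm using hm
  let f : PreHom X Y :=
    { T :=
        { obj := T
          map := m _ _
          map_id := fun c => Y.F.map_injective (by simp [hm])
          map_comp := fun f g => Y.F.map_injective (by simp [hm]) }
      additive := ⟨fun {c d f g} => Y.F.map_injective (by simp [hm, Functor.map_add])⟩
      linear := ⟨fun {c d} f r => Y.F.map_injective (by simp [hm, Functor.map_smul])⟩
      τ := NatIso.ofComponents u fun {c d} f => by
        change X.F.map f ≫ (u d).hom = (u c).hom ≫ Y.F.map (m c d f)
        rw [hm, Iso.hom_inv_id_assoc] }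
  refine ⟨f.toHom, fun η => NatTrans.ext (funext fun c => ?_)⟩
  change (u c).hom ≫ NatTrans.app η (T c) ≫ (u c).inv = _
  rw [← reassoc_of% hu, Iso.hom_inv_id, Category.comp_id]

/-- The morphism inducing a given homomorphism of endomorphism algebras. -/
def homOfAlg {X Y : Slice k} (φ : End Y.F →ₐ[k] End X.F) : X ⟶ Y := (endMap_surjective φ).choose

@[simp]
theorem endMap_homOfAlg {X Y : Slice k} (φ : End Y.F →ₐ[k] End X.F) (η : End Y.F) :
    endMap (homOfAlg φ) η = φ η := (endMap_surjective φ).choose_spec η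

/-- The isomorphism inducing a given isomorphism of endomorphism algebras. -/
def isoOfAlg {X Y : Slice k} (φ : End Y.F ≃ₐ[k] End X.F) : X ≅ Y where
  hom := homOfAlg φ.toAlgHom
  inv := homOfAlg φ.symm.toAlgHom
  hom_inv_id := endMap_injective fun η => by
    rw [endMap_comp, endMap_id, endMap_homOfAlg, endMap_homOfAlg]
    exact φ.apply_symm_apply η
  inv_hom_id := endMap_injective fun η => by
    rw [endMap_comp, endMap_id, endMap_homOfAlg, endMap_homOfAlg]
    exact φ.symm_apply_apply η

@[simp]
theorem endMap_isoOfAlg_hom {X Y : Slice k} (φ : End Y.F ≃ₐ[k] End X.F) (η : End Y.F) :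
    endMap (isoOfAlg φ).hom η = φ η := endMap_homOfAlg _ η

/-- In terms of endomorphism algebras, `f` sends `c` to `d` by means of `p` if and only if `p` is an
isomorphism which is equivariant along `endMap f`. -/
theorem sends_iff {X Y : Slice k} {f : X ⟶ Y} {c : X.C} {d : Y.C} {p : X.F.obj c ⟶ Y.F.obj d} :
    Sends f c d p ↔ IsIso p ∧
      ∀ η, NatTrans.app (endMap f η) c ≫ p = p ≫ NatTrans.app η d := by
  constructor
  · rintro ⟨g, rfl, φ, rfl⟩
    refine ⟨inferInstance, fun η => ?_⟩
    have := NatTrans.naturality η φ.hom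
    change (g.τ.hom.app c ≫ NatTrans.app η _ ≫ g.τ.inv.app c) ≫ g.τ.hom.app c ≫ _ = _
    simp only [Category.assoc, Iso.inv_hom_id_app_assoc]
    rw [this]
  · rintro ⟨hp, h⟩
    obtain ⟨g, rfl⟩ := Quotient.exists_rep f
    have hg : ∀ η : End Y.F, g.τ.inv.app c ≫ g.τ.hom.app c ≫ NatTrans.app η _ ≫ g.τ.inv.app c ≫ p =
        g.τ.inv.app c ≫ p ≫ NatTrans.app η d := fun η => by
      rw [← h η]
      change _ = _ ≫ (g.τ.hom.app c ≫ NatTrans.app η _ ≫ g.τ.inv.app c) ≫ p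
      simp only [Category.assoc]
    obtain ⟨m, hm⟩ := Y.exists_map_eq (c := g.T.obj c) (d := d) (g.τ.inv.app c ≫ p) fun η => by
      rw [Category.assoc, ← hg η, Iso.inv_hom_id_app_assoc]
    have : IsIso (Y.F.map m) := by rw [hm]; infer_instance
    have : Mono m := Y.F.mono_of_mono_map inferInstance
    have : Epi m := Y.F.epi_of_epi_map inferInstance
    have := isIso_of_mono_of_epi m
    refine ⟨g, rfl, asIso m, ?_⟩
    rw [asIso_hom, hm, Iso.hom_inv_id_app_assoc]

end EndMap

end BialgebraReconstruction

end
noncomputable section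

namespace BialgebraReconstruction

/-! ### The universal property of a bilinear functor generating its target -/

section Bilinear

variable {k : Type*} [Field k]
  {C : Type*} [Category C] [Preadditive C] [Linear k C]
  {D : Type*} [Category D] [Preadditive D] [Linear k D]
  {P : Type*} [Category P] [Preadditive P] [Linear k P]
  {E : Type*} [Category E] [Preadditive E] [Linear k E]

theorem IsBilinear.additive {B : C ⥤ D ⥤ E} (hB : IsBilinear k B) : B.Additive where
  map_add {c c' f g} := by
    ext d
    have := hB.additive_left d
    exact (B.flip.obj d).map_add

/-- The action of `End c` on `B(c, d)`. -/
def IsBilinear.endHomLeft {B : C ⥤ D ⥤ E} (hB : IsBilinear k B) (c : C) (d : D) :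
    End c →ₐ[k] End ((B.obj c).obj d) :=
  have := hB.additive_left d
  have := hB.linear_left d
  { toFun := fun f : c ⟶ c => ((B.flip.obj d).map f : (B.obj c).obj d ⟶ (B.obj c).obj d)
    map_one' := (B.flip.obj d).map_id c
    map_mul' := fun f g => (B.flip.obj d).map_comp (g : c ⟶ c) (f : c ⟶ c)
    map_zero' := (B.flip.obj d).map_zero c c
    map_add' := fun f g => (B.flip.obj d).map_add (f := (f : c ⟶ c)) (g := g)
    commutes' := fun r => by
      change (B.flip.obj d).map (r • 𝟙 c) = r • 𝟙 _
      rw [Functor.map_smul, CategoryTheory.Functor.map_id] }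

/-- The action of `End d` on `B(c, d)`. -/
def IsBilinear.endHomRight {B : C ⥤ D ⥤ E} (hB : IsBilinear k B) (c : C) (d : D) :
    End d →ₐ[k] End ((B.obj c).obj d) :=
  have := hB.additive_right c
  have := hB.linear_right c
  { toFun := fun f : d ⟶ d => ((B.obj c).map f : (B.obj c).obj d ⟶ (B.obj c).obj d)
    map_one' := (B.obj c).map_id d
    map_mul' := fun f g => (B.obj c).map_comp (g : d ⟶ d) (f : d ⟶ d)
    map_zero' := (B.obj c).map_zero d d
    map_add' := fun f g => (B.obj c).map_add (f := (f : d ⟶ d)) (g := g)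
    commutes' := fun r => by
      change (B.obj c).map (r • 𝟙 d) = r • 𝟙 _
      rw [Functor.map_smul, CategoryTheory.Functor.map_id] }

theorem IsBilinear.endHom_commute {B : C ⥤ D ⥤ E} (hB : IsBilinear k B) {c : C} {d : D}
    (f : End c) (g : End d) : Commute (hB.endHomLeft c d f) (hB.endHomRight c d g) :=
  (B.map (f : c ⟶ c)).naturality (g : d ⟶ d)

/-- The action of `End c ⊗ End d` on `B(c, d)`. -/
def IsBilinear.endHom {B : C ⥤ D ⥤ E} (hB : IsBilinear k B) (c : C) (d : D) :
    End c ⊗[k] End d →ₐ[k] End ((B.obj c).obj d) :=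
  Algebra.TensorProduct.lift (hB.endHomLeft c d) (hB.endHomRight c d) hB.endHom_commute

theorem IsBilinear.endHom_tmul {B : C ⥤ D ⥤ E} (hB : IsBilinear k B) {c : C} {d : D}
    (f : End c) (g : End d) : (hB.endHom c d (f ⊗ₜ g) : (B.obj c).obj d ⟶ (B.obj c).obj d) =
      (B.map (f : c ⟶ c)).app d ≫ (B.obj c).map (g : d ⟶ d) :=
  (Algebra.TensorProduct.lift_tmul _ _ hB.endHom_commute f g).trans (hB.endHom_commute f g)

/-- A natural transformation of additive bifunctors is determined by its component at a pair of
generators. -/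
theorem natTrans₂_ext {U U' : C ⥤ D ⥤ E} [U.Additive] (hU : ∀ c, (U.obj c).Additive) {G : C}
    {G' : D} (hG : Generates G) (hG' : Generates G') {s t : U ⟶ U'}
    (h : (s.app G).app G' = (t.app G).app G') : s = t :=
  have := hU G
  hG.natTrans_ext (hG'.natTrans_ext h)

/-- A morphism which commutes with the endomorphisms of both generators extends to a natural
transformation of bifunctors. -/
theorem exists_natTrans₂ {U U' : C ⥤ D ⥤ E} [U.Additive] [U'.Additive]
    (hU : ∀ c, (U.obj c).Additive) (hU' : ∀ c, (U'.obj c).Additive) {G : C} {G' : D}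
    (hG : Generates G) (hG' : Generates G') (t : (U.obj G).obj G' ⟶ (U'.obj G).obj G')
    (ht : ∀ f : G ⟶ G, (U.map f).app G' ≫ t = t ≫ (U'.map f).app G')
    (ht' : ∀ f : G' ⟶ G', (U.obj G).map f ≫ t = t ≫ (U'.obj G).map f) :
    ∃ s : U ⟶ U', (s.app G).app G' = t := by
  have := hU G
  have := hU' G
  obtain ⟨s, rfl⟩ := hG'.exists_natTrans (U.obj G) (U'.obj G) t ht'
  obtain ⟨s', rfl⟩ := hG.exists_natTrans U U' s fun f => hG'.natTrans_ext (ht f)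
  exact ⟨s', rfl⟩

theorem additive_comp_whiskeringRight {box : C ⥤ D ⥤ P} (hbox : IsBilinear k box)
    {Q : Type*} [Category Q] [Preadditive Q] (L : P ⥤ Q) [L.Additive] :
    (box ⋙ (Functor.whiskeringRight D P Q).obj L).Additive ∧
      ∀ c, ((box ⋙ (Functor.whiskeringRight D P Q).obj L).obj c).Additive := by
  refine ⟨⟨fun {c c' f g} => ?_⟩, fun c => ?_⟩
  · have := hbox.additive
    ext d
    change L.map ((box.map (f + g)).app d) = L.map ((box.map f).app d) + L.map ((box.map g).app d)
    rw [box.map_add, ← L.map_add]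
    rfl
  · have := hbox.additive_right c
    exact inferInstanceAs (box.obj c ⋙ L).Additive

/-- If `box` sends a pair of generators to a generator whose endomorphisms all come from
`End G ⊗ End G'`, then natural transformations descend uniquely along `box`. -/
theorem existsUnique_descent {box : C ⥤ D ⥤ P} (hbox : IsBilinear k box) {G : C} {G' : D}
    (hG : Generates G) (hG' : Generates G') (hP : Generates ((box.obj G).obj G'))
    (hχ : Function.Surjective (hbox.endHom G G')) {Q : Type*} [Category Q]
    [Preadditive Q] (L L' : P ⥤ Q) [L.Additive] [L'.Additive]
    (t : box ⋙ (Functor.whiskeringRight D P Q).obj L ⟶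
      box ⋙ (Functor.whiskeringRight D P Q).obj L') :
    ∃! s : L ⟶ L', Functor.whiskerLeft box ((Functor.whiskeringRight D P Q).map s) = t := by
  obtain ⟨h₁, h₂⟩ := additive_comp_whiskeringRight hbox L
  have ht : ∀ f : (box.obj G).obj G' ⟶ (box.obj G).obj G',
      L.map f ≫ (t.app G).app G' = (t.app G).app G' ≫ L'.map f := fun f => by
    obtain ⟨z, rfl⟩ := hχ f
    induction z with
    | zero => rw [map_zero]; exact (L.map_zero _ _).symm ▸ (L'.map_zero _ _).symm ▸ by simp
    | add x y hx hy =>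
      rw [map_add]
      refine (congrArg (· ≫ _) (L.map_add (f := hbox.endHom G G' x))).trans
        (Eq.trans ?_ (congrArg (_ ≫ ·) (L'.map_add (f := hbox.endHom G G' x))).symm)
      rw [Preadditive.add_comp, Preadditive.comp_add, hx, hy]
    | tmul f g =>
      rw [hbox.endHom_tmul, L.map_comp, L'.map_comp, Category.assoc]
      have e₁ := (t.app G).naturality (g : G' ⟶ G')
      have e₂ := congrArg (fun l => l.app G') (t.naturality (f : G ⟶ G))
      change L.map ((box.obj G).map (g : G' ⟶ G')) ≫ _ = _ ≫ L'.map _ at e₁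
      change L.map ((box.map (f : G ⟶ G)).app G') ≫ _ = _ ≫ L'.map _ at e₂
      rw [e₁, reassoc_of% e₂]
  obtain ⟨s, hs⟩ := hP.exists_natTrans L L' _ ht
  exact ⟨s, natTrans₂_ext h₂ hG hG' hs, fun s' hs' => hP.natTrans_ext
    ((congrArg (fun t => (t.app G).app G') hs').trans hs.symm)⟩

/-- If `box` sends a pair of generators to a generator with endomorphism algebra
`End G ⊗ End G'`, then every bilinear functor `B` factors through `box`: the factorization is
prescribed on the generator by the action of `End G ⊗ End G'` on `B(G, G')`. -/
theorem exists_descent [HasFiniteBiproducts E] [IsIdempotentComplete E] {box : C ⥤ D ⥤ P}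
    (hbox : IsBilinear k box) {G : C} {G' : D} (hG : Generates G) (hG' : Generates G')
    (hP : Generates ((box.obj G).obj G'))
    (hχ : Function.Bijective (hbox.endHom G G')) (B : C ⥤ D ⥤ E) (hB : IsBilinear k B) :
    ∃ L : P ⥤ E, L.Additive ∧ L.Linear k ∧
      Nonempty (box ⋙ (Functor.whiskeringRight D P E).obj L ≅ B) := by
  let χ := AlgEquiv.ofBijective (hbox.endHom G G') hχ
  let r : End ((box.obj G).obj G') →ₐ[k] End ((B.obj G).obj G') :=
    (hB.endHom G G').comp χ.symm.toAlgHom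
  have hr : ∀ f g, r (hbox.endHom G G' (f ⊗ₜ g)) = hB.endHom G G' (f ⊗ₜ g) := fun f g =>
    congrArg (hB.endHom G G') (χ.symm_apply_apply (f ⊗ₜ g))
  obtain ⟨L, hL, hL', φ, hφ⟩ := hP.exists_functor (k := k) (x := (B.obj G).obj G')
    r.toLinearMap (map_one r) (fun f g => r.map_mul' g f)
  refine ⟨L, hL, hL', ?_⟩
  obtain ⟨h₁, h₂⟩ := additive_comp_whiskeringRight hbox L
  have h₃ := hB.additive
  have h₄ := hB.additive_right
  have hφ₁ : ∀ f : G ⟶ G, L.map ((box.map f).app G') ≫ φ.hom = φ.hom ≫ (B.map f).app G' :=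
    fun f => by
      have := hr f (𝟙 G')
      rw [hbox.endHom_tmul, hB.endHom_tmul, CategoryTheory.Functor.map_id,
        CategoryTheory.Functor.map_id, Category.comp_id, Category.comp_id] at this
      exact (hφ _).trans (congrArg (φ.hom ≫ ·) this)
  have hφ₂ : ∀ f : G' ⟶ G', L.map ((box.obj G).map f) ≫ φ.hom = φ.hom ≫ (B.obj G).map f :=
    fun f => by
      have := hr (𝟙 G) f
      rw [hbox.endHom_tmul, hB.endHom_tmul, CategoryTheory.Functor.map_id,
        CategoryTheory.Functor.map_id, NatTrans.id_app, NatTrans.id_app, Category.id_comp,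
        Category.id_comp] at this
      exact (hφ _).trans (congrArg (φ.hom ≫ ·) this)
  obtain ⟨s, hs⟩ := exists_natTrans₂ (U := box ⋙ (Functor.whiskeringRight D P E).obj L) (U' := B)
    h₂ h₄ hG hG' φ.hom hφ₁ hφ₂
  obtain ⟨t, ht⟩ := exists_natTrans₂ (U := B) (U' := box ⋙ (Functor.whiskeringRight D P E).obj L)
    h₄ h₂ hG hG' φ.inv
    (fun f => by
      rw [Iso.comp_inv_eq, Category.assoc]
      exact (φ.inv_hom_id_assoc _).symm.trans (congrArg (φ.inv ≫ ·) (hφ₁ f).symm))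
    (fun f => by
      rw [Iso.comp_inv_eq, Category.assoc]
      exact (φ.inv_hom_id_assoc _).symm.trans (congrArg (φ.inv ≫ ·) (hφ₂ f).symm))
  refine ⟨⟨s, t, natTrans₂_ext h₂ hG hG' ?_, natTrans₂_ext h₄ hG hG' ?_⟩⟩
  · change (s.app G).app G' ≫ (t.app G).app G' = _
    rw [hs, ht]
    exact φ.hom_inv_id
  · change (t.app G).app G' ≫ (s.app G).app G' = _
    rw [hs, ht]
    exact φ.inv_hom_id

end Bilinear

end BialgebraReconstruction

end
noncomputable section

namespace BialgebraReconstruction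

/-! ### Endomorphisms of the tensor product of two fibre functors -/

section TensorRep

variable {k : Type u} [Field k] {A B : Type w} [Ring A] [Algebra k A] [Ring B] [Algebra k B]
  {V W : Vec k} (r : A →ₐ[k] End V) (s : B →ₐ[k] End W)

/-- The orbit map `a ↦ a x` of a representation. -/
def orbit (x : V) : A →ₗ[k] V where
  toFun a := (r a : V ⟶ V).hom.hom x
  map_add' a b := by rw [map_add]; rfl
  map_smul' c a := by rw [map_smul]; rfl

theorem tensorRep_apply_tmul (t : A ⊗[k] B) (x : V) (y : W) :
    (tensorRep r s t : V ⊗ W ⟶ V ⊗ W).hom.hom (x ⊗ₜ[k] y : V ⊗[k] W) =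
      TensorProduct.map (orbit r x) (orbit s y) t := by
  induction t with
  | zero => rw [tensorRep_zero, map_zero]; rfl
  | add a b ha hb => rw [tensorRep_add, map_add, ← ha, ← hb]; rfl
  | tmul a b => rw [tensorRep_tmul]; rfl

/-- Tensor products of endomorphisms of finite-dimensional spaces are independent:
`End V ⊗ End W` embeds in `End (V ⊗ W)`. -/
theorem endTensor_injective (V W : Vec k) : Function.Injective (endTensor V W) := by
  let e : ∀ U : Vec k, End U ≃ₗ[k] (U →ₗ[k] U) := fun U =>
    { toFun := fun f : U ⟶ U => f.hom.hom
      map_add' := fun _ _ => rfl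
      map_smul' := fun _ _ => rfl
      invFun := fun f => FGModuleCat.ofHom f
      left_inv := fun _ => rfl
      right_inv := fun _ => rfl }
  have h : ∀ t, e (V ⊗ W) (endTensor V W t) =
      homTensorHomEquiv k V W V W (TensorProduct.congr (e V) (e W) t) := fun t => by
    induction t with
    | zero => rw [map_zero (endTensor V W), LinearEquiv.map_zero, LinearEquiv.map_zero,
        LinearEquiv.map_zero]
    | add a b ha hb => rw [map_add (endTensor V W), LinearEquiv.map_add, LinearEquiv.map_add,
        LinearEquiv.map_add, ha, hb]
    | tmul a b =>
      rw [TensorProduct.congr_tmul, homTensorHomEquiv_apply, TensorProduct.homTensorHomMap_apply,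
        endTensor_tmul]
      rfl
  intro t t' htt'
  refine (TensorProduct.congr (e V) (e W)).injective
    ((homTensorHomEquiv k V W V W).injective ?_)
  rw [← h, ← h, htt']

variable {r s} in
theorem tensorRep_injective (hr : Function.Injective r) (hs : Function.Injective s) :
    Function.Injective (tensorRep r s) :=
  (endTensor_injective V W).comp
    (TensorProduct.map_injective_of_flat_flat r.toLinearMap s.toLinearMap hr hs)

end TensorRep

section Legs

variable {k : Type u} [Field k]

theorem leg_naturality (X : Slice k) {c c' : X.C} (f : c ⟶ c') (η : End X.F) :
    (leg X c η : X.F.obj c ⟶ X.F.obj c) ≫ X.F.map f =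
      X.F.map f ≫ (leg X c' η : X.F.obj c' ⟶ X.F.obj c') :=
  (NatTrans.naturality η f).symm

variable [IsAlgClosed k]

/-- Natural endomorphisms of a fibre functor are determined on a single object, namely on a
representing one. -/
theorem exists_leg_injective (X : Slice k) : ∃ G : X.C, Function.Injective (leg X G) := by
  obtain ⟨⟨G, g, -, hg⟩, -⟩ := X.exists_universal_and_model
  exact ⟨G, fun η η' h => hg.endEquiv.injective
    (congrArg (fun f : X.F.obj G ⟶ X.F.obj G => f.hom.hom g) h)⟩

variable {X Y : Slice k}

theorem eq_of_tensorRep_leg {t t' : End X.F ⊗[k] End Y.F}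
    (h : ∀ c d, tensorRep (leg X c) (leg Y d) t = tensorRep (leg X c) (leg Y d) t') : t = t' := by
  obtain ⟨G, hG⟩ := exists_leg_injective X
  obtain ⟨G', hG'⟩ := exists_leg_injective Y
  exact tensorRep_injective hG hG' (h G G')

/-- The natural endomorphisms of `(c, d) ↦ F(c) ⊗ F'(d)` form the algebra `End F ⊗ End F'`. -/
theorem exists_tensorRep_leg_eq
    (t : ∀ (c : X.C) (d : Y.C), X.F.obj c ⊗ Y.F.obj d ⟶ X.F.obj c ⊗ Y.F.obj d)
    (ht : ∀ {c c' : X.C} {d d' : Y.C} (f : c ⟶ c') (g : d ⟶ d'),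
      t c d ≫ (X.F.map f ⊗ₘ Y.F.map g) = (X.F.map f ⊗ₘ Y.F.map g) ≫ t c' d') :
    ∃ z : End X.F ⊗[k] End Y.F, ∀ c d, tensorRep (leg X c) (leg Y d) z = t c d := by
  obtain ⟨⟨G, g, -, hg⟩, -⟩ := X.exists_universal_and_model
  obtain ⟨⟨G', g', -, hg'⟩, -⟩ := Y.exists_universal_and_model
  let y : X.F.obj G ⊗[k] Y.F.obj G' := (t G G').hom.hom (g ⊗ₜ[k] g' : X.F.obj G ⊗[k] Y.F.obj G')
  obtain ⟨z, hz⟩ := (TensorProduct.congr hg.endEquiv hg'.endEquiv).surjective y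
  have hz' : (tensorRep (leg X G) (leg Y G') z :
      X.F.obj G ⊗ Y.F.obj G' ⟶ X.F.obj G ⊗ Y.F.obj G').hom.hom
        (g ⊗ₜ[k] g' : X.F.obj G ⊗[k] Y.F.obj G') = y :=
    (tensorRep_apply_tmul _ _ z g g').trans hz
  refine ⟨z, fun c d => Vec.hom_ext_apply fun x => ?_⟩
  change X.F.obj c ⊗[k] Y.F.obj d at x
  induction x using TensorProduct.induction_on with
  | zero => exact (map_zero _).trans (map_zero _).symm
  | add a b ha hb => exact (map_add _ _ _).trans ((congrArg₂ _ ha hb).trans (map_add _ _ _).symm)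
  | tmul a b =>
    obtain ⟨f, rfl⟩ := (hg.homEquiv c).surjective a
    obtain ⟨f', rfl⟩ := (hg'.homEquiv d).surjective b
    have h₁ := tensorRep_naturality (leg X G) (leg Y G') (leg X c) (leg Y d) (X.F.map f)
      (Y.F.map f') (leg_naturality X f) (leg_naturality Y f') z
    have h₂ := ht f f'
    exact ((congrArg (fun l => l.hom.hom (g ⊗ₜ[k] g' : X.F.obj G ⊗[k] Y.F.obj G')) h₁).symm.trans
      (congrArg (X.F.map f ⊗ₘ Y.F.map f').hom.hom hz')).trans
      (congrArg (fun l => l.hom.hom (g ⊗ₜ[k] g' : X.F.obj G ⊗[k] Y.F.obj G')) h₂)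

/-- A representation of `R` on `F(c) ⊗ F'(d)`, natural in `c` and `d`, is given by an algebra
homomorphism `R → End F ⊗ End F'`. -/
theorem exists_algHom_tensorRep_leg {R : Type*} [Ring R] [Algebra k R]
    (t : ∀ (c : X.C) (d : Y.C), R →ₐ[k] End (X.F.obj c ⊗ Y.F.obj d : Vec k))
    (ht : ∀ (x : R) {c c' : X.C} {d d' : Y.C} (f : c ⟶ c') (g : d ⟶ d'),
      (t c d x : X.F.obj c ⊗ Y.F.obj d ⟶ X.F.obj c ⊗ Y.F.obj d) ≫ (X.F.map f ⊗ₘ Y.F.map g) =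
        (X.F.map f ⊗ₘ Y.F.map g) ≫
          (t c' d' x : X.F.obj c' ⊗ Y.F.obj d' ⟶ X.F.obj c' ⊗ Y.F.obj d')) :
    ∃ φ : R →ₐ[k] End X.F ⊗[k] End Y.F,
      ∀ c d x, tensorRep (leg X c) (leg Y d) (φ x) = t c d x := by
  choose φ hφ using fun x => exists_tensorRep_leg_eq (fun c d => t c d x) (ht x)
  exact ⟨{ toFun := φ
           map_one' := eq_of_tensorRep_leg fun c d => by rw [hφ, map_one, map_one]
           map_mul' := fun x y => eq_of_tensorRep_leg fun c d => by
             rw [hφ, map_mul, map_mul, hφ, hφ]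
           map_zero' := eq_of_tensorRep_leg fun c d => by rw [hφ, map_zero, map_zero]
           map_add' := fun x y => eq_of_tensorRep_leg fun c d => by
             rw [hφ, map_add, map_add, hφ, hφ]
           commutes' := fun r => eq_of_tensorRep_leg fun c d => by
             rw [hφ, AlgHom.commutes, AlgHom.commutes] }, fun c d x => hφ x c d⟩

end Legs

namespace DeligneProduct

variable {k : Type u} [Field k] {X Y P : Slice k} (δ : DeligneProduct X Y P)

/-- Natural endomorphisms of the fibre functor of a Deligne product are determined on the objects
`c ⊠ d`, by uniqueness of descent. -/
theorem end_ext {η η' : End P.F} (h : ∀ c d, NatTrans.app η ((δ.box.obj c).obj d) =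
    NatTrans.app η' ((δ.box.obj c).obj d)) : η = η' := by
  refine (δ.existsUnique_desc (Vec k) P.F P.F
    (Functor.whiskerLeft δ.box ((Functor.whiskeringRight Y.C P.C (Vec k)).map η'))).unique ?_ rfl
  exact NatTrans.ext (funext fun c => NatTrans.ext (funext fun d => h c d))

/-- An element of `End F ⊗ End F'` acts on `⊗ ∘ (F ⊠ F')`, by existence of descent. -/
theorem exists_end (t : End X.F ⊗[k] End Y.F) : ∃ η : End P.F, ∀ c d,
    NatTrans.app η ((δ.box.obj c).obj d) = (δ.fib c d).inv ≫
      (tensorRep (leg X c) (leg Y d) t : X.F.obj c ⊗ Y.F.obj d ⟶ X.F.obj c ⊗ Y.F.obj d) ≫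
        (δ.fib c d).hom := by
  have hnat : ∀ {c c' : X.C} {d d' : Y.C} (f : c ⟶ c') (g : d ⟶ d'),
      P.F.map ((δ.box.map f).app d ≫ (δ.box.obj c').map g) ≫ (δ.fib c' d').inv ≫
        (tensorRep (leg X c') (leg Y d') t : X.F.obj c' ⊗ Y.F.obj d' ⟶ _) ≫ (δ.fib c' d').hom =
      ((δ.fib c d).inv ≫ (tensorRep (leg X c) (leg Y d) t : X.F.obj c ⊗ Y.F.obj d ⟶ _) ≫
        (δ.fib c d).hom) ≫ P.F.map ((δ.box.map f).app d ≫ (δ.box.obj c').map g) := by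
    intro c c' d d' f g
    have e₁ := δ.fib_natural f g
    have e₂ := tensorRep_naturality (leg X c) (leg Y d) (leg X c') (leg Y d') (X.F.map f)
      (Y.F.map g) (leg_naturality X f) (leg_naturality Y g) t
    have e₃ : P.F.map ((δ.box.map f).app d ≫ (δ.box.obj c').map g) =
        (δ.fib c d).inv ≫ (X.F.map f ⊗ₘ Y.F.map g) ≫ (δ.fib c' d').hom := by
      rw [e₁, Iso.inv_hom_id_assoc]
    rw [e₃]
    simp only [Category.assoc, Iso.hom_inv_id_assoc]
    rw [reassoc_of% e₂]
  obtain ⟨η, hη, -⟩ := δ.existsUnique_desc (Vec k) P.F P.F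
    { app := fun c =>
        { app := fun d => (δ.fib c d).inv ≫
            (tensorRep (leg X c) (leg Y d) t : X.F.obj c ⊗ Y.F.obj d ⟶ _) ≫ (δ.fib c d).hom
          naturality := fun d d' g => by
            have := hnat (𝟙 c) g
            rw [CategoryTheory.Functor.map_id, NatTrans.id_app, Category.id_comp] at this
            exact this }
      naturality := fun c c' f => NatTrans.ext (funext fun d => by
        have := hnat f (𝟙 d)
        rw [CategoryTheory.Functor.map_id, Category.comp_id] at this
        exact this) }
  exact ⟨η, fun c d => congrArg (fun l => (l.app c).app d) hη⟩

/-- The canonical algebra homomorphism `End F ⊗ End F' → End (⊗ ∘ (F ⊠ F'))`. -/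
def thetaHom : End X.F ⊗[k] End Y.F →ₐ[k] End P.F where
  toFun t := (δ.exists_end t).choose
  map_one' := δ.end_ext fun c d => by
    rw [(δ.exists_end 1).choose_spec, map_one]
    change (δ.fib c d).inv ≫ 𝟙 _ ≫ (δ.fib c d).hom = 𝟙 _
    rw [Category.id_comp, Iso.inv_hom_id]
  map_mul' x y := δ.end_ext fun c d => by
    rw [(δ.exists_end (x * y)).choose_spec, map_mul]
    change _ = NatTrans.app (δ.exists_end y).choose _ ≫ NatTrans.app (δ.exists_end x).choose _
    rw [(δ.exists_end x).choose_spec, (δ.exists_end y).choose_spec]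
    simp only [Category.assoc, Iso.hom_inv_id_assoc]
    rfl
  map_zero' := δ.end_ext fun c d => by
    rw [(δ.exists_end 0).choose_spec, tensorRep_zero, zero_comp, comp_zero]
    rfl
  map_add' x y := δ.end_ext fun c d => by
    rw [(δ.exists_end (x + y)).choose_spec, tensorRep_add, Preadditive.add_comp,
      Preadditive.comp_add]
    change _ = NatTrans.app (δ.exists_end x).choose _ + NatTrans.app (δ.exists_end y).choose _
    rw [(δ.exists_end x).choose_spec, (δ.exists_end y).choose_spec]
  commutes' r := δ.end_ext fun c d => by
    rw [(δ.exists_end _).choose_spec, AlgHom.commutes]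
    change (δ.fib c d).inv ≫ (r • 𝟙 _) ≫ (δ.fib c d).hom = r • 𝟙 _
    rw [Linear.smul_comp, Linear.comp_smul, Category.id_comp, Iso.inv_hom_id]

theorem thetaHom_app (t : End X.F ⊗[k] End Y.F) (c : X.C) (d : Y.C) :
    (δ.fib c d).hom ≫ NatTrans.app (δ.thetaHom t) ((δ.box.obj c).obj d) =
      (tensorRep (leg X c) (leg Y d) t : X.F.obj c ⊗ Y.F.obj d ⟶ X.F.obj c ⊗ Y.F.obj d) ≫
        (δ.fib c d).hom := by
  rw [← Iso.eq_inv_comp]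
  exact (δ.exists_end t).choose_spec c d

variable [IsAlgClosed k]

theorem thetaHom_bijective : Function.Bijective δ.thetaHom := by
  constructor
  · intro t t' h
    refine eq_of_tensorRep_leg fun c d => ?_
    refine (cancel_mono (δ.fib c d).hom).1 ((δ.thetaHom_app t c d).symm.trans ?_)
    rw [h]
    exact δ.thetaHom_app t' c d
  · intro η
    -- the restriction of `η` to the objects `c ⊠ d` is given by an element of `End F ⊗ End F'`
    obtain ⟨t, ht⟩ := exists_tensorRep_leg_eq (X := X) (Y := Y)
      (fun c d => (δ.fib c d).hom ≫ NatTrans.app η _ ≫ (δ.fib c d).inv) fun {c c' d d'} f g => by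
        have e₁ := δ.fib_natural f g
        have e₂ := NatTrans.naturality η ((δ.box.map f).app d ≫ (δ.box.obj c').map g)
        have e₃ : (X.F.map f ⊗ₘ Y.F.map g) = (δ.fib c d).hom ≫
            P.F.map ((δ.box.map f).app d ≫ (δ.box.obj c').map g) ≫ (δ.fib c' d').inv := by
          rw [← Category.assoc, ← e₁, Category.assoc, Iso.hom_inv_id, Category.comp_id]
        rw [e₃]
        simp only [Category.assoc, Iso.inv_hom_id_assoc]
        rw [reassoc_of% e₂]
    refine ⟨t, δ.end_ext fun c d => ?_⟩
    rw [← cancel_epi (δ.fib c d).hom, δ.thetaHom_app, ht]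
    simp only [Category.assoc, Iso.inv_hom_id, Category.comp_id]

/-- The canonical isomorphism `End F ⊗ End F' ≅ End (⊗ ∘ (F ⊠ F'))`. -/
def theta : End X.F ⊗[k] End Y.F ≃ₐ[k] End P.F := AlgEquiv.ofBijective _ δ.thetaHom_bijective

theorem theta_app (t : End X.F ⊗[k] End Y.F) (c : X.C) (d : Y.C) :
    (δ.fib c d).hom ≫ NatTrans.app (δ.theta t) ((δ.box.obj c).obj d) =
      (tensorRep (leg X c) (leg Y d) t : X.F.obj c ⊗ Y.F.obj d ⟶ X.F.obj c ⊗ Y.F.obj d) ≫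
        (δ.fib c d).hom := δ.thetaHom_app t c d

end DeligneProduct

end BialgebraReconstruction

end
noncomputable section

namespace BialgebraReconstruction

/-! ### Modules over a semisimple algebra as an object of `Slice` -/

namespace FDMod

variable {k : Type u} [Field k] {R : Type w} [Ring R] [Algebra k R]

theorem intertwines {M N : FDMod k R} (f : M ⟶ N) (a : R) (x : M.V) :
    f.1.hom.hom ((M.ρ a : M.V ⟶ M.V).hom.hom x) =
      (N.ρ a : N.V ⟶ N.V).hom.hom (f.1.hom.hom x) :=
  congrArg (fun l : M.V ⟶ N.V => l.hom.hom x) (f.2 a)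

/-- A module which is free on `x` has a unique morphism sending `x` to a given element. -/
theorem bijective_eval_of_free {N : FDMod k R} {x : N.V} (hx : Function.Bijective (orbit N.ρ x))
    (M : FDMod k R) : Function.Bijective fun f : N ⟶ M => (f.1.hom.hom x : M.V) := by
  constructor
  · intro f g h
    refine Subtype.ext (Vec.hom_ext_apply fun y => ?_)
    obtain ⟨a, rfl⟩ := hx.surjective y
    exact (intertwines f a x).trans ((congrArg _ h).trans (intertwines g a x).symm)
  · intro y
    let e := LinearEquiv.ofBijective _ hx
    have he : ∀ a, e.symm ((N.ρ a : N.V ⟶ N.V).hom.hom x) = a := fun a => e.symm_apply_apply a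
    refine ⟨⟨FGModuleCat.ofHom (orbit M.ρ y ∘ₗ e.symm.toLinearMap), fun a =>
      Vec.hom_ext_apply fun z => ?_⟩, ?_⟩
    · obtain ⟨b, rfl⟩ := e.surjective z
      change (M.ρ (e.symm ((N.ρ a : N.V ⟶ N.V).hom.hom ((N.ρ b : N.V ⟶ N.V).hom.hom x))) :
          M.V ⟶ M.V).hom.hom y =
        (M.ρ a : M.V ⟶ M.V).hom.hom ((M.ρ (e.symm (e b)) : M.V ⟶ M.V).hom.hom y)
      have h : (N.ρ a : N.V ⟶ N.V).hom.hom ((N.ρ b : N.V ⟶ N.V).hom.hom x) =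
          (N.ρ (a * b) : N.V ⟶ N.V).hom.hom x := by rw [map_mul]; rfl
      rw [h, he, e.symm_apply_apply, map_mul]
      rfl
    · change (M.ρ (e.symm x) : M.V ⟶ M.V).hom.hom y = y
      have h : e.symm x = 1 := by
        conv_rhs => rw [← he 1, map_one]
        rfl
      rw [h, map_one]
      rfl

/-- Over a semisimple algebra, a module which is free on one element generates. -/
theorem generates_of_free {R : Type u} [Ring R] [Algebra k R] [IsSemisimpleRing R] {N : FDMod k R}
    {x : N.V} (hx : Function.Bijective (orbit N.ρ x)) : Generates N := fun M => by
  obtain ⟨n, v, w, hw, hvw⟩ := FDMod.exists_retraction M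
  choose b hb using fun i => (bijective_eval_of_free hx M).surjective (v i)
  replace hb : ∀ i, (b i).1.hom.hom x = v i := hb
  refine ⟨n, fun i => ⟨FGModuleCat.ofHom (orbit N.ρ x ∘ₗ LinearMap.proj i ∘ₗ w), fun a =>
    Vec.hom_ext_apply fun y => ?_⟩, b, Subtype.ext ?_⟩
  · change (N.ρ (w ((M.ρ a : M.V ⟶ M.V).hom.hom y) i) : N.V ⟶ N.V).hom.hom x =
      (N.ρ a : N.V ⟶ N.V).hom.hom ((N.ρ (w y i) : N.V ⟶ N.V).hom.hom x)
    rw [hw, Pi.smul_apply, smul_eq_mul, map_mul]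
    rfl
  · have hsum : ∀ (s : Finset (Fin n)) (f : Fin n → (M ⟶ M)),
        (∑ i ∈ s, f i).1 = ∑ i ∈ s, (f i).1 := fun s f =>
      map_sum (intertwiners M M).subtype f s
    refine (hsum _ _).trans (Vec.hom_ext_apply fun y => ?_)
    rw [Vec.sum_apply]
    refine (Finset.sum_congr rfl fun i _ => ?_).trans (hvw y)
    change (b i).1.hom.hom ((N.ρ (w y i) : N.V ⟶ N.V).hom.hom x) = _
    rw [intertwines, hb]

/-- The regular module is free on `1`. -/
theorem orbit_ofModule_bijective {R : Type u} [Ring R] [Algebra k R] [Module.Finite k R] :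
    Function.Bijective (orbit (ofModule (k := k) (A := R) R).ρ (1 : R)) := by
  have : ∀ a : R, orbit (ofModule (k := k) (A := R) R).ρ (1 : R) a = a := fun a => mul_one a
  exact ⟨fun a b h => (this a).symm.trans (h.trans (this b)), fun a => ⟨a, this a⟩⟩

variable (k R) in
/-- The action of the elements of `R`, as natural endomorphisms of the forgetful functor. -/
def actHom : R →ₐ[k] End (forget k R) where
  toFun a := { app := fun M => M.ρ a, naturality := fun _ _ f => (f.2 a).symm }
  map_one' := NatTrans.ext (funext fun M => map_one M.ρ)
  map_mul' a b := NatTrans.ext (funext fun M => map_mul M.ρ a b)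
  map_zero' := NatTrans.ext (funext fun M => map_zero M.ρ)
  map_add' a b := NatTrans.ext (funext fun M => map_add M.ρ a b)
  commutes' r := NatTrans.ext (funext fun M => M.ρ.commutes r)

theorem actHom_bijective {R : Type u} [Ring R] [Algebra k R] [Module.Finite k R] :
    Function.Bijective (actHom k R) := by
  have hx := orbit_ofModule_bijective (k := k) (R := R)
  constructor
  · intro a b h
    exact hx.injective (congrArg (fun η : End (forget k R) =>
      (NatTrans.app η (ofModule R)).hom.hom (1 : R)) h)
  · intro η
    obtain ⟨a, ha⟩ := hx.surjective ((NatTrans.app η (ofModule R)).hom.hom (1 : R))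
    refine ⟨a, NatTrans.ext (funext fun M => Vec.hom_ext_apply fun y => ?_)⟩
    obtain ⟨f, rfl⟩ := (bijective_eval_of_free hx M).surjective y
    change (M.ρ a : M.V ⟶ M.V).hom.hom (f.1.hom.hom (1 : R)) =
      (NatTrans.app η M).hom.hom (((forget k R).map f).hom.hom (1 : R))
    refine (intertwines f a (show (ofModule (k := k) (A := R) R).V from (1 : R))).symm.trans ?_
    exact (congrArg f.1.hom.hom ha).trans (congrArg (fun l : (ofModule (k := k) (A := R) R).V ⟶ M.V
      => l.hom.hom (1 : R)) (NatTrans.naturality η f)).symm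

variable (k) in
/-- A finite-dimensional algebra is the algebra of natural endomorphisms of the forgetful functor
of its category of modules. -/
def act (R : Type u) [Ring R] [Algebra k R] [Module.Finite k R] : R ≃ₐ[k] End (forget k R) :=
  AlgEquiv.ofBijective (actHom k R) actHom_bijective

end FDMod

section ModSlice

variable {k : Type u} [Field k]

variable (k) in
/-- The object `(Mod(A), Forget)` of `Slice`. -/
def modSlice (A : Type u) [Ring A] [Algebra k A] [Module.Finite k A] [IsSemisimpleRing A] :
    Slice k where
  C := FDMod k A
  F := FDMod.forget k A

variable {A B : Type u} [Ring A] [Algebra k A] [Ring B] [Algebra k B]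

/-- The fibres of the objects of `X` as `A`-modules, for an algebra `A` acting on the fibre
functor. -/
def Slice.toFDMod (X : Slice k) (e : A →ₐ[k] End X.F) : X.C ⥤ FDMod k A where
  obj c := ⟨X.F.obj c, (leg X c).comp e⟩
  map f := ⟨X.F.map f, fun a => leg_naturality X f (e a)⟩
  map_id c := Subtype.ext (X.F.map_id c)
  map_comp f g := Subtype.ext (X.F.map_comp f g)

/-- The external tensor product of modules, as a bifunctor. -/
def FDMod.extTensorFunctor : FDMod k A ⥤ FDMod k B ⥤ FDMod k (A ⊗[k] B) where
  obj M :=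
    { obj := fun N => M.extTensor N
      map := fun {N N'} g => ⟨M.V ◁ g.1, fun t => by
        rw [← id_tensorHom]
        exact tensorRep_naturality M.ρ N.ρ M.ρ N'.ρ (𝟙 M.V) g.1 (𝟙 M :).2 g.2 t⟩
      map_id := fun N => Subtype.ext (whiskerLeft_id M.V N.V)
      map_comp := fun f g => Subtype.ext (whiskerLeft_comp M.V f.1 g.1) }
  map {M M'} f :=
    { app := fun N => ⟨f.1 ▷ N.V, fun t => by
        rw [← tensorHom_id]
        exact tensorRep_naturality M.ρ N.ρ M'.ρ N.ρ f.1 (𝟙 N.V) f.2 (𝟙 N :).2 t⟩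
      naturality := fun N N' g => Subtype.ext (whisker_exchange f.1 g.1).symm.symm }
  map_id M := NatTrans.ext (funext fun N => Subtype.ext (id_whiskerRight M.V N.V))
  map_comp f g := NatTrans.ext (funext fun N => Subtype.ext (comp_whiskerRight f.1 g.1 N.V))

/-- The bifunctor `(c, d) ↦ F(c) ⊗ F'(d)` with values in the category of `A ⊗ B`-modules. -/
def Slice.box (X Y : Slice k) (e : A →ₐ[k] End X.F) (e' : B →ₐ[k] End Y.F) :
    X.C ⥤ Y.C ⥤ FDMod k (A ⊗[k] B) :=
  X.toFDMod e ⋙ FDMod.extTensorFunctor ⋙ (Functor.whiskeringLeft _ _ _).obj (Y.toFDMod e')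

theorem Slice.box_isBilinear (X Y : Slice k) (e : A →ₐ[k] End X.F) (e' : B →ₐ[k] End Y.F) :
    IsBilinear k (X.box Y e e') where
  additive_right c := ⟨fun {d d' f g} => Subtype.ext (by
    change X.F.obj c ◁ Y.F.map (f + g) = X.F.obj c ◁ Y.F.map f + X.F.obj c ◁ Y.F.map g
    rw [Functor.map_add, MonoidalPreadditive.whiskerLeft_add])⟩
  linear_right c := ⟨fun {d d'} f r => Subtype.ext (by
    change X.F.obj c ◁ Y.F.map (r • f) = r • (X.F.obj c ◁ Y.F.map f)
    rw [Functor.map_smul, MonoidalLinear.whiskerLeft_smul])⟩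
  additive_left d := ⟨fun {c c' f g} => Subtype.ext (by
    change X.F.map (f + g) ▷ Y.F.obj d = X.F.map f ▷ Y.F.obj d + X.F.map g ▷ Y.F.obj d
    rw [Functor.map_add, MonoidalPreadditive.add_whiskerRight])⟩
  linear_left d := ⟨fun {c c'} f r => Subtype.ext (by
    change X.F.map (r • f) ▷ Y.F.obj d = r • (X.F.map f ▷ Y.F.obj d)
    rw [Functor.map_smul, MonoidalLinear.smul_whiskerRight])⟩

variable [IsAlgClosed k] [Module.Finite k A] [IsSemisimpleRing A] [Module.Finite k B]
  [IsSemisimpleRing B]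

instance : IsSemisimpleRing (A ⊗[k] B) := isSemisimpleRing_tensorProduct k A B

/-- If `F` and `F'` are represented by `G` and `G'`, then `F(G) ⊗ F'(G')` is free of rank one over
`A ⊗ B`, and its endomorphisms are those induced by `End G ⊗ End G'`. -/
theorem Slice.box_generator (X Y : Slice k) (e : A ≃ₐ[k] End X.F) (e' : B ≃ₐ[k] End Y.F)
    {G : X.C} {g : X.F.obj G} (hg : IsUniversal X G g) {G' : Y.C} {g' : Y.F.obj G'}
    (hg' : IsUniversal Y G' g') :
    Generates (((X.box Y e.toAlgHom e'.toAlgHom).obj G).obj G') ∧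
      Function.Bijective ((X.box_isBilinear Y e.toAlgHom e'.toAlgHom).endHom G G') := by
  let N := ((X.box Y e.toAlgHom e'.toAlgHom).obj G).obj G'
  let x : N.V := (g ⊗ₜ[k] g' : X.F.obj G ⊗[k] Y.F.obj G')
  have hx : Function.Bijective (orbit N.ρ x) := by
    have : ∀ t, orbit N.ρ x t = TensorProduct.congr (e.toLinearEquiv.trans hg.endEquiv)
        (e'.toLinearEquiv.trans hg'.endEquiv) t := fun t => tensorRep_apply_tmul _ _ t g g'
    rw [funext this]
    exact LinearEquiv.bijective _
  refine ⟨FDMod.generates_of_free hx, ?_⟩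
  have h : ∀ t, ((X.box_isBilinear Y e.toAlgHom e'.toAlgHom).endHom G G' t : N ⟶ N).1.hom.hom x =
      TensorProduct.congr (hg.homEquiv G) (hg'.homEquiv G') t := fun t => by
    induction t with
    | zero => rw [map_zero]; exact (LinearEquiv.map_zero _).symm
    | add a b ha hb => rw [map_add, LinearEquiv.map_add, ← ha, ← hb]; rfl
    | tmul f f' => rw [IsBilinear.endHom_tmul]; rfl
  refine (Function.Bijective.of_comp_iff' (FDMod.bijective_eval_of_free hx N) _).1 ?_
  rw [show _ ∘ _ = _ from funext h]
  exact LinearEquiv.bijective _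

theorem Slice.box_existsUnique_descent (X Y : Slice k) (e : A ≃ₐ[k] End X.F) (e' : B ≃ₐ[k] End Y.F)
    {E : Type*} [Category E] [Preadditive E] (L L' : FDMod k (A ⊗[k] B) ⥤ E) (hL : L.Additive)
    (hL' : L'.Additive) (t : X.box Y e.toAlgHom e'.toAlgHom ⋙
        (Functor.whiskeringRight Y.C (FDMod k (A ⊗[k] B)) E).obj L ⟶
      X.box Y e.toAlgHom e'.toAlgHom ⋙
        (Functor.whiskeringRight Y.C (FDMod k (A ⊗[k] B)) E).obj L') :
    ∃! s : L ⟶ L', Functor.whiskerLeft (X.box Y e.toAlgHom e'.toAlgHom)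
      ((Functor.whiskeringRight Y.C (FDMod k (A ⊗[k] B)) E).map s) = t := by
  obtain ⟨⟨G, g, hG, hg⟩, -⟩ := X.exists_universal_and_model
  obtain ⟨⟨G', g', hG', hg'⟩, -⟩ := Y.exists_universal_and_model
  obtain ⟨h₁, h₂⟩ := X.box_generator Y e e' hg hg'
  exact existsUnique_descent (X.box_isBilinear Y e.toAlgHom e'.toAlgHom) hG hG' h₁ h₂.surjective
    L L' t

/-- The category of `A ⊗ B`-modules is a Deligne tensor product of `(C, F)` and `(C', F')` if `A`
and `B` are the endomorphism algebras of `F` and `F'`. -/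
def deligneProductOfModels (X Y : Slice k) (e : A ≃ₐ[k] End X.F) (e' : B ≃ₐ[k] End Y.F) :
    DeligneProduct X Y (modSlice k (A ⊗[k] B)) where
  box := X.box Y e.toAlgHom e'.toAlgHom
  bilinear := X.box_isBilinear Y e.toAlgHom e'.toAlgHom
  exists_desc := by
    intro E _ _ _ _ L hL
    obtain ⟨⟨G, g, hG, hg⟩, -⟩ := X.exists_universal_and_model
    obtain ⟨⟨G', g', hG', hg'⟩, -⟩ := Y.exists_universal_and_model
    obtain ⟨h₁, h₂⟩ := X.box_generator Y e e' hg hg'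
    have := Abelian.hasFiniteBiproducts (C := E)
    exact exists_descent (X.box_isBilinear Y e.toAlgHom e'.toAlgHom) hG hG' h₁ h₂ L hL
  existsUnique_desc := by
    intro E _ _ _ _ L L' hL _ hL' _ t
    exact X.box_existsUnique_descent Y e e' L L' hL hL' t
  fib c d := Iso.refl _
  fib_natural {c c' d d'} f g := by
    change (X.F.map f ⊗ₘ Y.F.map g) ≫ 𝟙 _ = 𝟙 _ ≫ X.F.map f ▷ Y.F.obj d ≫ X.F.obj c' ◁ Y.F.map g
    rw [Category.comp_id, Category.id_comp, MonoidalCategory.tensorHom_def]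

theorem exists_deligneProduct (X Y : Slice k) : ∃ P : Slice k, Nonempty (DeligneProduct X Y P) := by
  obtain ⟨-, A, _, _, _, _, ⟨e⟩⟩ := X.exists_universal_and_model
  obtain ⟨-, B, _, _, _, _, ⟨e'⟩⟩ := Y.exists_universal_and_model
  exact ⟨_, ⟨deligneProductOfModels X Y e e'⟩⟩

end ModSlice

end BialgebraReconstruction

end
noncomputable section

namespace BialgebraReconstruction

/-! ### Computing with pure tensors in endomorphism algebras -/

section Pure

variable {k : Type u} [Field k]

/-- The natural endomorphisms along which `p` is equivariant. -/
def equivariant {X Y : Slice k} (f : X ⟶ Y) {c : X.C} {d : Y.C} (p : X.F.obj c ⟶ Y.F.obj d) :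
    AddSubmonoid (End Y.F) where
  carrier := {η | NatTrans.app (endMap f η) c ≫ p = p ≫ NatTrans.app η d}
  zero_mem' := by
    change NatTrans.app (endMap f 0) c ≫ p = p ≫ 0
    rw [map_zero, comp_zero]
    exact zero_comp
  add_mem' {a b} ha hb := by
    change NatTrans.app (endMap f (a + b)) c ≫ p = p ≫ (NatTrans.app a d + NatTrans.app b d)
    rw [map_add, Preadditive.comp_add, ← ha, ← hb]
    exact Preadditive.add_comp _ _ _ _ _ _

theorem end_id_bijective : Function.Bijective (Algebra.ofId k (End (𝟭 (Vec k)))) := by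
  constructor
  · intro r s h
    have := congrArg (fun η : End (𝟭 (Vec k)) =>
      (NatTrans.app η (FGModuleCat.of k k)).hom.hom (1 : k)) h
    change r • (1 : k) = s • (1 : k) at this
    simpa using this
  · intro η
    let r : k := (NatTrans.app η (FGModuleCat.of k k)).hom.hom (1 : k)
    refine ⟨r, NatTrans.ext (funext fun V => Vec.hom_ext_apply fun (x : V) => ?_)⟩
    have := congrArg (fun l : FGModuleCat.of k k ⟶ V => l.hom.hom (1 : k))
      (NatTrans.naturality η (Vec.span V x))
    change (NatTrans.app η V).hom.hom ((1 : k) • x) = r • x at this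
    rw [one_smul] at this
    exact this.symm

variable (k) in
/-- The algebra of natural endomorphisms of the identity functor of `Vec` is `k`. -/
def unitEquiv : k ≃ₐ[k] End (Slice.unit k).F := AlgEquiv.ofBijective _ end_id_bijective

variable [IsAlgClosed k]

theorem sends_of_equivariant {X Y : Slice k} {f : X ⟶ Y} {c : X.C} {d : Y.C}
    {p : X.F.obj c ⟶ Y.F.obj d} (hp : IsIso p) (h : ∀ η, η ∈ equivariant f p) : Sends f c d p :=
  sends_iff.2 ⟨hp, h⟩

/-- Where `F` is faithful on endomorphisms, a 2-morphism computes the induced homomorphism. -/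
theorem Slice.Sends.endMap_eq {X Y : Slice k} {f : X ⟶ Y} {c : X.C} {d : Y.C}
    {p : X.F.obj c ⟶ Y.F.obj d} (hf : Sends f c d p) (hc : Function.Injective (leg X c))
    {η : End Y.F} {ξ : End X.F}
    (h : NatTrans.app ξ c ≫ p = p ≫ NatTrans.app η d) : endMap f η = ξ := by
  obtain ⟨hp, h'⟩ := sends_iff.1 hf
  exact hc ((cancel_mono p).1 ((h' η).trans h.symm))

/-- Every object of the target of an isomorphism in `Slice` is hit, up to a 2-morphism. -/
theorem exists_sends_of_iso {X Y : Slice k} (f : X ≅ Y) (d : Y.C) :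
    ∃ (c : X.C) (p : X.F.obj c ⟶ Y.F.obj d), Sends f.hom c d p := by
  obtain ⟨c, e, he⟩ := X.exists_fiber_iso (Y.F.obj d) ((leg Y d).comp (endMap f.inv))
  refine ⟨c, e.inv, sends_iff.2 ⟨inferInstance, fun η => ?_⟩⟩
  have := he (endMap f.hom η)
  change NatTrans.app (endMap f.inv (endMap f.hom η)) d ≫ e.hom = _ at this
  rw [← endMap_comp, f.inv_hom_id, endMap_id] at this
  rw [Iso.comp_inv_eq, Category.assoc, this, Iso.inv_hom_id_assoc]

namespace DeligneProduct

variable {X Y P : Slice k} (δ : DeligneProduct X Y P)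

theorem theta_tmul_app (a : End X.F) (b : End Y.F) (c : X.C) (d : Y.C) :
    NatTrans.app (δ.theta (a ⊗ₜ b)) ((δ.box.obj c).obj d) =
      (δ.fib c d).inv ≫ (NatTrans.app a c ⊗ₘ NatTrans.app b d) ≫ (δ.fib c d).hom := by
  rw [Iso.eq_inv_comp, δ.theta_app, tensorRep_tmul]
  rfl

theorem theta_mem (S : AddSubmonoid (End P.F)) (h : ∀ a b, δ.theta (a ⊗ₜ b) ∈ S) (η : End P.F) :
    η ∈ S := by
  obtain ⟨t, rfl⟩ := δ.theta.surjective η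
  induction t with
  | zero => rw [map_zero]; exact S.zero_mem
  | add x y hx hy => rw [map_add]; exact S.add_mem hx hy
  | tmul a b => exact h a b

/-- An additive submonoid containing the pure tensors in three factors is everything. -/
theorem theta_mem₃ {Y₁ Y₂ : Slice k} (ε : DeligneProduct Y₁ Y₂ Y) (S : AddSubmonoid (End P.F))
    (h : ∀ a b c, δ.theta (a ⊗ₜ ε.theta (b ⊗ₜ c)) ∈ S) (η : End P.F) : η ∈ S :=
  δ.theta_mem S (fun a => ε.theta_mem (S.comap (δ.theta.toLinearMap ∘ₗ
    TensorProduct.mk k _ _ a).toAddMonoidHom) (h a)) η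

theorem theta_mem₄ {Y₁ Y₂ Z₁ Z₂ : Slice k} (ε : DeligneProduct Y₁ Y₂ Y)
    (ζ : DeligneProduct Z₁ Z₂ Y₂) (S : AddSubmonoid (End P.F))
    (h : ∀ a b c d, δ.theta (a ⊗ₜ ε.theta (b ⊗ₜ ζ.theta (c ⊗ₜ d))) ∈ S) (η : End P.F) : η ∈ S :=
  δ.theta_mem S (fun a => ε.theta_mem₃ ζ (S.comap (δ.theta.toLinearMap ∘ₗ
    TensorProduct.mk k _ _ a).toAddMonoidHom) (h a)) η

/-- Morphisms into a Deligne product are determined by their effect on pure tensors of natural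
endomorphisms. -/
theorem hom_ext {Q : Slice k} {f g : Q ⟶ P}
    (h : ∀ a b, endMap f (δ.theta (a ⊗ₜ b)) = endMap g (δ.theta (a ⊗ₜ b))) : f = g :=
  endMap_injective (δ.theta_mem (AddMonoidHom.eqLocusM (endMap f : End P.F →+ End Q.F)
    (endMap g : End P.F →+ End Q.F)) h)

theorem hom_ext₃ {Y₁ Y₂ Q : Slice k} (ε : DeligneProduct Y₁ Y₂ Y) {f g : Q ⟶ P}
    (h : ∀ a b c, endMap f (δ.theta (a ⊗ₜ ε.theta (b ⊗ₜ c))) =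
      endMap g (δ.theta (a ⊗ₜ ε.theta (b ⊗ₜ c)))) : f = g :=
  endMap_injective (δ.theta_mem₃ ε (AddMonoidHom.eqLocusM (endMap f : End P.F →+ End Q.F)
    (endMap g : End P.F →+ End Q.F)) h)

theorem hom_ext₄ {Y₁ Y₂ Z₁ Z₂ Q : Slice k} (ε : DeligneProduct Y₁ Y₂ Y)
    (ζ : DeligneProduct Z₁ Z₂ Y₂) {f g : Q ⟶ P}
    (h : ∀ a b c d, endMap f (δ.theta (a ⊗ₜ ε.theta (b ⊗ₜ ζ.theta (c ⊗ₜ d)))) =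
      endMap g (δ.theta (a ⊗ₜ ε.theta (b ⊗ₜ ζ.theta (c ⊗ₜ d))))) : f = g :=
  endMap_injective (δ.theta_mem₄ ε ζ (AddMonoidHom.eqLocusM (endMap f : End P.F →+ End Q.F)
    (endMap g : End P.F →+ End Q.F)) h)

theorem leg_box_injective {c : X.C} {d : Y.C} (hc : Function.Injective (leg X c))
    (hd : Function.Injective (leg Y d)) :
    Function.Injective (leg P ((δ.box.obj c).obj d)) := by
  intro η η' h
  obtain ⟨t, rfl⟩ := δ.theta.surjective η
  obtain ⟨t', rfl⟩ := δ.theta.surjective η'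
  have h' := congrArg (fun l => (δ.fib c d).hom ≫ l) h
  change (δ.fib c d).hom ≫ NatTrans.app (δ.theta t) _ =
    (δ.fib c d).hom ≫ NatTrans.app (δ.theta t') _ at h'
  rw [δ.theta_app, δ.theta_app, cancel_mono] at h'
  rw [tensorRep_injective hc hd h']

/-- The homomorphism of endomorphism algebras induced by two homomorphisms on the factors. -/
def tensorAlg {X' Y' P' : Slice k} (δ' : DeligneProduct X' Y' P') (φ : End X'.F →ₐ[k] End X.F)
    (ψ : End Y'.F →ₐ[k] End Y.F) : End P'.F →ₐ[k] End P.F :=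
  (δ.theta.toAlgHom.comp (Algebra.TensorProduct.map φ ψ)).comp δ'.theta.symm.toAlgHom

theorem tensorAlg_theta {X' Y' P' : Slice k} (δ' : DeligneProduct X' Y' P')
    (φ : End X'.F →ₐ[k] End X.F) (ψ : End Y'.F →ₐ[k] End Y.F) (a : End X'.F) (b : End Y'.F) :
    δ.tensorAlg δ' φ ψ (δ'.theta (a ⊗ₜ b)) = δ.theta (φ a ⊗ₜ ψ b) := by
  have h := δ'.theta.symm_apply_apply (a ⊗ₜ b)
  have h' := congrArg (fun t => δ.theta (Algebra.TensorProduct.map φ ψ t)) h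
  exact h'

/-- The isomorphism of endomorphism algebras underlying the associator. -/
def assocAlg {Z Q R S : Slice k} (δ' : DeligneProduct P Z Q) (ε : DeligneProduct Y Z R)
    (ε' : DeligneProduct X R S) : End S.F ≃ₐ[k] End Q.F :=
  ε'.theta.symm.trans <| (Algebra.TensorProduct.congr AlgEquiv.refl ε.theta.symm).trans <|
    (Algebra.TensorProduct.assoc k k k (End X.F) (End Y.F) (End Z.F)).symm.trans <|
      (Algebra.TensorProduct.congr δ.theta AlgEquiv.refl).trans δ'.theta

theorem assocAlg_theta {Z Q R S : Slice k} (δ' : DeligneProduct P Z Q) (ε : DeligneProduct Y Z R)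
    (ε' : DeligneProduct X R S) (a : End X.F) (b : End Y.F) (c : End Z.F) :
    δ.assocAlg δ' ε ε' (ε'.theta (a ⊗ₜ ε.theta (b ⊗ₜ c))) =
      δ'.theta (δ.theta (a ⊗ₜ b) ⊗ₜ c) := by
  have h₁ := ε'.theta.symm_apply_apply (a ⊗ₜ ε.theta (b ⊗ₜ c))
  have h₂ := ε.theta.symm_apply_apply (b ⊗ₜ c)
  have h₃ := congrArg (fun t => δ'.theta (Algebra.TensorProduct.map δ.theta.toAlgHom (AlgHom.id k _)
    ((Algebra.TensorProduct.assoc k k k (End X.F) (End Y.F) (End Z.F)).symm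
      (Algebra.TensorProduct.map (AlgHom.id k _) ε.theta.symm.toAlgHom t)))) h₁
  have h₄ := congrArg (fun t => δ'.theta (Algebra.TensorProduct.map δ.theta.toAlgHom (AlgHom.id k _)
    ((Algebra.TensorProduct.assoc k k k (End X.F) (End Y.F) (End Z.F)).symm (a ⊗ₜ t)))) h₂
  exact h₃.trans h₄

/-- The isomorphism of endomorphism algebras underlying the left unitor. -/
def lidAlg (u : k ≃ₐ[k] End X.F) : End Y.F ≃ₐ[k] End P.F :=
  (Algebra.TensorProduct.lid k (End Y.F)).symm.trans <|
    (Algebra.TensorProduct.congr u AlgEquiv.refl).trans δ.theta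

theorem lidAlg_apply (u : k ≃ₐ[k] End X.F) (b : End Y.F) :
    δ.lidAlg u b = δ.theta (1 ⊗ₜ b) := by
  have := congrArg (fun a => δ.theta (a ⊗ₜ b)) (map_one u)
  exact this

/-- The isomorphism of endomorphism algebras underlying the right unitor. -/
def ridAlg (u : k ≃ₐ[k] End Y.F) : End X.F ≃ₐ[k] End P.F :=
  (Algebra.TensorProduct.rid k k (End X.F)).symm.trans <|
    (Algebra.TensorProduct.congr AlgEquiv.refl u).trans δ.theta

theorem ridAlg_apply (u : k ≃ₐ[k] End Y.F) (a : End X.F) :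
    δ.ridAlg u a = δ.theta (a ⊗ₜ 1) := by
  have := congrArg (fun b => δ.theta (a ⊗ₜ b)) (map_one u)
  exact this

/-- The isomorphism of endomorphism algebras underlying the braiding. -/
def commAlg {Q : Slice k} (ε : DeligneProduct Y X Q) : End Q.F ≃ₐ[k] End P.F :=
  ε.theta.symm.trans <| (Algebra.TensorProduct.comm k (End Y.F) (End X.F)).trans δ.theta

theorem commAlg_theta {Q : Slice k} (ε : DeligneProduct Y X Q) (a : End X.F) (b : End Y.F) :
    δ.commAlg ε (ε.theta (b ⊗ₜ a)) = δ.theta (a ⊗ₜ b) := by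
  have := congrArg (fun t => δ.theta (Algebra.TensorProduct.comm k (End Y.F) (End X.F) t))
    (ε.theta.symm_apply_apply (b ⊗ₜ a))
  exact this

end DeligneProduct

end Pure

end BialgebraReconstruction

end
noncomputable section

namespace BialgebraReconstruction

/-! ### The symmetric monoidal structure of `Slice` -/

section Monoidal

variable {k : Type u} [Field k] [IsAlgClosed k]

/-- A chosen tensor product of two objects of `Slice`. -/
def tensorSlice (X Y : Slice k) : Slice k := (exists_deligneProduct X Y).choose

/-- The universal bifunctor of the chosen tensor product. -/
def tensorSliceProd (X Y : Slice k) : DeligneProduct X Y (tensorSlice X Y) :=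
  (exists_deligneProduct X Y).choose_spec.some

variable (k) in
/-- The objects and structure morphisms of the monoidal category `Slice`, the latter given by
isomorphisms of endomorphism algebras. -/
abbrev sliceMonoidalStruct : MonoidalCategoryStruct (Slice k) where
  tensorObj := tensorSlice
  tensorUnit := Slice.unit k
  tensorHom f g := homOfAlg
    ((tensorSliceProd _ _).tensorAlg (tensorSliceProd _ _) (endMap f) (endMap g))
  whiskerLeft X _ _ f := homOfAlg
    ((tensorSliceProd X _).tensorAlg (tensorSliceProd X _) (endMap (𝟙 X)) (endMap f))
  whiskerRight f Y := homOfAlg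
    ((tensorSliceProd _ Y).tensorAlg (tensorSliceProd _ Y) (endMap f) (endMap (𝟙 Y)))
  associator X Y Z := isoOfAlg ((tensorSliceProd X Y).assocAlg
    (tensorSliceProd (tensorSlice X Y) Z) (tensorSliceProd Y Z)
    (tensorSliceProd X (tensorSlice Y Z)))
  leftUnitor X := isoOfAlg ((tensorSliceProd (Slice.unit k) X).lidAlg (unitEquiv k))
  rightUnitor X := isoOfAlg ((tensorSliceProd X (Slice.unit k)).ridAlg (unitEquiv k))

section Coherence

attribute [local instance] sliceMonoidalStruct

/-- The universal bifunctor exhibiting `X ⊗ Y` as a tensor product. -/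
def sliceProd (X Y : Slice k) : DeligneProduct X Y (X ⊗ Y) := tensorSliceProd X Y

variable {X Y Z W X' Y' Z' : Slice k}

theorem endMap_sliceTensorHom (f : X ⟶ X') (g : Y ⟶ Y') (a : End X'.F) (b : End Y'.F) :
    endMap (f ⊗ₘ g) ((sliceProd X' Y').theta (a ⊗ₜ b)) =
      (sliceProd X Y).theta (endMap f a ⊗ₜ endMap g b) :=
  (endMap_homOfAlg _ _).trans (DeligneProduct.tensorAlg_theta _ _ _ _ _ _)

theorem endMap_sliceWhiskerLeft (f : Y ⟶ Y') (a : End X.F) (b : End Y'.F) :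
    endMap (X ◁ f) ((sliceProd X Y').theta (a ⊗ₜ b)) =
      (sliceProd X Y).theta (a ⊗ₜ endMap f b) :=
  (endMap_sliceTensorHom (𝟙 X) f a b).trans (by rw [endMap_id])

theorem endMap_sliceWhiskerRight (f : X ⟶ X') (a : End X'.F) (b : End Y.F) :
    endMap (f ▷ Y) ((sliceProd X' Y).theta (a ⊗ₜ b)) =
      (sliceProd X Y).theta (endMap f a ⊗ₜ b) :=
  (endMap_sliceTensorHom f (𝟙 Y) a b).trans (by rw [endMap_id])

theorem endMap_sliceAssociator (a : End X.F) (b : End Y.F) (c : End Z.F) :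
    endMap (α_ X Y Z).hom ((sliceProd X (Y ⊗ Z)).theta
      (a ⊗ₜ (sliceProd Y Z).theta (b ⊗ₜ c))) =
    (sliceProd (X ⊗ Y) Z).theta ((sliceProd X Y).theta (a ⊗ₜ b) ⊗ₜ c) :=
  (endMap_isoOfAlg_hom _ _).trans (DeligneProduct.assocAlg_theta _ _ _ _ _ _ _)

theorem endMap_sliceLeftUnitor (a : End X.F) :
    endMap (λ_ X).hom a = (sliceProd (𝟙_ (Slice k)) X).theta (1 ⊗ₜ a) :=
  (endMap_isoOfAlg_hom _ _).trans (DeligneProduct.lidAlg_apply _ _ _)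

theorem endMap_sliceRightUnitor (a : End X.F) :
    endMap (ρ_ X).hom a = (sliceProd X (𝟙_ (Slice k))).theta (a ⊗ₜ 1) :=
  (endMap_isoOfAlg_hom _ _).trans (DeligneProduct.ridAlg_apply _ _ _)

theorem slice_tensorHom_def (f : X ⟶ X') (g : Y ⟶ Y') : f ⊗ₘ g = f ▷ Y ≫ X' ◁ g :=
  (sliceProd X' Y').hom_ext fun a b => by
    rw [endMap_comp, endMap_sliceTensorHom, endMap_sliceWhiskerLeft, endMap_sliceWhiskerRight]

theorem slice_id_tensorHom_id (X Y : Slice k) : 𝟙 X ⊗ₘ 𝟙 Y = 𝟙 (X ⊗ Y) :=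
  (sliceProd X Y).hom_ext fun a b => by
    rw [endMap_sliceTensorHom, endMap_id, endMap_id, endMap_id]

theorem slice_whiskerLeft_id (X Y : Slice k) : X ◁ 𝟙 Y = 𝟙 (X ⊗ Y) :=
  (sliceProd X Y).hom_ext fun a b => by
    rw [endMap_sliceWhiskerLeft, endMap_id, endMap_id]

theorem slice_id_whiskerRight (X Y : Slice k) : 𝟙 X ▷ Y = 𝟙 (X ⊗ Y) :=
  (sliceProd X Y).hom_ext fun a b => by
    rw [endMap_sliceWhiskerRight, endMap_id, endMap_id]

theorem slice_tensorHom_comp_tensorHom {X'' Y'' : Slice k} (f : X ⟶ X') (g : Y ⟶ Y')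
    (f' : X' ⟶ X'') (g' : Y' ⟶ Y'') : (f ⊗ₘ g) ≫ (f' ⊗ₘ g') = (f ≫ f') ⊗ₘ (g ≫ g') :=
  (sliceProd X'' Y'').hom_ext fun a b => by
    rw [endMap_comp, endMap_sliceTensorHom, endMap_sliceTensorHom, endMap_sliceTensorHom,
      endMap_comp, endMap_comp]

theorem slice_associator_naturality (f : X ⟶ X') (g : Y ⟶ Y') (h : Z ⟶ Z') :
    ((f ⊗ₘ g) ⊗ₘ h) ≫ (α_ X' Y' Z').hom = (α_ X Y Z).hom ≫ (f ⊗ₘ (g ⊗ₘ h)) :=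
  (sliceProd X' (Y' ⊗ Z')).hom_ext₃ (sliceProd Y' Z') fun a b c => by
    simp only [endMap_comp, endMap_sliceAssociator, endMap_sliceTensorHom]

theorem slice_leftUnitor_naturality (f : X ⟶ Y) :
    𝟙_ (Slice k) ◁ f ≫ (λ_ Y).hom = (λ_ X).hom ≫ f :=
  endMap_injective fun a => by
    simp only [endMap_comp, endMap_sliceLeftUnitor, endMap_sliceWhiskerLeft]

theorem slice_rightUnitor_naturality (f : X ⟶ Y) :
    f ▷ 𝟙_ (Slice k) ≫ (ρ_ Y).hom = (ρ_ X).hom ≫ f :=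
  endMap_injective fun a => by
    simp only [endMap_comp, endMap_sliceRightUnitor, endMap_sliceWhiskerRight]

theorem slice_pentagon (W X Y Z : Slice k) :
    (α_ W X Y).hom ▷ Z ≫ (α_ W (X ⊗ Y) Z).hom ≫ W ◁ (α_ X Y Z).hom =
      (α_ (W ⊗ X) Y Z).hom ≫ (α_ W X (Y ⊗ Z)).hom :=
  (sliceProd W (X ⊗ Y ⊗ Z)).hom_ext₄ (sliceProd X (Y ⊗ Z)) (sliceProd Y Z) fun a b c d => by
    simp only [endMap_comp, endMap_sliceAssociator, endMap_sliceWhiskerLeft,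
      endMap_sliceWhiskerRight]

theorem slice_triangle (X Y : Slice k) :
    (α_ X (𝟙_ (Slice k)) Y).hom ≫ X ◁ (λ_ Y).hom = (ρ_ X).hom ▷ Y :=
  (sliceProd X Y).hom_ext fun a b => by
    simp only [endMap_comp, endMap_sliceAssociator, endMap_sliceWhiskerLeft,
      endMap_sliceWhiskerRight, endMap_sliceLeftUnitor, endMap_sliceRightUnitor]

/-- The braiding of `Slice`. -/
def sliceBraiding (X Y : Slice k) : X ⊗ Y ≅ Y ⊗ X :=
  isoOfAlg ((sliceProd X Y).commAlg (sliceProd Y X))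

theorem endMap_sliceBraiding (a : End X.F) (b : End Y.F) :
    endMap (sliceBraiding X Y).hom ((sliceProd Y X).theta (b ⊗ₜ a)) =
      (sliceProd X Y).theta (a ⊗ₜ b) :=
  (endMap_isoOfAlg_hom _ _).trans (DeligneProduct.commAlg_theta _ _ _ _)

theorem slice_braiding_naturality_right (X : Slice k) (f : Y ⟶ Z) :
    X ◁ f ≫ (sliceBraiding X Z).hom = (sliceBraiding X Y).hom ≫ f ▷ X :=
  (sliceProd Z X).hom_ext fun a b => by
    simp only [endMap_comp, endMap_sliceBraiding, endMap_sliceWhiskerLeft,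
      endMap_sliceWhiskerRight]

theorem slice_braiding_naturality_left (f : X ⟶ Y) (Z : Slice k) :
    f ▷ Z ≫ (sliceBraiding Y Z).hom = (sliceBraiding X Z).hom ≫ Z ◁ f :=
  (sliceProd Z Y).hom_ext fun a b => by
    simp only [endMap_comp, endMap_sliceBraiding, endMap_sliceWhiskerLeft,
      endMap_sliceWhiskerRight]

theorem slice_hexagon_forward (X Y Z : Slice k) :
    (α_ X Y Z).hom ≫ (sliceBraiding X (Y ⊗ Z)).hom ≫ (α_ Y Z X).hom =
      (sliceBraiding X Y).hom ▷ Z ≫ (α_ Y X Z).hom ≫ Y ◁ (sliceBraiding X Z).hom :=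
  (sliceProd Y (Z ⊗ X)).hom_ext₃ (sliceProd Z X) fun a b c => by
    simp only [endMap_comp, endMap_sliceBraiding, endMap_sliceAssociator, endMap_sliceWhiskerLeft,
      endMap_sliceWhiskerRight]

theorem slice_symmetry (X Y : Slice k) :
    (sliceBraiding X Y).hom ≫ (sliceBraiding Y X).hom = 𝟙 (X ⊗ Y) :=
  (sliceProd X Y).hom_ext fun a b => by
    simp only [endMap_comp, endMap_sliceBraiding, endMap_id]

theorem slice_hexagon_reverse (X Y Z : Slice k) :
    (α_ X Y Z).inv ≫ (sliceBraiding (X ⊗ Y) Z).hom ≫ (α_ Z X Y).inv =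
      X ◁ (sliceBraiding Y Z).hom ≫ (α_ X Z Y).inv ≫ (sliceBraiding X Z).hom ▷ Y := by
  rw [Iso.inv_comp_eq, ← Category.assoc, Iso.comp_inv_eq]
  refine (sliceProd Z (X ⊗ Y)).hom_ext₃ (sliceProd X Y) fun a b c => ?_
  have h : endMap (α_ X Z Y).inv ((sliceProd (X ⊗ Z) Y).theta
      ((sliceProd X Z).theta (b ⊗ₜ a) ⊗ₜ c)) =
      (sliceProd X (Z ⊗ Y)).theta (b ⊗ₜ (sliceProd Z Y).theta (a ⊗ₜ c)) := by
    rw [← endMap_sliceAssociator, ← endMap_comp, Iso.inv_hom_id, endMap_id]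
  simp only [endMap_comp, endMap_sliceBraiding, endMap_sliceAssociator, endMap_sliceWhiskerLeft,
    endMap_sliceWhiskerRight, h]

end Coherence

variable (k) in
/-- The monoidal category `Slice`. -/
abbrev sliceMonoidal : MonoidalCategory (Slice k) where
  toMonoidalCategoryStruct := sliceMonoidalStruct k
  tensorHom_def := slice_tensorHom_def
  id_tensorHom_id := slice_id_tensorHom_id
  tensorHom_comp_tensorHom := slice_tensorHom_comp_tensorHom
  whiskerLeft_id := slice_whiskerLeft_id
  id_whiskerRight := slice_id_whiskerRight
  associator_naturality := slice_associator_naturality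
  leftUnitor_naturality := slice_leftUnitor_naturality
  rightUnitor_naturality := slice_rightUnitor_naturality
  pentagon := slice_pentagon
  triangle := slice_triangle

variable (k) in
/-- The symmetric monoidal category `Slice`. -/
abbrev sliceSymmetric : letI := sliceMonoidal k; SymmetricCategory (Slice k) :=
  letI := sliceMonoidal k
  { braiding := sliceBraiding
    braiding_naturality_right X _ _ f := slice_braiding_naturality_right X f
    braiding_naturality_left f Z := slice_braiding_naturality_left f Z
    hexagon_forward := slice_hexagon_forward
    hexagon_reverse := slice_hexagon_reverse
    symmetry := slice_symmetry }

end Monoidal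

end BialgebraReconstruction

end
noncomputable section

namespace BialgebraReconstruction

/-! ### Structure morphisms of `Slice` on objects and on endomorphism algebras -/

theorem Slice.PreHom.sends {k : Type u} [Field k] {X Y : Slice k} (f : PreHom X Y)
    (c : X.C) : Sends f.toHom c (f.T.obj c) (f.τ.hom.app c) :=
  ⟨f, rfl, Iso.refl _, by
    rw [Iso.refl_hom, CategoryTheory.Functor.map_id]; exact Category.comp_id _⟩

/-- The algebra of natural endomorphisms of the fibre functor of the unit is `k`. -/
theorem DeligneStructure.unit_bijective {k : Type u} [Field k] [MonoidalCategory (Slice k)]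
    [SymmetricCategory (Slice k)] (D : DeligneStructure k) :
    Function.Bijective (Algebra.ofId k (End (𝟙_ (Slice k) :).F)) := by
  have h : ∀ r, Algebra.ofId k (End (𝟙_ (Slice k) :).F) r =
      endMap D.unitIso.hom (unitEquiv k r) := fun r =>
    (((endMap D.unitIso.hom).comp (unitEquiv k).toAlgHom).commutes r).symm
  constructor
  · intro r s hrs
    rw [h, h] at hrs
    have := congrArg (endMap D.unitIso.inv) hrs
    rw [← endMap_comp, ← endMap_comp, D.unitIso.inv_hom_id, endMap_id, endMap_id] at this
    exact (unitEquiv k).injective this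
  · intro η
    obtain ⟨r, hr⟩ := (unitEquiv k).surjective (endMap D.unitIso.inv η)
    refine ⟨r, ?_⟩
    rw [h, hr, ← endMap_comp, D.unitIso.hom_inv_id, endMap_id]

/-- Natural endomorphisms of the fibre functor of the unit are scalars, so they are determined on
any object with one-dimensional fibre. -/
theorem DeligneStructure.leg_unit_injective {k : Type u} [Field k] [MonoidalCategory (Slice k)]
    [SymmetricCategory (Slice k)] (D : DeligneStructure k) {e : (𝟙_ (Slice k) :).C}
    {q : (𝟙_ (Slice k) :).F.obj e ⟶ 𝟙_ (Vec k)} (hq : IsIso q) :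
    Function.Injective (leg (𝟙_ (Slice k)) e) := by
  intro η η' h
  obtain ⟨r, rfl⟩ := D.unit_bijective.surjective η
  obtain ⟨s, rfl⟩ := D.unit_bijective.surjective η'
  have h' : r • 𝟙 ((𝟙_ (Slice k) :).F.obj e) = s • 𝟙 ((𝟙_ (Slice k) :).F.obj e) := h
  have h'' : r • 𝟙 (𝟙_ (Vec k)) = s • 𝟙 (𝟙_ (Vec k)) := by
    have := congrArg (fun l => inv q ≫ l ≫ q) h'
    simpa using this
  have := congrArg (fun l : 𝟙_ (Vec k) ⟶ 𝟙_ (Vec k) => l.hom.hom (1 : k)) h''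
  change r • (1 : k) = s • (1 : k) at this
  rw [smul_eq_mul, smul_eq_mul, mul_one, mul_one] at this
  rw [this]

section Dictionary

variable {k : Type u} [Field k] [IsAlgClosed k]

namespace DeligneProduct

variable {X Y Z X' Y' P P' Q R S : Slice k} (δ : DeligneProduct X Y P)

/-- The tensor product of two 2-cells is equivariant along the tensor product of the induced
homomorphisms. This lemma and its analogues for the associator, the unitors and the braiding
translate between the two descriptions of a structure morphism of `Slice`: where it sends objects,
and what it induces on endomorphism algebras. -/
theorem tensor_equivariant (δ' : DeligneProduct X' Y' P') {f : X ⟶ X'} {g : Y ⟶ Y'} {c : X.C}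
    {d : Y.C} {c' : X'.C} {d' : Y'.C} {p : X.F.obj c ⟶ X'.F.obj c'} {q : Y.F.obj d ⟶ Y'.F.obj d'}
    (hp : Sends f c c' p) (hq : Sends g d d' q) (a : End X'.F) (b : End Y'.F) :
    NatTrans.app (δ.theta (endMap f a ⊗ₜ endMap g b)) ((δ.box.obj c).obj d) ≫
        (δ.fib c d).inv ≫ (p ⊗ₘ q) ≫ (δ'.fib c' d').hom =
      ((δ.fib c d).inv ≫ (p ⊗ₘ q) ≫ (δ'.fib c' d').hom) ≫
        NatTrans.app (δ'.theta (a ⊗ₜ b)) ((δ'.box.obj c').obj d') := by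
  have e₁ := (sends_iff.1 hp).2 a
  have e₂ := (sends_iff.1 hq).2 b
  rw [theta_tmul_app, theta_tmul_app]
  simp only [Category.assoc, Iso.hom_inv_id_assoc, tensorHom_comp_tensorHom_assoc]
  rw [e₁, e₂]

/-- A morphism which acts on pure tensors as `f ⊗ g` sends `c ⊠ d` to `c' ⊠ d'`, if `f` sends `c` to
`c'` and `g` sends `d` to `d'`. -/
theorem sends_tensor (δ' : DeligneProduct X' Y' P') {f : X ⟶ X'} {g : Y ⟶ Y'} {h : P ⟶ P'}
    (hh : ∀ a b, endMap h (δ'.theta (a ⊗ₜ b)) = δ.theta (endMap f a ⊗ₜ endMap g b)) {c : X.C}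
    {d : Y.C} {c' : X'.C} {d' : Y'.C} {p : X.F.obj c ⟶ X'.F.obj c'} {q : Y.F.obj d ⟶ Y'.F.obj d'}
    (hp : Sends f c c' p) (hq : Sends g d d' q) :
    Sends h ((δ.box.obj c).obj d) ((δ'.box.obj c').obj d')
      ((δ.fib c d).inv ≫ (p ⊗ₘ q) ≫ (δ'.fib c' d').hom) := by
  have := (sends_iff.1 hp).1
  have := (sends_iff.1 hq).1
  refine sends_of_equivariant inferInstance (δ'.theta_mem _ fun a b => ?_)
  change NatTrans.app (endMap h _) _ ≫ _ = _
  rw [hh]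
  exact δ.tensor_equivariant δ' hp hq a b

theorem assoc_equivariant (δ' : DeligneProduct P Z Q) (ε : DeligneProduct Y Z R)
    (ε' : DeligneProduct X R S) (c : X.C) (d : Y.C) (e : Z.C) (x : End X.F) (y : End Y.F)
    (z : End Z.F) :
    NatTrans.app (δ'.theta (δ.theta (x ⊗ₜ y) ⊗ₜ z)) ((δ'.box.obj ((δ.box.obj c).obj d)).obj e) ≫
        (δ'.fib _ e).inv ≫ (δ.fib c d).inv ▷ Z.F.obj e ≫
          (α_ (X.F.obj c) (Y.F.obj d) (Z.F.obj e)).hom ≫ X.F.obj c ◁ (ε.fib d e).hom ≫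
            (ε'.fib c _).hom =
      ((δ'.fib _ e).inv ≫ (δ.fib c d).inv ▷ Z.F.obj e ≫
          (α_ (X.F.obj c) (Y.F.obj d) (Z.F.obj e)).hom ≫ X.F.obj c ◁ (ε.fib d e).hom ≫
            (ε'.fib c _).hom) ≫
        NatTrans.app (ε'.theta (x ⊗ₜ ε.theta (y ⊗ₜ z)))
          ((ε'.box.obj c).obj ((ε.box.obj d).obj e)) := by
  simp only [theta_tmul_app, Category.assoc, Iso.hom_inv_id_assoc, ← id_tensorHom, ← tensorHom_id,
    tensorHom_comp_tensorHom_assoc, Iso.hom_inv_id, Category.comp_id, Category.id_comp]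
  have e₁ : ((δ.fib c d).inv ≫ (NatTrans.app x c ⊗ₘ NatTrans.app y d)) ⊗ₘ NatTrans.app z e =
      ((δ.fib c d).inv ⊗ₘ 𝟙 (Z.F.obj e)) ≫
        ((NatTrans.app x c ⊗ₘ NatTrans.app y d) ⊗ₘ NatTrans.app z e) := by
    rw [tensorHom_comp_tensorHom, Category.id_comp]
  have e₂ : NatTrans.app x c ⊗ₘ ((NatTrans.app y d ⊗ₘ NatTrans.app z e) ≫ (ε.fib d e).hom) =
      (NatTrans.app x c ⊗ₘ (NatTrans.app y d ⊗ₘ NatTrans.app z e)) ≫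
        (𝟙 (X.F.obj c) ⊗ₘ (ε.fib d e).hom) := by
    rw [tensorHom_comp_tensorHom, Category.comp_id]
  rw [e₁, e₂, Category.assoc, Category.assoc, associator_naturality_assoc]

theorem leftUnitor_equivariant {c : X.C} (d : Y.C) (q : X.F.obj c ⟶ 𝟙_ (Vec k)) (y : End Y.F) :
    NatTrans.app (δ.theta (1 ⊗ₜ y)) ((δ.box.obj c).obj d) ≫
        (δ.fib c d).inv ≫ q ▷ Y.F.obj d ≫ (λ_ (Y.F.obj d)).hom =
      ((δ.fib c d).inv ≫ q ▷ Y.F.obj d ≫ (λ_ (Y.F.obj d)).hom) ≫ NatTrans.app y d := by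
  rw [theta_tmul_app]
  change ((δ.fib c d).inv ≫ (𝟙 _ ⊗ₘ NatTrans.app y d) ≫ (δ.fib c d).hom) ≫ _ = _
  simp only [Category.assoc, Iso.hom_inv_id_assoc, id_tensorHom, whisker_exchange_assoc]
  rw [leftUnitor_naturality]

theorem rightUnitor_equivariant (c : X.C) {d : Y.C} (q : Y.F.obj d ⟶ 𝟙_ (Vec k)) (x : End X.F) :
    NatTrans.app (δ.theta (x ⊗ₜ 1)) ((δ.box.obj c).obj d) ≫
        (δ.fib c d).inv ≫ X.F.obj c ◁ q ≫ (ρ_ (X.F.obj c)).hom =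
      ((δ.fib c d).inv ≫ X.F.obj c ◁ q ≫ (ρ_ (X.F.obj c)).hom) ≫ NatTrans.app x c := by
  rw [theta_tmul_app]
  change ((δ.fib c d).inv ≫ (NatTrans.app x c ⊗ₘ 𝟙 _) ≫ (δ.fib c d).hom) ≫ _ = _
  simp only [Category.assoc, Iso.hom_inv_id_assoc, tensorHom_id, ← whisker_exchange_assoc]
  rw [rightUnitor_naturality]

theorem braiding_equivariant (ε : DeligneProduct Y X Q) (c : X.C) (d : Y.C) (x : End X.F)
    (y : End Y.F) :
    NatTrans.app (δ.theta (x ⊗ₜ y)) ((δ.box.obj c).obj d) ≫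
        (δ.fib c d).inv ≫ (β_ (X.F.obj c) (Y.F.obj d)).hom ≫ (ε.fib d c).hom =
      ((δ.fib c d).inv ≫ (β_ (X.F.obj c) (Y.F.obj d)).hom ≫ (ε.fib d c).hom) ≫
        NatTrans.app (ε.theta (y ⊗ₜ x)) ((ε.box.obj d).obj c) := by
  simp only [theta_tmul_app, Category.assoc, Iso.hom_inv_id_assoc]
  rw [← BraidedCategory.braiding_naturality_assoc]

end DeligneProduct

variable (k) in
/-- The symmetric monoidal structure of `Slice` is the one given by the Deligne tensor product. -/
def sliceDeligneStructure : letI := sliceMonoidal k; letI := sliceSymmetric k; DeligneStructure k :=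
  letI := sliceMonoidal k
  letI := sliceSymmetric k
  { prod := sliceProd
    unitIso := Iso.refl _
    tensorHom := fun f g c d => (sliceProd _ _).sends_tensor (sliceProd _ _)
      (endMap_sliceTensorHom f.toHom g.toHom) (f.sends c) (g.sends d)
    associator := fun X Y Z c d e => sends_of_equivariant inferInstance
      ((sliceProd X (Y ⊗ Z)).theta_mem₃ (sliceProd Y Z) _ fun x y z => by
        change NatTrans.app (endMap _ _) _ ≫ _ = _
        rw [endMap_sliceAssociator]
        exact (sliceProd X Y).assoc_equivariant _ _ _ c d e x y z)
    leftUnitor := fun X c e q hq => by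
      have : IsIso (C := Vec k) (Y := 𝟙_ (Vec k)) q := (sends_iff.1 hq).1
      refine sends_of_equivariant inferInstance fun x => ?_
      change NatTrans.app (endMap _ _) _ ≫ _ = _
      rw [endMap_sliceLeftUnitor]
      exact (sliceProd _ X).leftUnitor_equivariant c q x
    rightUnitor := fun X c e q hq => by
      have : IsIso (C := Vec k) (Y := 𝟙_ (Vec k)) q := (sends_iff.1 hq).1
      refine sends_of_equivariant inferInstance fun x => ?_
      change NatTrans.app (endMap _ _) _ ≫ _ = _
      rw [endMap_sliceRightUnitor]
      exact (sliceProd X _).rightUnitor_equivariant c q x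
    braiding := fun X Y c d => sends_of_equivariant inferInstance
      ((sliceProd Y X).theta_mem _ fun y x => by
        change NatTrans.app (endMap (sliceBraiding X Y).hom _) _ ≫ _ = _
        rw [endMap_sliceBraiding]
        exact (sliceProd X Y).braiding_equivariant _ c d x y) }

namespace DeligneStructure

variable [MonoidalCategory (Slice k)] [SymmetricCategory (Slice k)] (D : DeligneStructure k)

/-- Whatever the Deligne structure, `f ⊗ g` acts on pure tensors factor by factor. Both sides are
compared on an object `c ⊠ d` on which natural endomorphisms are determined; the lemmas below, for
the other structure morphisms, have the same proof. -/
theorem endMap_tensorHom {X X' Y Y' : Slice k} (f : X ⟶ X') (g : Y ⟶ Y') (a : End X'.F)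
    (b : End Y'.F) : endMap (f ⊗ₘ g) ((D.prod X' Y').theta (a ⊗ₜ b)) =
      (D.prod X Y).theta (endMap f a ⊗ₜ endMap g b) := by
  obtain ⟨f, rfl⟩ := Quotient.exists_rep f
  obtain ⟨g, rfl⟩ := Quotient.exists_rep g
  obtain ⟨c, hc⟩ := exists_leg_injective X
  obtain ⟨d, hd⟩ := exists_leg_injective Y
  exact (D.tensorHom f g c d).endMap_eq ((D.prod X Y).leg_box_injective hc hd)
    ((D.prod X Y).tensor_equivariant (D.prod X' Y') (f.sends c) (g.sends d) a b)

theorem endMap_whiskerLeft (X : Slice k) {Y Y' : Slice k} (g : Y ⟶ Y') (a : End X.F)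
    (b : End Y'.F) : endMap (X ◁ g) ((D.prod X Y').theta (a ⊗ₜ b)) =
      (D.prod X Y).theta (a ⊗ₜ endMap g b) := by
  rw [← id_tensorHom, D.endMap_tensorHom, endMap_id]

theorem endMap_whiskerRight {X X' : Slice k} (f : X ⟶ X') (Y : Slice k) (a : End X'.F)
    (b : End Y.F) : endMap (f ▷ Y) ((D.prod X' Y).theta (a ⊗ₜ b)) =
      (D.prod X Y).theta (endMap f a ⊗ₜ b) := by
  rw [← tensorHom_id, D.endMap_tensorHom, endMap_id]

theorem endMap_associator (X Y Z : Slice k) (a : End X.F) (b : End Y.F) (c : End Z.F) :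
    endMap (α_ X Y Z).hom ((D.prod X (Y ⊗ Z)).theta (a ⊗ₜ (D.prod Y Z).theta (b ⊗ₜ c))) =
      (D.prod (X ⊗ Y) Z).theta ((D.prod X Y).theta (a ⊗ₜ b) ⊗ₜ c) := by
  obtain ⟨x, hx⟩ := exists_leg_injective X
  obtain ⟨y, hy⟩ := exists_leg_injective Y
  obtain ⟨z, hz⟩ := exists_leg_injective Z
  exact (D.associator X Y Z x y z).endMap_eq
    (DeligneProduct.leg_box_injective _ (DeligneProduct.leg_box_injective _ hx hy) hz)
    ((D.prod X Y).assoc_equivariant _ _ _ x y z a b c)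

theorem endMap_associator_inv (X Y Z : Slice k) (a : End X.F) (b : End Y.F) (c : End Z.F) :
    endMap (α_ X Y Z).inv ((D.prod (X ⊗ Y) Z).theta ((D.prod X Y).theta (a ⊗ₜ b) ⊗ₜ c)) =
      (D.prod X (Y ⊗ Z)).theta (a ⊗ₜ (D.prod Y Z).theta (b ⊗ₜ c)) := by
  rw [← D.endMap_associator, ← endMap_comp, Iso.inv_hom_id, endMap_id]

theorem endMap_braiding (X Y : Slice k) (a : End X.F) (b : End Y.F) :
    endMap (β_ X Y).hom ((D.prod Y X).theta (b ⊗ₜ a)) = (D.prod X Y).theta (a ⊗ₜ b) := by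
  obtain ⟨x, hx⟩ := exists_leg_injective X
  obtain ⟨y, hy⟩ := exists_leg_injective Y
  exact (D.braiding X Y x y).endMap_eq (DeligneProduct.leg_box_injective _ hx hy)
    ((D.prod X Y).braiding_equivariant _ x y a b)

/-- An object of the unit of `Slice` which corresponds to `k` under the comparison with `Vec`. -/
theorem exists_unit_object : ∃ (e : (𝟙_ (Slice k) :).C) (q : (𝟙_ (Slice k) :).F.obj e ⟶ 𝟙_ (Vec k)),
    Sends D.unitIso.hom e (𝟙_ (Vec k)) q :=
  exists_sends_of_iso D.unitIso (𝟙_ (Vec k) : (Slice.unit k).C)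

theorem endMap_leftUnitor (X : Slice k) (a : End X.F) :
    endMap (λ_ X).hom a = (D.prod (𝟙_ (Slice k)) X).theta (1 ⊗ₜ a) := by
  obtain ⟨e, q, hq⟩ := D.exists_unit_object
  obtain ⟨c, hc⟩ := exists_leg_injective X
  exact (D.leftUnitor X c e q hq).endMap_eq
    (DeligneProduct.leg_box_injective _ (D.leg_unit_injective (sends_iff.1 hq).1) hc)
    (DeligneProduct.leftUnitor_equivariant _ c q a)

theorem endMap_rightUnitor (X : Slice k) (a : End X.F) :
    endMap (ρ_ X).hom a = (D.prod X (𝟙_ (Slice k))).theta (a ⊗ₜ 1) := by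
  obtain ⟨e, q, hq⟩ := D.exists_unit_object
  obtain ⟨c, hc⟩ := exists_leg_injective X
  exact (D.rightUnitor X c e q hq).endMap_eq
    (DeligneProduct.leg_box_injective _ hc (D.leg_unit_injective (sends_iff.1 hq).1))
    (DeligneProduct.rightUnitor_equivariant _ c q a)

end DeligneStructure

end Dictionary

end BialgebraReconstruction

end
noncomputable section

namespace BialgebraReconstruction

/-! ### The canonical monoid of a monoidal fibre functor -/

section Canonical

variable {k : Type u} [Field k]

/-- Conjugation by an isomorphism of vector spaces. -/
def conjAlg {V W : Vec k} (e : V ≅ W) : End W →ₐ[k] End V where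
  toFun a := e.hom ≫ (a : W ⟶ W) ≫ e.inv
  map_one' := by
    change e.hom ≫ 𝟙 W ≫ e.inv = 𝟙 V
    simp
  map_mul' a b := by
    change e.hom ≫ ((b : W ⟶ W) ≫ (a : W ⟶ W)) ≫ e.inv =
      (e.hom ≫ (b : W ⟶ W) ≫ e.inv) ≫ e.hom ≫ (a : W ⟶ W) ≫ e.inv
    simp
  map_zero' := by
    change e.hom ≫ (0 : W ⟶ W) ≫ e.inv = (0 : V ⟶ V)
    rw [zero_comp, comp_zero]
  map_add' a b := by
    change e.hom ≫ ((a : W ⟶ W) + (b : W ⟶ W)) ≫ e.inv =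
      (e.hom ≫ (a : W ⟶ W) ≫ e.inv + e.hom ≫ (b : W ⟶ W) ≫ e.inv : V ⟶ V)
    rw [Preadditive.add_comp, Preadditive.comp_add]
  commutes' r := by
    change e.hom ≫ (r • 𝟙 W) ≫ e.inv = r • 𝟙 V
    simp

variable (k) in
theorem ofId_end_unit_bijective : Function.Bijective (Algebra.ofId k (End (𝟙_ (Vec k)))) := by
  constructor
  · intro r s h
    have := congrArg (fun l : 𝟙_ (Vec k) ⟶ 𝟙_ (Vec k) => l.hom.hom (1 : k)) h
    change r • (1 : k) = s • (1 : k) at this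
    rwa [smul_eq_mul, smul_eq_mul, _root_.mul_one, _root_.mul_one] at this
  · intro l
    refine ⟨(l : 𝟙_ (Vec k) ⟶ 𝟙_ (Vec k)).hom.hom (1 : k), Vec.hom_ext_apply fun (x : k) => ?_⟩
    change (l : 𝟙_ (Vec k) ⟶ 𝟙_ (Vec k)).hom.hom (1 : k) • x = _
    refine (mul_comm _ x).trans ((map_smul (l : 𝟙_ (Vec k) ⟶ 𝟙_ (Vec k)).hom.hom x
      (1 : k)).symm.trans ?_)
    exact congrArg (l : 𝟙_ (Vec k) ⟶ 𝟙_ (Vec k)).hom.hom (_root_.mul_one x)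

variable (k) in
/-- The algebra of endomorphisms of the tensor unit of `Vec` is `k`. -/
def endUnitEquiv : k ≃ₐ[k] End (𝟙_ (Vec k)) := AlgEquiv.ofBijective _ (ofId_end_unit_bijective k)

theorem Slice.Sends.congr {X Y : Slice k} {f : X ⟶ Y} {c : X.C} {d : Y.C}
    {p q : X.F.obj c ⟶ Y.F.obj d} (hf : Sends f c d p) (h : p = q) : Sends f c d q :=
  h ▸ hf

variable [IsAlgClosed k]

namespace Slice.Sends

variable {X Y Z : Slice k} {f : X ⟶ Y} {c : X.C} {d : Y.C} {p : X.F.obj c ⟶ Y.F.obj d}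

theorem comp (hf : Sends f c d p) {g : Y ⟶ Z} {e : Z.C} {q : Y.F.obj d ⟶ Z.F.obj e}
    (hg : Sends g d e q) : Sends (f ≫ g) c e (p ≫ q) := by
  obtain ⟨hp, h⟩ := sends_iff.1 hf
  obtain ⟨hq, h'⟩ := sends_iff.1 hg
  refine sends_iff.2 ⟨inferInstance, fun η => ?_⟩
  rw [endMap_comp, ← Category.assoc, h, Category.assoc, h', Category.assoc]

theorem comp_map (hf : Sends f c d p) {d' : Y.C} (φ : d ≅ d') :
    Sends f c d' (p ≫ Y.F.map φ.hom) := by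
  obtain ⟨hp, h⟩ := sends_iff.1 hf
  refine sends_iff.2 ⟨inferInstance, fun η => ?_⟩
  rw [← Category.assoc, h, Category.assoc, Category.assoc]
  exact congrArg (p ≫ ·) (NatTrans.naturality η φ.hom).symm

/-- A morphism is determined by where it sends a single object on which natural endomorphisms are
determined. -/
theorem unique (hf : Sends f c d p) {g : X ⟶ Y} (hg : Sends g c d p)
    (hc : Function.Injective (leg X c)) : f = g :=
  endMap_injective fun η => hf.endMap_eq hc ((sends_iff.1 hg).2 η)

theorem id (X : Slice k) (c : X.C) : Sends (𝟙 X) c c (𝟙 _) :=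
  sends_iff.2 ⟨inferInstance, fun η => by
    rw [endMap_id, Category.comp_id, Category.id_comp]⟩

end Slice.Sends

variable [MonoidalCategory (Slice k)] [SymmetricCategory (Slice k)]

/-- A tensor product of morphisms is computed on all objects reached by its factors, not only on
chosen representatives. -/
theorem DeligneStructure.sends_tensor (D : DeligneStructure k) {X X' Y Y' : Slice k} {f : X ⟶ X'}
    {g : Y ⟶ Y'} {c : X.C} {d : Y.C} {c' : X'.C} {d' : Y'.C} {p : X.F.obj c ⟶ X'.F.obj c'}
    {q : Y.F.obj d ⟶ Y'.F.obj d'} (hp : Sends f c c' p) (hq : Sends g d d' q) :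
    Sends (f ⊗ₘ g) (((D.prod X Y).box.obj c).obj d) (((D.prod X' Y').box.obj c').obj d')
      (((D.prod X Y).fib c d).inv ≫ (p ⊗ₘ q) ≫ ((D.prod X' Y').fib c' d').hom) :=
  (D.prod X Y).sends_tensor (D.prod X' Y') (D.endMap_tensorHom f g) hp hq

namespace FiberFunctor

variable (D : DeligneStructure k) (X : FiberFunctor k)

/-- The multiplication of the canonical monoid: conjugation by the tensorator makes `End F` act on
`F(c) ⊗ F(d)`, which amounts to an algebra homomorphism `End F → End F ⊗ End F`. -/
theorem exists_mul : ∃ f : X.toSlice ⊗ X.toSlice ⟶ X.toSlice, ∀ c d : X.C,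
    Sends f (((D.prod X.toSlice X.toSlice).box.obj c).obj d) (c ⊗ d)
      (((D.prod X.toSlice X.toSlice).fib c d).inv ≫ Functor.LaxMonoidal.μ X.F c d) := by
  obtain ⟨φ, hφ⟩ := exists_algHom_tensorRep_leg (X := X.toSlice) (Y := X.toSlice)
    (fun c d => (conjAlg (Functor.Monoidal.μIso X.F c d)).comp (leg X.toSlice (c ⊗ d)))
    (fun η {c c' d d'} f g => by
      change (Functor.LaxMonoidal.μ X.F c d ≫ NatTrans.app η (c ⊗ d) ≫
        Functor.OplaxMonoidal.δ X.F c d) ≫ _ = _ ≫ Functor.LaxMonoidal.μ X.F c' d' ≫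
          NatTrans.app η (c' ⊗ d') ≫ Functor.OplaxMonoidal.δ X.F c' d'
      have := NatTrans.naturality η (f ⊗ₘ g)
      simp only [Category.assoc, Functor.OplaxMonoidal.δ_natural,
        Functor.LaxMonoidal.μ_natural_assoc]
      rw [reassoc_of% this])
  refine ⟨homOfAlg ((D.prod X.toSlice X.toSlice).theta.toAlgHom.comp φ), fun c d =>
    sends_iff.2 ⟨inferInstance, fun η => ?_⟩⟩
  rw [endMap_homOfAlg]
  change NatTrans.app ((D.prod X.toSlice X.toSlice).theta (φ η)) _ ≫ _ = _
  rw [← cancel_epi ((D.prod X.toSlice X.toSlice).fib c d).hom, ← Category.assoc,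
    DeligneProduct.theta_app, hφ]
  change ((Functor.LaxMonoidal.μ X.F c d ≫ NatTrans.app η (c ⊗ d) ≫
    Functor.OplaxMonoidal.δ X.F c d) ≫ _) ≫ _ = _
  simp

/-- The unit of the canonical monoid: `End F` acts on the fibre of the unit object, which is
one-dimensional. -/
theorem exists_one : ∃ f : 𝟙_ (Slice k) ⟶ X.toSlice, ∀ (e : (𝟙_ (Slice k) :).C)
    (q : (𝟙_ (Slice k) :).F.obj e ⟶ 𝟙_ (Vec k)), Sends D.unitIso.hom e (𝟙_ (Vec k)) q →
    Sends f e (𝟙_ X.C) (q ≫ Functor.LaxMonoidal.ε X.F) := by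
  let φ : End X.F →ₐ[k] End (Slice.unit k).F :=
    ((unitEquiv k).toAlgHom.comp (endUnitEquiv k).symm.toAlgHom).comp
      ((conjAlg (Functor.Monoidal.εIso X.F)).comp (leg X.toSlice (𝟙_ X.C)))
  have hφ : Sends (homOfAlg φ : Slice.unit k ⟶ X.toSlice) (𝟙_ (Vec k)) (𝟙_ X.C)
      (Functor.LaxMonoidal.ε X.F) := by
    refine sends_iff.2 ⟨inferInstanceAs (IsIso (Functor.LaxMonoidal.ε X.F)), fun η => ?_⟩
    rw [endMap_homOfAlg]
    have h : NatTrans.app (φ η) (𝟙_ (Vec k)) = Functor.LaxMonoidal.ε X.F ≫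
        NatTrans.app η (𝟙_ X.C) ≫ Functor.OplaxMonoidal.η X.F :=
      (endUnitEquiv k).apply_symm_apply _
    rw [h]
    refine (Category.assoc _ _ _).trans (congrArg _ ?_)
    refine (Category.assoc _ _ _).trans ?_
    exact (congrArg _ (Functor.Monoidal.η_ε X.F)).trans (Category.comp_id _)
  exact ⟨D.unitIso.hom ≫ homOfAlg φ, fun e q hq => hq.comp hφ⟩

/-- The monoid axioms hold because both sides send one object, on which natural endomorphisms are
determined, to the same object with the same 2-cell; the equality of 2-cells is a coherence axiom of
the monoidal functor `F`. -/
theorem exists_isCanonicalMonoid : ∃ m : MonObj X.toSlice, IsCanonicalMonoid D X m := by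
  obtain ⟨mul, hmul⟩ := X.exists_mul D
  obtain ⟨one, hone⟩ := X.exists_one D
  obtain ⟨e, q, hq⟩ := D.exists_unit_object
  obtain ⟨c, hc⟩ := exists_leg_injective X.toSlice
  have he := D.leg_unit_injective (sends_iff.1 hq).1
  have hid := Slice.Sends.id X.toSlice c
  refine ⟨{ one, mul, one_mul := ?_, mul_one := ?_, mul_assoc := ?_ }, ⟨hone, hmul⟩⟩
  · rw [← tensorHom_id]
    refine Slice.Sends.unique ?_ (D.leftUnitor X.toSlice c e q hq)
      (DeligneProduct.leg_box_injective _ he hc)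
    refine (((D.sends_tensor (hone e q hq) hid).comp (hmul _ c)).comp_map (λ_ c)).congr ?_
    simp only [Category.assoc, Iso.hom_inv_id_assoc, tensorHom_id, comp_whiskerRight]
    rw [Functor.LaxMonoidal.left_unitality]
  · rw [← id_tensorHom]
    refine Slice.Sends.unique ?_ (D.rightUnitor X.toSlice c e q hq)
      (DeligneProduct.leg_box_injective _ hc he)
    refine (((D.sends_tensor hid (hone e q hq)).comp (hmul c _)).comp_map (ρ_ c)).congr ?_
    simp only [Category.assoc, Iso.hom_inv_id_assoc, id_tensorHom,
      MonoidalCategory.whiskerLeft_comp]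
    rw [Functor.LaxMonoidal.right_unitality]
  · rw [← id_tensorHom, ← tensorHom_id]
    refine Slice.Sends.unique ?_ ((D.associator X.toSlice X.toSlice X.toSlice c c c).comp
      ((D.sends_tensor hid (hmul c c)).comp (hmul c (c ⊗ c))))
      (DeligneProduct.leg_box_injective _ (DeligneProduct.leg_box_injective _ hc hc) hc)
    refine (((D.sends_tensor (hmul c c) hid).comp (hmul (c ⊗ c) c)).comp_map (α_ c c c)).congr ?_
    simp only [Category.assoc, Iso.hom_inv_id_assoc, id_tensorHom, tensorHom_id,
      comp_whiskerRight, MonoidalCategory.whiskerLeft_comp, whiskerLeft_hom_inv_assoc]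
    rw [Functor.LaxMonoidal.associativity]

theorem existsUnique_isCanonicalMonoid : ∃! m : MonObj X.toSlice, IsCanonicalMonoid D X m := by
  obtain ⟨m, hm⟩ := X.exists_isCanonicalMonoid D
  refine ⟨m, hm, fun m' hm' => MonObj.ext _ _ ?_⟩
  obtain ⟨c, hc⟩ := exists_leg_injective X.toSlice
  exact (hm'.mul c c).unique (hm.mul c c) (DeligneProduct.leg_box_injective _ hc hc)

variable {X} in
/-- As for the monoid axioms, it suffices to compare where both sides send one object; the equality
of 2-cells is the compatibility of `τ` with tensorators and units. -/
theorem isMonHom_of_monoidal {Y : FiberFunctor k} {m : MonObj X.toSlice} {n : MonObj Y.toSlice}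
    (hm : IsCanonicalMonoid D X m) (hn : IsCanonicalMonoid D Y n) (g : PreHom X.toSlice Y.toSlice)
    [g.T.Monoidal] (hg : NatTrans.IsMonoidal g.τ.hom) : IsMonHom g.toHom where
  one_hom := by
    obtain ⟨e, q, hq⟩ := D.exists_unit_object
    refine Slice.Sends.unique ((hm.one e q hq).comp (g.sends _)) ?_
      (D.leg_unit_injective (sends_iff.1 hq).1)
    refine ((hn.one e q hq).comp_map (Functor.Monoidal.εIso g.T)).congr ?_
    have := hg.unit
    rw [Functor.LaxMonoidal.comp_ε] at this
    rw [Category.assoc, Category.assoc, this]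
    rfl
  mul_hom := by
    obtain ⟨c, hc⟩ := exists_leg_injective X.toSlice
    refine Slice.Sends.unique ((hm.mul c c).comp (g.sends _)) ?_
      (DeligneProduct.leg_box_injective _ hc hc)
    refine (((D.sends_tensor (g.sends c) (g.sends c)).comp (hn.mul _ _)).comp_map
      (Functor.Monoidal.μIso g.T c c)).congr ?_
    have := hg.tensor c c
    rw [Functor.LaxMonoidal.comp_μ] at this
    simp only [Category.assoc, Iso.hom_inv_id_assoc]
    rw [this]
    rfl

end FiberFunctor

end Canonical

end BialgebraReconstruction

end
noncomputable section

namespace BialgebraReconstruction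

/-! ### Duality between monoids in `Slice` and bialgebras -/

theorem tensorRep_map {k : Type u} [Field k] {A B A' B' : Type*} [Ring A] [Algebra k A] [Ring B]
    [Algebra k B] [Ring A'] [Algebra k A'] [Ring B'] [Algebra k B'] {V W : Vec k}
    (r : A' →ₐ[k] End V) (s : B' →ₐ[k] End W) (f : A →ₐ[k] A') (g : B →ₐ[k] B') (t : A ⊗[k] B) :
    endTensor V W (Algebra.TensorProduct.map r s (Algebra.TensorProduct.map f g t)) =
      endTensor V W (Algebra.TensorProduct.map (r.comp f) (s.comp g) t) := by
  rw [Algebra.TensorProduct.map_comp]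
  rfl

namespace DeligneStructure

variable {k : Type u} [Field k] [MonoidalCategory (Slice k)] [SymmetricCategory (Slice k)]
  (D : DeligneStructure k)

/-- The algebra of natural endomorphisms of the fibre functor of the unit is `k`. -/
def unitAlg : k ≃ₐ[k] End (𝟙_ (Slice k) :).F := AlgEquiv.ofBijective _ D.unit_bijective

/-- The counit induced by the unit of a monoid. -/
def dualCounit {X : Slice k} [MonObj X] {A : Type u} [Ring A] [Algebra k A]
    (e : A ≃ₐ[k] End X.F) : A →ₐ[k] k :=
  D.unitAlg.symm.toAlgHom.comp ((endMap (MonObj.one (X := X))).comp e.toAlgHom)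

theorem endMap_one {X : Slice k} [MonObj X] {A : Type u} [Ring A] [Algebra k A]
    (e : A ≃ₐ[k] End X.F) (a : A) :
    endMap (MonObj.one (X := X)) (e a) = D.unitAlg (D.dualCounit e a) :=
  (D.unitAlg.apply_symm_apply _).symm

variable [IsAlgClosed k]

section Tensor

variable {X Y Z X' Y' : Slice k} {A B C A' B' : Type u} [Ring A] [Algebra k A] [Ring B]
  [Algebra k B] [Ring C] [Algebra k C] [Ring A'] [Algebra k A'] [Ring B'] [Algebra k B']

/-- If `A` and `B` are the endomorphism algebras of two fibre functors, then `A ⊗ B` is that of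
their tensor product. -/
def tensorEquiv (e : A ≃ₐ[k] End X.F) (e' : B ≃ₐ[k] End Y.F) : A ⊗[k] B ≃ₐ[k] End (X ⊗ Y).F :=
  (Algebra.TensorProduct.congr e e').trans (D.prod X Y).theta

variable (e : A ≃ₐ[k] End X.F) (e' : B ≃ₐ[k] End Y.F) (e'' : C ≃ₐ[k] End Z.F)

theorem tensorEquiv_tmul (a : A) (b : B) :
    D.tensorEquiv e e' (a ⊗ₜ b) = (D.prod X Y).theta (e a ⊗ₜ e' b) := rfl

theorem tensorEquiv_app (t : A ⊗[k] B) (c : X.C) (d : Y.C) :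
    ((D.prod X Y).fib c d).hom ≫
        NatTrans.app (D.tensorEquiv e e' t) (((D.prod X Y).box.obj c).obj d) =
      (tensorRep ((leg X c).comp e.toAlgHom) ((leg Y d).comp e'.toAlgHom) t :
        X.F.obj c ⊗ Y.F.obj d ⟶ X.F.obj c ⊗ Y.F.obj d) ≫ ((D.prod X Y).fib c d).hom :=
  ((D.prod X Y).theta_app _ c d).trans
    (congrArg (· ≫ ((D.prod X Y).fib c d).hom) (tensorRep_map _ _ e.toAlgHom e'.toAlgHom t))

variable {e e'} in
theorem endMap_tensorHom_tensorEquiv {e₁ : A' ≃ₐ[k] End X'.F} {e₂ : B' ≃ₐ[k] End Y'.F} {f : X ⟶ X'}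
    {g : Y ⟶ Y'} {φ : A' →ₐ[k] A} {ψ : B' →ₐ[k] B} (hf : ∀ a, endMap f (e₁ a) = e (φ a))
    (hg : ∀ b, endMap g (e₂ b) = e' (ψ b)) (t : A' ⊗[k] B') :
    endMap (f ⊗ₘ g) (D.tensorEquiv e₁ e₂ t) =
      D.tensorEquiv e e' (Algebra.TensorProduct.map φ ψ t) := by
  induction t with
  | zero => simp only [map_zero]
  | add x y hx hy => simp only [map_add, hx, hy]
  | tmul a b =>
    rw [tensorEquiv_tmul, D.endMap_tensorHom, Algebra.TensorProduct.map_tmul, tensorEquiv_tmul, hf,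
      hg]

theorem endMap_associator_tensorEquiv (t : (A ⊗[k] B) ⊗[k] C) :
    endMap (α_ X Y Z).hom (D.tensorEquiv e (D.tensorEquiv e' e'')
      (Algebra.TensorProduct.assoc k k k A B C t)) =
      D.tensorEquiv (D.tensorEquiv e e') e'' t := by
  induction t with
  | zero => simp only [map_zero]
  | add x y hx hy => simp only [map_add, hx, hy]
  | tmul t c =>
    induction t with
    | zero => simp only [TensorProduct.zero_tmul, map_zero]
    | add x y hx hy => simp only [TensorProduct.add_tmul, map_add, hx, hy]
    | tmul a b => exact D.endMap_associator X Y Z (e a) (e' b) (e'' c)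

theorem endMap_leftUnitor_tensorEquiv (b : B) :
    endMap (λ_ Y).hom (e' b) = D.tensorEquiv D.unitAlg e' (1 ⊗ₜ b) := by
  rw [D.endMap_leftUnitor, tensorEquiv_tmul, map_one]

theorem endMap_rightUnitor_tensorEquiv (a : A) :
    endMap (ρ_ X).hom (e a) = D.tensorEquiv e D.unitAlg (a ⊗ₜ 1) := by
  rw [D.endMap_rightUnitor, tensorEquiv_tmul, map_one]

/-- The interchange of the two inner factors, used for the tensor product of monoids, acts on pure
tensors as expected. -/
theorem endMap_tensorμ (X₁ X₂ Y₁ Y₂ : Slice k) (a : End X₁.F) (b : End Y₁.F) (c : End X₂.F)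
    (d : End Y₂.F) : endMap (tensorμ X₁ X₂ Y₁ Y₂) ((D.prod (X₁ ⊗ Y₁) (X₂ ⊗ Y₂)).theta
      ((D.prod X₁ Y₁).theta (a ⊗ₜ b) ⊗ₜ (D.prod X₂ Y₂).theta (c ⊗ₜ d))) =
      (D.prod (X₁ ⊗ X₂) (Y₁ ⊗ Y₂)).theta
        ((D.prod X₁ X₂).theta (a ⊗ₜ c) ⊗ₜ (D.prod Y₁ Y₂).theta (b ⊗ₜ d)) := by
  simp only [tensorμ, endMap_comp, D.endMap_associator_inv, D.endMap_whiskerLeft,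
    D.endMap_associator, D.endMap_whiskerRight, D.endMap_braiding]

end Tensor

/-- The bialgebra `A` is dual to the monoid `X`, by means of an identification of `A` with the
endomorphism algebra of the fibre functor: the multiplication and the unit of `X` induce the
comultiplication and the counit of `A`. -/
structure IsDual (X : Slice k) [MonObj X] {A : Type u} [Ring A] [Bialgebra k A]
    (e : A ≃ₐ[k] End X.F) : Prop where
  mul : ∀ a, endMap (MonObj.mul (X := X)) (e a) = D.tensorEquiv e e (Coalgebra.comul (R := k) a)
  one : ∀ a, endMap (MonObj.one (X := X)) (e a) = D.unitAlg (Coalgebra.counit (R := k) a)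

variable {D} in
/-- Monoid homomorphisms are dual to bialgebra homomorphisms. -/
theorem IsDual.isMonHom_iff {X Y : Slice k} [MonObj X] [MonObj Y] {A B : Type u} [Ring A]
    [Bialgebra k A] [Ring B] [Bialgebra k B] {e : A ≃ₐ[k] End X.F} {e' : B ≃ₐ[k] End Y.F}
    (he : D.IsDual X e) (he' : D.IsDual Y e') {f : X ⟶ Y} {φ : B →ₐ[k] A}
    (hf : ∀ b, endMap f (e' b) = e (φ b)) :
    IsMonHom f ↔ (Bialgebra.counitAlgHom k A).comp φ = Bialgebra.counitAlgHom k B ∧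
      (Algebra.TensorProduct.map φ φ).comp (Bialgebra.comulAlgHom k B) =
        (Bialgebra.comulAlgHom k A).comp φ := by
  have h₁ : ∀ b, endMap (MonObj.one (X := X) ≫ f) (e' b) =
      D.unitAlg (Coalgebra.counit (R := k) (φ b)) := fun b => by
    rw [endMap_comp, hf, he.one]
  have h₂ : ∀ b, endMap (MonObj.mul (X := X) ≫ f) (e' b) =
      D.tensorEquiv e e (Coalgebra.comul (R := k) (φ b)) := fun b => by
    rw [endMap_comp, hf, he.mul]
  have h₃ : ∀ b, endMap ((f ⊗ₘ f) ≫ MonObj.mul (X := Y)) (e' b) = D.tensorEquiv e e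
      (Algebra.TensorProduct.map φ φ (Coalgebra.comul (R := k) b)) := fun b => by
    rw [endMap_comp, he'.mul, D.endMap_tensorHom_tensorEquiv hf hf]
  constructor
  · intro h
    refine ⟨AlgHom.ext fun b => D.unitAlg.injective ?_,
      AlgHom.ext fun b => (D.tensorEquiv e e).injective ?_⟩
    · have := he'.one b
      rw [← IsMonHom.one_hom f, h₁] at this
      exact this
    · have := h₃ b
      rw [← IsMonHom.mul_hom f, h₂] at this
      exact this.symm
  · rintro ⟨h, h'⟩
    refine ⟨endMap_injective fun η => ?_, endMap_injective fun η => ?_⟩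
    · obtain ⟨b, rfl⟩ := e'.surjective η
      rw [h₁, he'.one]
      exact congrArg D.unitAlg (AlgHom.congr_fun h b)
    · obtain ⟨b, rfl⟩ := e'.surjective η
      rw [h₂, h₃]
      exact congrArg (D.tensorEquiv e e) (AlgHom.congr_fun h' b).symm

section DualBialgebra

variable {X : Slice k} [MonObj X] {A : Type u} [Ring A] [Algebra k A] (e : A ≃ₐ[k] End X.F)

/-- The comultiplication induced by the multiplication of a monoid. -/
def dualComul : A →ₐ[k] A ⊗[k] A :=
  (D.tensorEquiv e e).symm.toAlgHom.comp ((endMap (MonObj.mul (X := X))).comp e.toAlgHom)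

theorem endMap_mul (a : A) :
    endMap (MonObj.mul (X := X)) (e a) = D.tensorEquiv e e (D.dualComul e a) :=
  ((D.tensorEquiv e e).apply_symm_apply _).symm

theorem dualComul_coassoc : (Algebra.TensorProduct.assoc k k k A A A).toAlgHom.comp
    ((Algebra.TensorProduct.map (D.dualComul e) (.id k A)).comp (D.dualComul e)) =
      (Algebra.TensorProduct.map (.id k A) (D.dualComul e)).comp (D.dualComul e) := by
  have hid : ∀ a, endMap (𝟙 X) (e a) = e (AlgHom.id k A a) := fun a => endMap_id X (e a)
  refine AlgHom.ext fun a => (D.tensorEquiv e (D.tensorEquiv e e)).injective ?_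
  have h := congrArg (fun f => endMap f (e a)) (MonObj.mul_assoc X)
  simp only [endMap_comp, ← tensorHom_id, ← id_tensorHom, D.endMap_mul,
    D.endMap_tensorHom_tensorEquiv (D.endMap_mul e) hid,
    D.endMap_tensorHom_tensorEquiv hid (D.endMap_mul e)] at h
  rw [← D.endMap_associator_tensorEquiv] at h
  have h' := congrArg (endMap (α_ X X X).inv) h
  rw [← endMap_comp, ← endMap_comp, Iso.inv_hom_id, endMap_id, endMap_id] at h'
  exact h'

theorem dualCounit_rTensor : (Algebra.TensorProduct.map (D.dualCounit e) (.id k A)).comp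
    (D.dualComul e) = (Algebra.TensorProduct.lid k A).symm := by
  have hid : ∀ a, endMap (𝟙 X) (e a) = e (AlgHom.id k A a) := fun a => endMap_id X (e a)
  refine AlgHom.ext fun a => (D.tensorEquiv D.unitAlg e).injective ?_
  have h := congrArg (fun f => endMap f (e a)) (MonObj.one_mul X)
  simp only [endMap_comp, ← tensorHom_id, D.endMap_mul,
    D.endMap_tensorHom_tensorEquiv (D.endMap_one e) hid, D.endMap_leftUnitor_tensorEquiv] at h
  exact h

theorem dualCounit_lTensor : (Algebra.TensorProduct.map (.id k A) (D.dualCounit e)).comp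
    (D.dualComul e) = (Algebra.TensorProduct.rid k k A).symm := by
  have hid : ∀ a, endMap (𝟙 X) (e a) = e (AlgHom.id k A a) := fun a => endMap_id X (e a)
  refine AlgHom.ext fun a => (D.tensorEquiv e D.unitAlg).injective ?_
  have h := congrArg (fun f => endMap f (e a)) (MonObj.mul_one X)
  simp only [endMap_comp, ← id_tensorHom, D.endMap_mul,
    D.endMap_tensorHom_tensorEquiv hid (D.endMap_one e), D.endMap_rightUnitor_tensorEquiv] at h
  exact h

/-- The bialgebra structure dual to a monoid structure. -/
abbrev dualBialgebra : Bialgebra k A :=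
  Bialgebra.ofAlgHom (D.dualComul e) (D.dualCounit e) (D.dualComul_coassoc e)
    (D.dualCounit_rTensor e) (D.dualCounit_lTensor e)

theorem isDual_dualBialgebra : letI := D.dualBialgebra e; D.IsDual X e :=
  letI := D.dualBialgebra e
  ⟨D.endMap_mul e, D.endMap_one e⟩

end DualBialgebra

variable {D} in
/-- The dual of a tensor product of monoids is the tensor product of the dual bialgebras. -/
theorem IsDual.tensor {M N : Mon (Slice k)} {A B : Type u} [Ring A] [Bialgebra k A] [Ring B]
    [Bialgebra k B] {e : A ≃ₐ[k] End M.X.F} {e' : B ≃ₐ[k] End N.X.F} (he : D.IsDual M.X e)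
    (he' : D.IsDual N.X e') : D.IsDual (M ⊗ N).X (D.tensorEquiv e e') where
  mul t := by
    have key : ∀ s : (A ⊗[k] A) ⊗[k] (B ⊗[k] B),
        endMap (tensorμ M.X N.X M.X N.X) (D.tensorEquiv (D.tensorEquiv e e)
          (D.tensorEquiv e' e') s) = D.tensorEquiv (D.tensorEquiv e e') (D.tensorEquiv e e')
            (TensorProduct.tensorTensorTensorComm k A A B B s) := fun s => by
      induction s with
      | zero => simp only [map_zero]
      | add x y hx hy => simp only [map_add, hx, hy]
      | tmul s s' =>
        induction s with
        | zero => simp only [TensorProduct.zero_tmul, map_zero]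
        | add x y hx hy => simp only [TensorProduct.add_tmul, map_add, hx, hy]
        | tmul a b =>
          induction s' with
          | zero => simp only [TensorProduct.tmul_zero, map_zero]
          | add x y hx hy => simp only [TensorProduct.tmul_add, map_add, hx, hy]
          | tmul c d => exact D.endMap_tensorμ M.X N.X M.X N.X (e a) (e b) (e' c) (e' d)
    rw [Mon.tensorObj_mul, endMap_comp]
    have h := D.endMap_tensorHom_tensorEquiv (φ := Bialgebra.comulAlgHom k A)
      (ψ := Bialgebra.comulAlgHom k B) he.mul he'.mul t
    refine (congrArg _ h).trans ((key _).trans ?_)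
    rfl
  one t := by
    rw [Mon.tensorObj_one, endMap_comp]
    have h := D.endMap_tensorHom_tensorEquiv (φ := Bialgebra.counitAlgHom k A)
      (ψ := Bialgebra.counitAlgHom k B) he.one he'.one t
    refine (congrArg _ h).trans ?_
    have key : ∀ s : k ⊗[k] k,
        endMap (λ_ (𝟙_ (Slice k))).inv (D.tensorEquiv D.unitAlg D.unitAlg s) =
        D.unitAlg (TensorProduct.lid k k s) := fun s => by
      obtain ⟨r, rfl⟩ := (TensorProduct.lid k k).symm.surjective s
      rw [LinearEquiv.apply_symm_apply, TensorProduct.lid_symm_apply,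
        ← D.endMap_leftUnitor_tensorEquiv, ← endMap_comp, Iso.inv_hom_id, endMap_id]
    refine (key _).trans (congrArg D.unitAlg ?_)
    clear h
    induction t with
    | zero => simp only [map_zero]
    | add x y hx hy => simp only [map_add, hx, hy]
    | tmul a b => simp [mul_comm]

theorem isDual_unit : D.IsDual (𝟙_ (Mon (Slice k))).X D.unitAlg where
  mul r := D.endMap_leftUnitor_tensorEquiv D.unitAlg r
  one r := by
    rw [Mon.tensorUnit_one, endMap_id]
    rfl

end DeligneStructure

end BialgebraReconstruction

end
noncomputable section

namespace BialgebraReconstruction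

/-! ### The functor from bialgebras to monoids in `Slice` -/

namespace DeligneStructure

variable {k : Type u} [Field k] [IsAlgClosed k] [MonoidalCategory (Slice k)]
  [SymmetricCategory (Slice k)] (D : DeligneStructure k)

variable {D} in
/-- Two monoids with the same dual bialgebra are isomorphic. -/
def IsDual.iso {M N : Mon (Slice k)} {A : Type u} [Ring A] [Bialgebra k A]
    {e : A ≃ₐ[k] End M.X.F} {e' : A ≃ₐ[k] End N.X.F} (he : D.IsDual M.X e)
    (he' : D.IsDual N.X e') : M ≅ N :=
  haveI : IsMonHom (isoOfAlg (e'.symm.trans e)).hom :=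
    (he.isMonHom_iff he' (φ := AlgHom.id k A) fun a => by
      rw [endMap_isoOfAlg_hom, AlgEquiv.trans_apply, AlgEquiv.symm_apply_apply]; rfl).2
      ⟨rfl, by rw [Algebra.TensorProduct.map_id]; rfl⟩
  Mon.mkIso' (isoOfAlg (e'.symm.trans e))

variable {D} in
theorem IsDual.endMap_iso_hom {M N : Mon (Slice k)} {A : Type u} [Ring A] [Bialgebra k A]
    {e : A ≃ₐ[k] End M.X.F} {e' : A ≃ₐ[k] End N.X.F} (he : D.IsDual M.X e)
    (he' : D.IsDual N.X e') (a : A) : endMap (he.iso he').hom.hom (e' a) = e a :=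
  (endMap_isoOfAlg_hom _ _).trans (congrArg e (e'.symm_apply_apply a))

/-- The canonical monoid of a monoidal fibre functor. -/
def canonicalMon (X : FiberFunctor k) : Mon (Slice k) where
  X := X.toSlice
  mon := (X.exists_isCanonicalMonoid D).choose

theorem isCanonicalMonoid_canonicalMon (X : FiberFunctor k) :
    IsCanonicalMonoid D X (D.canonicalMon X).mon :=
  (X.exists_isCanonicalMonoid D).choose_spec

/-- The monoid `(Mod(A), Forget)`. -/
abbrev modMon (A : SSBialg k) : Mon (Slice k) := D.canonicalMon (modFiber A)

/-- `A` is the endomorphism algebra of the forgetful functor of `Mod(A)`. -/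
def modAct (A : SSBialg k) : A.obj ≃ₐ[k] End (D.modMon A).X.F := FDMod.act k A.obj

/-- The bialgebra `A` is dual to the canonical monoid `(Mod(A), Forget)`: `A` acts on `V ⊗ W`
through the comultiplication, and on the unit through the counit. -/
theorem isDual_modMon (A : SSBialg k) : D.IsDual (D.modMon A).X (D.modAct A) where
  mul a := by
    refine (D.prod _ _).end_ext fun V W => ?_
    have h := (sends_iff.1 ((D.isCanonicalMonoid_canonicalMon (modFiber A)).mul V W)).2
      (D.modAct A a)
    have h' := D.tensorEquiv_app (D.modAct A) (D.modAct A) (Coalgebra.comul (R := k) a) V W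
    rw [← Iso.eq_inv_comp] at h'
    have aux : ∀ {P Q : Vec k} (i : P ≅ Q) (x : Q ⟶ Q) (y : P ⟶ P),
        x ≫ i.inv ≫ 𝟙 P = (i.inv ≫ 𝟙 P) ≫ y → x = i.inv ≫ y ≫ i.hom := fun i x y h => by
      rw [Category.comp_id] at h
      rw [← reassoc_of% h, Iso.inv_hom_id, Category.comp_id]
    exact (aux ((D.prod (D.modMon A).X (D.modMon A).X).fib V W) _ _ h).trans h'.symm
  one a := by
    obtain ⟨e, q, hq⟩ := D.exists_unit_object
    refine ((D.isCanonicalMonoid_canonicalMon (modFiber A)).one e q hq).endMap_eq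
      (D.leg_unit_injective (sends_iff.1 hq).1) ?_
    have aux : ∀ {P : Vec k} (q : P ⟶ 𝟙_ (Vec k)) (r : k), (r • 𝟙 P) ≫ q ≫ 𝟙 (𝟙_ (Vec k)) =
        (q ≫ 𝟙 (𝟙_ (Vec k))) ≫ (r • 𝟙 (𝟙_ (Vec k))) := fun q r => by
      rw [Linear.smul_comp, Linear.comp_smul, Category.id_comp, Category.comp_id, Category.comp_id]
    exact aux q (Coalgebra.counit (R := k) a)

/-- Restriction along `f` is dual to `f`. -/
theorem endMap_modMap {A B : SSBialg k} (f : A ⟶ B) (a : A.obj) :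
    endMap (X := (D.modMon B).X) (Y := (D.modMon A).X) (modMap f).toHom (D.modAct A a) =
      D.modAct B (f.hom.toBialgHom a) := by
  refine NatTrans.ext (funext fun V => ?_)
  exact (Category.id_comp _).trans (Category.comp_id _)

theorem isMonHom_modMap {A B : SSBialg k} (f : A ⟶ B) :
    IsMonHom (M := (D.modMon B).X) (N := (D.modMon A).X) (modMap f).toHom :=
  ((D.isDual_modMon B).isMonHom_iff (D.isDual_modMon A)
    (φ := (f.hom.toBialgHom : A.obj →ₐ[k] B.obj)) (D.endMap_modMap f)).2
      ⟨BialgHom.counitAlgHom_comp f.hom.toBialgHom,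
        BialgHom.map_comp_comulAlgHom f.hom.toBialgHom⟩

/-- The functor `A ↦ (Mod(A), Forget)` with values in monoids. -/
def modMonFunctor : (SSBialg k)ᵒᵖ ⥤ Mon (Slice k) where
  obj A := D.modMon A.unop
  map f := { hom := (modMap f.unop).toHom, isMonHom_hom := D.isMonHom_modMap f.unop }
  map_id A := Mon.Hom.ext ((modFunctor k).map_id A)
  map_comp f g := Mon.Hom.ext ((modFunctor k).map_comp f g)

theorem endMap_modMonFunctor_map {A B : (SSBialg k)ᵒᵖ} (f : A ⟶ B) (b : B.unop.obj) :
    endMap (D.modMonFunctor.map f).hom (D.modAct B.unop b) =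
      D.modAct A.unop (f.unop.hom.toBialgHom b) := D.endMap_modMap f.unop b

instance : D.modMonFunctor.Faithful where
  map_injective {A B} f g h := Quiver.Hom.unop_inj <| ObjectProperty.hom_ext _ <|
    BialgCat.hom_ext _ _ <| BialgHom.ext fun b => (D.modAct A.unop).injective <| by
      rw [← endMap_modMonFunctor_map, ← endMap_modMonFunctor_map, h]

/-- A monoid homomorphism between categories of modules induces a homomorphism of the dual
bialgebras, and it is the restriction along it. -/
instance : D.modMonFunctor.Full where
  map_surjective {A B} g := by
    let φ : B.unop.obj →ₐ[k] A.unop.obj :=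
      (D.modAct A.unop).symm.toAlgHom.comp ((endMap g.hom).comp (D.modAct B.unop).toAlgHom)
    have hφ : ∀ b, endMap g.hom (D.modAct B.unop b) = D.modAct A.unop (φ b) := fun b =>
      ((D.modAct A.unop).apply_symm_apply _).symm
    obtain ⟨h₁, h₂⟩ := ((D.isDual_modMon A.unop).isMonHom_iff (D.isDual_modMon B.unop) hφ).1
      g.isMonHom_hom
    refine ⟨(ObjectProperty.homMk (BialgCat.ofHom (BialgHom.ofAlgHom φ h₁ h₂))).op,
      Mon.Hom.ext (endMap_injective fun η => ?_)⟩
    obtain ⟨b, rfl⟩ := (D.modAct B.unop).surjective η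
    rw [hφ, endMap_modMonFunctor_map]
    rfl

/-- Every monoid in `Slice` has a dual finite-dimensional semisimple bialgebra. -/
theorem exists_isDual (M : Mon (Slice k)) :
    ∃ (A : SSBialg k) (e : A.obj ≃ₐ[k] End M.X.F), D.IsDual M.X e := by
  obtain ⟨-, A, _, _, hA, hA', ⟨e⟩⟩ := M.X.exists_universal_and_model
  let := D.dualBialgebra e
  exact ⟨⟨BialgCat.of k A, hA, hA'⟩, e, D.isDual_dualBialgebra e⟩

instance : D.modMonFunctor.EssSurj where
  mem_essImage M := by
    obtain ⟨A, e, he⟩ := D.exists_isDual M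
    exact ⟨op A, ⟨(D.isDual_modMon A).iso he⟩⟩

instance : D.modMonFunctor.IsEquivalence where

/-- The comparison `(Mod(A), Forget) ⊗ (Mod(B), Forget) ≅ (Mod(A ⊗ B), Forget)`. -/
def modMonTensor (A B : SSBialg k) : D.modMon A ⊗ D.modMon B ≅ D.modMon (A ⊗ B) :=
  ((D.isDual_modMon A).tensor (D.isDual_modMon B)).iso (D.isDual_modMon (A ⊗ B))

theorem endMap_modMonTensor {A B : SSBialg k} (t : A.obj ⊗[k] B.obj) :
    endMap (D.modMonTensor A B).hom.hom (D.modAct (A ⊗ B) t) =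
      D.tensorEquiv (D.modAct A) (D.modAct B) t :=
  IsDual.endMap_iso_hom _ _ t

variable (k) in
/-- The comparison between the unit and `(Mod(k), Forget)`. -/
def modMonUnit : 𝟙_ (Mon (Slice k)) ≅ D.modMon (𝟙_ (SSBialg k)) :=
  D.isDual_unit.iso (D.isDual_modMon (𝟙_ (SSBialg k)))

theorem endMap_modMonUnit (r : k) :
    endMap (D.modMonUnit k).hom.hom (D.modAct (𝟙_ (SSBialg k)) r) = D.unitAlg r :=
  IsDual.endMap_iso_hom _ _ r

end DeligneStructure

end BialgebraReconstruction

end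
noncomputable section

namespace BialgebraReconstruction

/-! ### Compatibility with tensor products -/

namespace DeligneStructure

variable {k : Type u} [Field k] [IsAlgClosed k] [MonoidalCategory (Slice k)]
  [SymmetricCategory (Slice k)] (D : DeligneStructure k)

theorem endMap_whiskerRight_tensorEquiv {X X' Y : Slice k} {A B : Type u} [Ring A] [Algebra k A]
    [Ring B] [Algebra k B] {e : A ≃ₐ[k] End X.F} {e₁ : A ≃ₐ[k] End X'.F} (e' : B ≃ₐ[k] End Y.F)
    {f : X ⟶ X'} (hf : ∀ a, endMap f (e₁ a) = e a) (t : A ⊗[k] B) :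
    endMap (f ▷ Y) (D.tensorEquiv e₁ e' t) = D.tensorEquiv e e' t := by
  rw [← tensorHom_id, D.endMap_tensorHom_tensorEquiv (φ := AlgHom.id k A) (ψ := AlgHom.id k B) hf
    (fun b => endMap_id Y (e' b)), Algebra.TensorProduct.map_id, AlgHom.id_apply]

theorem endMap_whiskerLeft_tensorEquiv {X Y Y' : Slice k} {A B : Type u} [Ring A] [Algebra k A]
    [Ring B] [Algebra k B] (e : A ≃ₐ[k] End X.F) {e' : B ≃ₐ[k] End Y.F} {e₁ : B ≃ₐ[k] End Y'.F}
    {f : Y ⟶ Y'} (hf : ∀ b, endMap f (e₁ b) = e' b) (t : A ⊗[k] B) :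
    endMap (X ◁ f) (D.tensorEquiv e e₁ t) = D.tensorEquiv e e' t := by
  rw [← id_tensorHom, D.endMap_tensorHom_tensorEquiv (φ := AlgHom.id k A) (ψ := AlgHom.id k B)
    (fun a => endMap_id X (e a)) hf, Algebra.TensorProduct.map_id, AlgHom.id_apply]

/-- Homomorphisms to `(Mod(A), Forget)` are determined on `A`. -/
theorem hom_modMon_ext {M : Mon (Slice k)} {A : SSBialg k} {f g : M ⟶ D.modMon A}
    (h : ∀ a : A.obj, endMap f.hom (D.modAct A a) = endMap g.hom (D.modAct A a)) : f = g :=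
  Mon.Hom.ext <| endMap_injective fun η => by
    obtain ⟨a, rfl⟩ := (D.modAct A).surjective η
    exact h a

/-- The monoidal structure of `A ↦ (Mod(A), Forget)`. -/
def modMonCoreMonoidal : D.modMonFunctor.CoreMonoidal where
  εIso := D.modMonUnit k
  μIso A B := D.modMonTensor A.unop B.unop
  μIso_hom_natural_left {A B} f C := D.hom_modMon_ext fun t => by
    have h₁ := D.endMap_modMonTensor (A := B.unop) (B := C.unop) t
    have h₂ := D.endMap_modMonTensor (A := A.unop) (B := C.unop)
      ((f ▷ C).unop.hom.toBialgHom t)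
    have h₃ := D.endMap_modMonFunctor_map (f ▷ C) t
    have h₄ := D.endMap_tensorHom_tensorEquiv (f := (D.modMonFunctor.map f).hom)
      (g := 𝟙 (D.modMon C.unop).X) (φ := (f.unop.hom.toBialgHom : B.unop.obj →ₐ[k] A.unop.obj))
      (ψ := AlgHom.id k C.unop.obj) (D.endMap_modMonFunctor_map f)
      (fun c => endMap_id _ (D.modAct C.unop c)) t
    rw [tensorHom_id] at h₄
    exact (endMap_comp_eq h₁ h₄).trans (endMap_comp_eq h₃ h₂).symm
  μIso_hom_natural_right {A B} C f := D.hom_modMon_ext fun t => by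
    have h₁ := D.endMap_modMonTensor (A := C.unop) (B := B.unop) t
    have h₂ := D.endMap_modMonTensor (A := C.unop) (B := A.unop)
      ((C ◁ f).unop.hom.toBialgHom t)
    have h₃ := D.endMap_modMonFunctor_map (C ◁ f) t
    have h₄ := D.endMap_tensorHom_tensorEquiv (g := (D.modMonFunctor.map f).hom)
      (f := 𝟙 (D.modMon C.unop).X) (ψ := (f.unop.hom.toBialgHom : B.unop.obj →ₐ[k] A.unop.obj))
      (φ := AlgHom.id k C.unop.obj) (fun c => endMap_id _ (D.modAct C.unop c))
      (D.endMap_modMonFunctor_map f) t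
    rw [id_tensorHom] at h₄
    exact (endMap_comp_eq h₁ h₄).trans (endMap_comp_eq h₃ h₂).symm
  associativity A B C := D.hom_modMon_ext fun t => by
    obtain ⟨s, rfl⟩ := (Algebra.TensorProduct.assoc k k k A.unop.obj B.unop.obj
      C.unop.obj).surjective t
    have h₁ := D.endMap_modMonFunctor_map (α_ A B C).hom
      (Algebra.TensorProduct.assoc k k k A.unop.obj B.unop.obj C.unop.obj s)
    have h₁' : (α_ A B C).hom.unop.hom.toBialgHom
        (Algebra.TensorProduct.assoc k k k A.unop.obj B.unop.obj C.unop.obj s) = s :=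
      (Algebra.TensorProduct.assoc k k k A.unop.obj B.unop.obj C.unop.obj).symm_apply_apply s
    rw [h₁'] at h₁
    have h₂ := D.endMap_modMonTensor (A := A.unop ⊗ B.unop) (B := C.unop) s
    have h₃ := D.endMap_whiskerRight_tensorEquiv (D.modAct C.unop)
      (D.endMap_modMonTensor (A := A.unop) (B := B.unop)) s
    have h₄ := D.endMap_modMonTensor (A := A.unop) (B := B.unop ⊗ C.unop)
      (Algebra.TensorProduct.assoc k k k A.unop.obj B.unop.obj C.unop.obj s)
    have h₅ := D.endMap_whiskerLeft_tensorEquiv (D.modAct A.unop)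
      (D.endMap_modMonTensor (A := B.unop) (B := C.unop))
      (Algebra.TensorProduct.assoc k k k A.unop.obj B.unop.obj C.unop.obj s)
    have h₆ := D.endMap_associator_tensorEquiv (D.modAct A.unop) (D.modAct B.unop)
      (D.modAct C.unop) s
    exact (endMap_comp_eq (endMap_comp_eq h₁ h₂) h₃).trans
      (endMap_comp_eq (endMap_comp_eq h₄ h₅) h₆).symm
  left_unitality A := D.hom_modMon_ext fun a => by
    have h₁ := D.endMap_modMonFunctor_map (λ_ A).hom a
    have h₂ := D.endMap_modMonTensor (A := 𝟙_ (SSBialg k)) (B := A.unop)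
      ((1 : k) ⊗ₜ[k] a)
    have h₃ := D.endMap_whiskerRight_tensorEquiv (D.modAct A.unop) D.endMap_modMonUnit
      ((1 : k) ⊗ₜ[k] a)
    have h₄ := D.endMap_leftUnitor_tensorEquiv (D.modAct A.unop) a
    exact h₄.trans (endMap_comp_eq (endMap_comp_eq h₁ h₂) h₃).symm
  right_unitality A := D.hom_modMon_ext fun a => by
    have h₁ := D.endMap_modMonFunctor_map (ρ_ A).hom a
    have h₂ := D.endMap_modMonTensor (B := 𝟙_ (SSBialg k)) (A := A.unop)
      (a ⊗ₜ[k] (1 : k))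
    have h₃ := D.endMap_whiskerLeft_tensorEquiv (D.modAct A.unop) D.endMap_modMonUnit
      (a ⊗ₜ[k] (1 : k))
    have h₄ := D.endMap_rightUnitor_tensorEquiv (D.modAct A.unop) a
    exact h₄.trans (endMap_comp_eq (endMap_comp_eq h₁ h₂) h₃).symm

instance : D.modMonFunctor.Monoidal := D.modMonCoreMonoidal.toMonoidal

/-- `A ↦ (Mod(A), Forget)` as an equivalence; the inverse is `(C, F) ↦ End(F)`. -/
def modMonEquivalence : (SSBialg k)ᵒᵖ ≌ Mon (Slice k) := D.modMonFunctor.asEquivalence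

/-- The comparison `Mod(A) ⊠ Mod(B) ≅ Mod(A ⊗ B)` sends `V ⊠ W` to `V ⊗ W`, because it is dual to
the identity of `A ⊗ B`, which acts on both fibres in the same way. -/
theorem isModFunctor : IsModFunctor D D.modMonFunctor := by
  refine ⟨Iso.refl _, fun A => ⟨(D.modMon A).mon, D.isCanonicalMonoid_canonicalMon _, ?_⟩,
    fun A B V W => ?_⟩
  · exact inferInstanceAs (IsMonHom (𝟙 (D.modMon A).X))
  · have := Iso.isIso_inv ((D.prod (modFiber A).toSlice (modFiber B).toSlice).fib V W)
    refine sends_iff.2 ⟨by exact this, fun η => ?_⟩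
    obtain ⟨t, rfl⟩ := (D.modAct (A ⊗ B)).surjective η
    have h : ∀ s : (D.modMon A).X ⊗ (D.modMon B).X ⟶ (D.modMon (A ⊗ B)).X,
        (𝟙 (D.modMon A).X ⊗ₘ 𝟙 (D.modMon B).X) ≫ s ≫ 𝟙 (D.modMon (A ⊗ B)).X = s := fun s => by
      rw [id_tensorHom_id, Category.id_comp, Category.comp_id]
    have h₁ := (congrArg (fun s => endMap s (D.modAct (A ⊗ B) t))
      (h (D.modMonTensor A B).hom.hom)).trans (D.endMap_modMonTensor t)
    have h₂ := D.tensorEquiv_app (D.modAct A) (D.modAct B) t V W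
    rw [← Iso.eq_inv_comp, ← Category.assoc, ← Iso.comp_inv_eq] at h₂
    exact (congrArg (fun ξ : End ((D.modMon A).X ⊗ (D.modMon B).X).F =>
      NatTrans.app ξ _ ≫ ((D.prod (D.modMon A).X (D.modMon B).X).fib V W).inv) h₁).trans h₂

end DeligneStructure

end BialgebraReconstruction

end
noncomputable section

namespace BialgebraReconstruction

/-! ### The inverse equivalence -/

/-- An isomorphism in `Slice` induces an isomorphism of endomorphism algebras. -/
def endMapEquiv {k : Type u} [Field k] {X Y : Slice k} (f : X ≅ Y) : End Y.F ≃ₐ[k] End X.F :=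
  AlgEquiv.ofAlgHom (endMap f.hom) (endMap f.inv)
    (AlgHom.ext fun η => by
      rw [AlgHom.comp_apply, ← endMap_comp, f.hom_inv_id, endMap_id, AlgHom.id_apply])
    (AlgHom.ext fun η => by
      rw [AlgHom.comp_apply, ← endMap_comp, f.inv_hom_id, endMap_id, AlgHom.id_apply])

namespace DeligneStructure

variable {k : Type u} [Field k] [IsAlgClosed k] [MonoidalCategory (Slice k)]
  [SymmetricCategory (Slice k)] (D : DeligneStructure k)

variable {D} in
/-- Duality is transported along monoid homomorphisms which are bijective on natural
endomorphisms. -/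
theorem IsDual.of_isMonHom {X Y : Slice k} [MonObj X] [MonObj Y] {A : Type u} [Ring A]
    [Bialgebra k A] {e : A ≃ₐ[k] End X.F} {e' : A ≃ₐ[k] End Y.F} (he' : D.IsDual Y e') {f : X ⟶ Y}
    [IsMonHom f] (hf : ∀ a, endMap f (e' a) = e a) : D.IsDual X e where
  mul a := by
    rw [← hf, ← endMap_comp, IsMonHom.mul_hom, endMap_comp, he'.mul,
      D.endMap_tensorHom_tensorEquiv (φ := AlgHom.id k A) (ψ := AlgHom.id k A) hf hf,
      Algebra.TensorProduct.map_id, AlgHom.id_apply]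
  one a := by
    rw [← hf, ← endMap_comp, IsMonHom.one_hom, he'.one]

section Inverse

variable (M N : Mon (Slice k))

/-- The bialgebra `End(F)` of a monoid in `Slice`. -/
abbrev endBialg : SSBialg k := (D.modMonEquivalence.inverse.obj M).unop

/-- The comparison `(C, F) ≅ (Mod(End(F)), Forget)`. -/
abbrev toModMon : M ⟶ D.modMon (D.endBialg M) := D.modMonEquivalence.counitIso.inv.app M

/-- The value of the inverse equivalence at `(C, F)` is the algebra `End(F)`. -/
def endBialgEquiv : (D.endBialg M).obj ≃ₐ[k] End M.X.F :=
  (D.modAct (D.endBialg M)).trans (endMapEquiv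
    ((Mon.forget (Slice k)).mapIso (D.modMonEquivalence.counitIso.app M)).symm)

variable {M N} in
/-- `toModMon` is dual to the identification of `endBialg M` with `End(F)`; this is the definition
of the latter. -/
theorem endMap_toModMon (a : (D.endBialg M).obj) :
    endMap (D.toModMon M).hom (D.modAct (D.endBialg M) a) = D.endBialgEquiv M a := rfl

/-- The bialgebra structure of `endBialg M` is the one induced by the monoid structure of `M`,
because `toModMon` is an isomorphism of monoids. -/
theorem isDual_endBialg : D.IsDual M.X (D.endBialgEquiv M) :=
  (D.isDual_modMon (D.endBialg M)).of_isMonHom (f := (D.toModMon M).hom) D.endMap_toModMon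

instance : D.modMonEquivalence.functor.Monoidal := inferInstanceAs D.modMonFunctor.Monoidal

instance : D.modMonEquivalence.inverse.Monoidal := D.modMonEquivalence.inverseMonoidal

instance : D.modMonEquivalence.IsMonoidal := Adjunction.IsMonoidal.mk rfl fun _ _ => rfl

/-- The counit of the monoidal equivalence is compatible with tensor products. -/
theorem toModMon_tensor : D.toModMon (M ⊗ N) = (D.toModMon M ⊗ₘ D.toModMon N) ≫
    Functor.LaxMonoidal.μ D.modMonFunctor _ _ ≫
      D.modMonFunctor.map (Functor.LaxMonoidal.μ D.modMonEquivalence.inverse M N) := by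
  have h := D.modMonEquivalence.functor_map_μ_inverse_comp_counitIso_hom_app_tensor M N
  rw [← Iso.app_hom, ← Iso.eq_comp_inv] at h
  refine Eq.symm ((congrArg (fun l => _ ≫ _ ≫ l) h).trans ?_)
  rw [Category.assoc]
  refine (congrArg (_ ≫ ·) (Functor.Monoidal.μ_δ_assoc D.modMonFunctor _ _ _)).trans ?_
  have h' := tensorHom_comp_tensorHom (D.modMonEquivalence.counitIso.inv.app M)
    (D.modMonEquivalence.counitIso.inv.app N) (D.modMonEquivalence.counitIso.hom.app M)
    (D.modMonEquivalence.counitIso.hom.app N)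
  rw [Iso.inv_hom_id_app, Iso.inv_hom_id_app] at h'
  exact (Category.assoc _ _ _).symm.trans ((congrArg (· ≫ _)
    (h'.trans (id_tensorHom_id _ _))).trans (Category.id_comp _))

/-- The tensorator of the inverse equivalence is the canonical isomorphism
`End(F) ⊗ End(F') ≅ End(⊗ ∘ (F ⊠ F'))`. -/
theorem endBialgEquiv_tensor (b : (D.endBialg (M ⊗ N)).obj) :
    D.endBialgEquiv (M ⊗ N) b = D.tensorEquiv (D.endBialgEquiv M) (D.endBialgEquiv N)
      ((Functor.LaxMonoidal.μ D.modMonEquivalence.inverse M N).unop.hom.toBialgHom b) := by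
  rw [← endMap_toModMon, toModMon_tensor]
  have h₁ := D.endMap_modMonFunctor_map (Functor.LaxMonoidal.μ D.modMonEquivalence.inverse M N) b
  have h₂ := D.endMap_modMonTensor (A := D.endBialg M) (B := D.endBialg N)
    ((Functor.LaxMonoidal.μ D.modMonEquivalence.inverse M N).unop.hom.toBialgHom b)
  have h₃ := D.endMap_tensorHom_tensorEquiv (φ := AlgHom.id k _) (ψ := AlgHom.id k _)
    (e := D.endBialgEquiv M) (e' := D.endBialgEquiv N) D.endMap_toModMon D.endMap_toModMon
    ((Functor.LaxMonoidal.μ D.modMonEquivalence.inverse M N).unop.hom.toBialgHom b)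
  replace h₃ := h₃.trans (congrArg _ (AlgHom.congr_fun Algebra.TensorProduct.map_id _))
  exact endMap_comp_eq (endMap_comp_eq h₁ h₂) h₃

end Inverse

theorem isEndFunctor : IsEndFunctor D D.modMonEquivalence.inverse := by
  refine ⟨D.endBialgEquiv, fun M N f b => ?_, fun M b c d => ?_, fun M b => ?_,
    fun M N b c d => ?_⟩
  · have h : f ≫ D.toModMon N = D.toModMon M ≫
        D.modMonFunctor.map (D.modMonEquivalence.inverse.map f) :=
      D.modMonEquivalence.counitIso.inv.naturality f
    have h' := congrArg (fun l => endMap (Mon.Hom.hom l) (D.modAct (D.endBialg N) b)) h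
    refine Eq.trans (endMap_comp_eq ?_ (D.endMap_toModMon _)).symm
      (h'.symm.trans (endMap_comp_eq (D.endMap_toModMon b) rfl))
    exact D.endMap_modMonFunctor_map (D.modMonEquivalence.inverse.map f) b
  · rw [(D.isDual_endBialg M).mul]
    exact D.tensorEquiv_app _ _ _ c d
  · exact (D.isDual_endBialg M).one b
  · rw [endBialgEquiv_tensor]
    exact D.tensorEquiv_app _ _ _ c d

end DeligneStructure

end BialgebraReconstruction

end

open BialgebraReconstruction BialgebraReconstruction.Slice
theorem mainTheorem8 (k : Type u) [Field k] [IsAlgClosed k] :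
    (∃ (_ : MonoidalCategory (Slice k)) (_ : SymmetricCategory (Slice k)),
      Nonempty (DeligneStructure k)) ∧
    ∀ [MonoidalCategory (Slice k)] [SymmetricCategory (Slice k)] (D : DeligneStructure k),
      (∃ (E : (SSBialg k)ᵒᵖ ≌ Mon (Slice k)) (_ : E.functor.Monoidal) (_ : E.inverse.Monoidal),
        E.IsMonoidal ∧ IsModFunctor D E.functor ∧ IsEndFunctor D E.inverse) ∧
      (∀ X : FiberFunctor k, ∃! m : MonObj X.toSlice, IsCanonicalMonoid D X m) ∧
      (∀ (X Y : FiberFunctor k) (m : MonObj X.toSlice) (n : MonObj Y.toSlice),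
        IsCanonicalMonoid D X m → IsCanonicalMonoid D Y n →
        ∀ (g : PreHom X.toSlice Y.toSlice) [g.T.Monoidal], NatTrans.IsMonoidal g.τ.hom →
          IsMonHom g.toHom) ∧
      ∀ M : Mon (Slice k), ∃ (X : FiberFunctor k) (m : MonObj X.toSlice),
        IsCanonicalMonoid D X m ∧ Nonempty (M ≅ Mon.mk X.toSlice) := by
  refine ⟨⟨sliceMonoidal k, sliceSymmetric k, ⟨sliceDeligneStructure k⟩⟩, fun D => ⟨?_,
    fun X => X.existsUnique_isCanonicalMonoid D,
    fun X Y m n hm hn g _ hg => FiberFunctor.isMonHom_of_monoidal D hm hn g hg, fun M => ?_⟩⟩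
  · exact ⟨D.modMonEquivalence, inferInstance, inferInstance, inferInstance, D.isModFunctor,
      D.isEndFunctor⟩
  · obtain ⟨A, e, he⟩ := D.exists_isDual M
    exact ⟨modFiber A, (D.modMon A).mon, D.isCanonicalMonoid_canonicalMon _,
      ⟨he.iso (D.isDual_modMon A)⟩⟩
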